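/- The model of computation is the word RAM (deterministic programs, unit cost per instruction, word length $O(1)\cdot\log(\text{input size})$, all computed numbers fit into a word). The Orthogonal Vectors Hypothesis (OVH) states: for every $\varepsilon>0$ there is a $c>0$ such that no algorithm decides in time $O(N^{2-\varepsilon})$, for given sets $A,B\subseteq\{0,1\}^d$ with $|A|=|B|=N$ and $d=\lceil c\log N\rceil$, whether there are $a\in A$, $b\in B$ with $\langle a,b\rangle=0$. A one-dimensional curve of complexity $m$ is the polygonal curve $[0,1]\to\mathbb R$ given by a sequence of $m$ vertices, and $d_F(P,Q)=\min_{f,g}\max_{t\in[0,1]}|P(f(t))-Q(g(t))|$, with $f,g$ ranging over the monotone surjective functions $[0,1]\to[0,1]$, is the continuous Fréchet distance. An $a$-ANN for $n$ curves of complexity $m$ and query complexity $k$, $2\le k\le m$, consists of a preprocessing algorithm, which receives a set $\mathcal P$ of $n$ one-dimensional curves of complexity $m$, the number $k$ and a distance threshold $\delta>0$, and of a query algorithm, which is run on the result of the preprocessing and on a curve $Q$ of complexity $k$ and does the following: if some $P\in\mathcal P$ has $d_F(P,Q)\le\delta$, it returns some $P'\in\mathcal P$ with $d_F(P',Q)\le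 a\delta$; if all $P\in\mathcal P$ have $d_F(P,Q)\ge a\delta$, it returns "no"; otherwise it returns either "no" or some $P\in\mathcal P$ with $d_F(P,Q)\le a\delta$. As usual on the word RAM, all input numbers (vertices and $\delta$) are fractions whose numerators and denominators are at most $(nm)^e$ in absolute value, for a constant $e\ge 1$. Theorem. Assume OVH. For all $\varepsilon,\varepsilon'>0$ and every polynomial preprocessing bound $O(n^{\beta})$, $\beta>0$, there is a $c>0$ such that for every function $k=k(n)\in\omega(1)\cap o(\log n)$ and every constant $e\ge1$ there is no $(2-\varepsilon)$-ANN for the continuous Fréchet distance that supports query curves of complexity $k=k(n)$ and stores $n$ one-dimensional curves of complexity $m=\lceil k\cdot n^{c/k}\rceil$, with preprocessing time $O(n^{\beta})$ and query time $O(n^{1-\varepsilon'})$. -/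

import Mathlib

/-! ### The word RAM

Programs are structured (sequencing, branching, loops) over finitely many registers and finitely
many random-access memory banks.  All words are natural numbers below `2 ^ bits`; a computation
that would produce a larger number is stuck.  Every executed instruction and every evaluated test
costs one step. -/

namespace WordRAM

/-- The unit-cost operations on words.  Shifts are multiplications and divisions by powers of two;
subtraction is truncated at `0`; comparisons return `1` or `0`. -/
inductive BinOp
  | add | sub | mul | div | mod | land | lor | xor | lt | eq

def BinOp.eval : BinOp → ℕ → ℕ → ℕ
  | .add, x, y => x + y
  | .sub, x, y => x - y
  | .mul, x, y => x * y
  | .div, x, y => x / y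
  | .mod, x, y => x % y
  | .land, x, y => x &&& y
  | .lor, x, y => x ||| y
  | .xor, x, y => x ^^^ y
  | .lt, x, y => if x < y then 1 else 0
  | .eq, x, y => if x = y then 1 else 0

/-- Programs.  Registers and memory banks are named by numbers that are fixed in the program text;
only the address inside a bank is computed at run time. -/
inductive Prog
  /-- do nothing -/
  | skip
  /-- `reg r := v` -/
  | const (r v : ℕ)
  /-- `reg r := reg x o reg y` -/
  | op (o : BinOp) (r x y : ℕ)
  /-- `reg r := mem b [reg x]` -/
  | load (b r x : ℕ)
  /-- `mem b [reg x] := reg y` -/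
  | store (b x y : ℕ)
  /-- run `p`, then `q` -/
  | seq (p q : Prog)
  /-- if `reg x ≠ 0` then `p` else `q` -/
  | cond (x : ℕ) (p q : Prog)
  /-- while `reg x ≠ 0` do `p` -/
  | loop (x : ℕ) (p : Prog)

/-- A memory configuration: the registers, and the cells of every memory bank. -/
@[ext] structure State where
  reg : ℕ → ℕ
  mem : ℕ → ℕ → ℕ

def State.setReg (s : State) (r v : ℕ) : State :=
  { s with reg := Function.update s.reg r v }

def State.setMem (s : State) (b i v : ℕ) : State :=
  { s with mem := Function.update s.mem b (Function.update (s.mem b) i v) }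

/-- `Exec bits p s t s'`: on a machine with words of `bits` bits, the program `p` started in the
state `s` halts after exactly `t` steps, without any overflow, in the state `s'`. -/
inductive Exec (bits : ℕ) : Prog → State → ℕ → State → Prop
  | skip (s : State) : Exec bits .skip s 1 s
  | const (s : State) (r v : ℕ) (h : v < 2 ^ bits) :
      Exec bits (.const r v) s 1 (s.setReg r v)
  | op (s : State) (o : BinOp) (r x y : ℕ) (h : o.eval (s.reg x) (s.reg y) < 2 ^ bits) :
      Exec bits (.op o r x y) s 1 (s.setReg r (o.eval (s.reg x) (s.reg y)))
  | load (s : State) (b r x : ℕ) (h : s.mem b (s.reg x) < 2 ^ bits) :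
      Exec bits (.load b r x) s 1 (s.setReg r (s.mem b (s.reg x)))
  | store (s : State) (b x y : ℕ) (hx : s.reg x < 2 ^ bits) (hy : s.reg y < 2 ^ bits) :
      Exec bits (.store b x y) s 1 (s.setMem b (s.reg x) (s.reg y))
  | seq {p q : Prog} {s s' s'' : State} {t t' : ℕ}
      (hp : Exec bits p s t s') (hq : Exec bits q s' t' s'') :
      Exec bits (.seq p q) s (t + t') s''
  | condTrue {x : ℕ} {p q : Prog} {s s' : State} {t : ℕ} (h : s.reg x ≠ 0)
      (hp : Exec bits p s t s') : Exec bits (.cond x p q) s (t + 1) s'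
  | condFalse {x : ℕ} {p q : Prog} {s s' : State} {t : ℕ} (h : s.reg x = 0)
      (hq : Exec bits q s t s') : Exec bits (.cond x p q) s (t + 1) s'
  | loopTrue {x : ℕ} {p : Prog} {s s' s'' : State} {t t' : ℕ} (h : s.reg x ≠ 0)
      (hp : Exec bits p s t s') (hl : Exec bits (.loop x p) s' t' s'') :
      Exec bits (.loop x p) s (t + t' + 1) s''
  | loopFalse {x : ℕ} {p : Prog} {s : State} (h : s.reg x = 0) :
      Exec bits (.loop x p) s 1 s

/-- Word length `w · (⌊log₂ size⌋ + 1)`: logarithmic in the input size, the constant factor `w`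
belonging to the algorithm. -/
def wordBits (w size : ℕ) : ℕ := w * (Nat.log 2 size + 1)

/-- Row-major layout of an `n × m` table of words in one memory bank, padded by `0`. -/
def table {n m : ℕ} (f : Fin n → Fin m → ℕ) (i : ℕ) : ℕ :=
  if h : i / m < n ∧ i % m < m then f ⟨i / m, h.1⟩ ⟨i % m, h.2⟩ else 0

end WordRAM

/-! ### Orthogonal vectors -/

/-- There are `a` in the first and `b` in the second family with `⟨a, b⟩ = 0`. -/
def HasOrthogonalPair {N d : ℕ} (A B : Fin N → Fin d → Bool) : Prop :=
  ∃ i j, ∑ l, (A i l).toNat * (B j l).toNat = 0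

/-- Input convention: `N` and `d` in the registers `0` and `1`, the entries of the vectors of `A`
in bank `0` and those of `B` in bank `1`, everything else `0`. -/
def ovInput {N d : ℕ} (A B : Fin N → Fin d → Bool) : WordRAM.State where
  reg r := match r with
    | 0 => N
    | 1 => d
    | _ => 0
  mem b := match b with
    | 0 => WordRAM.table fun i j => (A i j).toNat
    | 1 => WordRAM.table fun i j => (B i j).toNat
    | _ => fun _ => 0

/-- The program `p`, run with word-length factor `w`, decides every instance that consists of two
sets of `N` vectors in `{0,1}^d` within `T` steps; register `0` holds the answer.  A set of `N`
vectors is listed as an injective family. -/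
def SolvesOV (p : WordRAM.Prog) (w N d : ℕ) (T : ℝ) : Prop :=
  ∀ A B : Fin N → Fin d → Bool, Function.Injective A → Function.Injective B →
    ∃ (t : ℕ) (s : WordRAM.State),
      WordRAM.Exec (WordRAM.wordBits w (N * d)) p (ovInput A B) t s ∧
      (t : ℝ) ≤ T ∧
      (HasOrthogonalPair A B → s.reg 0 = 1) ∧
      (¬ HasOrthogonalPair A B → s.reg 0 = 0)

/-- The Orthogonal Vectors Hypothesis: for all `ε > 0` there is `c > 0` such that no algorithm
solves the instances with `|A| = |B| = N` and `d = c log N` in time `O(N ^ (2 - ε))`. -/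
def OVH : Prop :=
  ∀ ε : ℝ, 0 < ε → ∃ c : ℝ, 0 < c ∧
    ¬ ∃ (p : WordRAM.Prog) (w : ℕ) (C : ℝ), ∀ N : ℕ, 0 < N →
      SolvesOV p w N ⌈c * Real.log N⌉₊ (C * (N : ℝ) ^ (2 - ε))

/-! ### One-dimensional curves and the continuous Fréchet distance -/

open scoped unitInterval in
/-- Reparametrizations: monotone surjective functions from `[0,1]` to `[0,1]`. -/
def IsReparam (f : I → I) : Prop := Monotone f ∧ Function.Surjective f

open scoped unitInterval in
/-- The continuous Fréchet distance of two curves in `ℝ`. -/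
noncomputable def frechetDist (P Q : I → ℝ) : ℝ :=
  sInf {r : ℝ | ∃ f g : I → I, IsReparam f ∧ IsReparam g ∧ r = ⨆ t : I, |P (f t) - Q (g t)|}

open scoped unitInterval in
/-- The polygonal curve with the vertices `p 0, …, p (m - 1)`: each of the `m - 1` edges is
traversed at constant speed, in the same amount of time. -/
noncomputable def polygonalCurve {m : ℕ} (p : Fin m → ℚ) (t : I) : ℝ :=
  let v : ℕ → ℝ := fun i => if h : i < m then (p ⟨i, h⟩ : ℝ) else 0
  let x : ℝ := (t : ℝ) * ((m : ℝ) - 1)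
  AffineMap.lineMap (v ⌊x⌋₊) (v (⌊x⌋₊ + 1)) (Int.fract x)

/-- Fréchet distance of the polygonal curves with the given vertex sequences. -/
noncomputable def polyDist {m k : ℕ} (p : Fin m → ℚ) (q : Fin k → ℚ) : ℝ :=
  frechetDist (polygonalCurve p) (polygonalCurve q)

/-! ### Approximate near neighbor data structures -/

/-- `ans` (an input curve, or "no" for `none`) is a legal reply to the query `Q`, for the input
curves `P`, the distance threshold `δ` and the approximation factor `a`. -/
def IsANNAnswer {n m k : ℕ} (a : ℝ) (P : Fin n → Fin m → ℚ) (δ : ℚ) (Q : Fin k → ℚ)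
    (ans : Option (Fin n)) : Prop :=
  ((∃ i, polyDist (P i) Q ≤ δ) → ∃ j, ans = some j ∧ polyDist (P j) Q ≤ a * δ) ∧
  ((∀ i, a * δ ≤ polyDist (P i) Q) → ans = none) ∧
  (∀ j, ans = some j → polyDist (P j) Q ≤ a * δ)

/-- `x` is a fraction whose numerator and denominator are at most `M` in absolute value. -/
def RatBounded (M : ℕ) (x : ℚ) : Prop := x.num.natAbs ≤ M ∧ x.den ≤ M

/-- Input convention for the preprocessing: `n`, `m`, `k` in the registers `0`, `1`, `2`, numerator
and denominator of `δ` in the registers `3`, `4`; positive part of the numerator, negative part of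
the numerator, and denominator of the vertices in the banks `0`, `1`, `2`; everything else `0`. -/
def annInput {n m : ℕ} (k : ℕ) (P : Fin n → Fin m → ℚ) (δ : ℚ) : WordRAM.State where
  reg r := match r with
    | 0 => n
    | 1 => m
    | 2 => k
    | 3 => δ.num.toNat
    | 4 => δ.den
    | _ => 0
  mem b := match b with
    | 0 => WordRAM.table fun i j => (P i j).num.toNat
    | 1 => WordRAM.table fun i j => (-(P i j).num).toNat
    | 2 => WordRAM.table fun i j => (P i j).den
    | _ => fun _ => 0

/-- The state `s` with the query `Q` written into the first `k` cells of the banks `3` (positive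
part of the numerators), `4` (negative part of the numerators) and `5` (denominators). -/
def withQuery {k : ℕ} (s : WordRAM.State) (Q : Fin k → ℚ) : WordRAM.State where
  reg := s.reg
  mem b i := if h : i < k then
      match b with
      | 3 => (Q ⟨i, h⟩).num.toNat
      | 4 => (-(Q ⟨i, h⟩).num).toNat
      | 5 => (Q ⟨i, h⟩).den
      | _ => s.mem b i
    else s.mem b i

/-- Output convention of a query: `0` for "no", `i + 1` for the input curve with index `i`. -/
def answerCode {n : ℕ} : Option (Fin n) → ℕ
  | none => 0
  | some i => i + 1

/-- The preprocessing program `pre` and the query program `qry`, run with word-length factor `w`,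
form an `a`-ANN data structure for `n` one-dimensional curves of complexity `m` and queries of
complexity `k`, with preprocessing time `Tpre` and query time `Tqry`.  All numbers in the input are
fractions with numerator and denominator at most `(n m) ^ e`.  A set of `n` curves is listed as an
injective family.  The query program starts from the memory that the preprocessing left. -/
def SolvesANN (pre qry : WordRAM.Prog) (w e : ℕ) (a : ℝ) (n m k : ℕ) (Tpre Tqry : ℝ) : Prop :=
  ∀ (P : Fin n → Fin m → ℚ) (δ : ℚ), Function.Injective P →
    (∀ i j, RatBounded ((n * m) ^ e) (P i j)) → 0 < δ → RatBounded ((n * m) ^ e) δ →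
    ∃ (t₁ : ℕ) (s₁ : WordRAM.State),
      WordRAM.Exec (WordRAM.wordBits w (n * m)) pre (annInput k P δ) t₁ s₁ ∧
      (t₁ : ℝ) ≤ Tpre ∧
      ∀ Q : Fin k → ℚ, (∀ j, RatBounded ((n * m) ^ e) (Q j)) →
        ∃ (t₂ : ℕ) (s₂ : WordRAM.State) (ans : Option (Fin n)),
          WordRAM.Exec (WordRAM.wordBits w (n * m)) qry (withQuery s₁ Q) t₂ s₂ ∧
          (t₂ : ℝ) ≤ Tqry ∧
          s₂.reg 0 = answerCode ans ∧
          IsANNAnswer a P δ Q ans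

/-- `k · n ^ (c / k)`, rounded up. -/
noncomputable def inputComplexity (c : ℝ) (n k : ℕ) : ℕ :=
  ⌈(k : ℝ) * (n : ℝ) ^ (c / (k : ℝ))⌉₊

/-!
The proof is a reduction from Orthogonal Vectors, which solves `N` vectors in time
`O(N ^ (2 - 1 / Z))` with a near neighbor data structure as in the theorem.

*The gadget.*  Cut the `d` coordinates into `(k - 2) / 2` blocks of length `l`.  A location on the
line stands for a pair of a block and a pattern in `{0,1}^l`.  The curve of a vector `a` moves from
left to right; at a location it makes a zigzag of height `2` if `a` and the pattern have no common
one in the block, and rests otherwise.  The curve of a vector `b` moves from left to right as well,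
with one zigzag of height `4` per block, at the location of the pattern of `b`.  If `⟨a, b⟩ = 0`,
then both curves zigzag at all these locations, and the Fréchet distance is at most `1`
(`polyDist_gadget_le`).  Otherwise `b` has a zigzag where `a` rests: it drops from `2` above to
`2` below a height that `a` passes only once, so that the distance is at least `2`
(`le_polyDist_gadget`).  A `(2 - ε)`-approximate answer therefore tells the two cases apart.  The
input curves need `k · 2 ^ l` vertices up to a constant factor, and `2 ^ l` is about
`n ^ (c' / k)` if `d` is `O(log n)`; `k = o(log n)` makes the constant factor irrelevant
(`eventually_parameters`).

*The reduction.*  Let `r` be the `Z`-th root of `N`, rounded down.  The vectors of `A` are split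
into groups of size `n = r ^ z`; for each group, the data structure is built and queried with all
vectors of `B`.  If `z` is large compared with `1 / ε'`, then the queries take time
`N / n · N · n ^ (1 - ε')`, less than `N ^ 2` by a prescribed power of `r`, and if `Z` is large
compared with `z β`, then the preprocessing takes less time than that.

*Uniformity.*  The function `k` is arbitrary, possibly not computable, so that the reduction cannot
compute the values of `k` and `m` at `n`.  Both are less than `r`, as are the block length and the
number of patterns, and the reduction tries all of them.  This costs a factor `r ^ 4`, for which the
choice of `z` leaves room.  For a wrong guess nothing is known about the programs of the data
structure: they may overflow, run forever, or give wrong answers.  They are therefore run by a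
clocked simulation (`clocked_spec`), which is a total program: it counts down fuel, gives up when a
word becomes too large, and every answer is verified by an inner product.  The simulation also
keeps the memory left by the preprocessing unchanged, as each query writes to a fresh part of the
memory that overlays it.  The right guess succeeds (`succeeds_of_solvesANN`), and no wrong guess
reports a pair that is not orthogonal (`guessLoop_spec`).  The finitely many `N` for which the
parameters are not yet in their asymptotic range are solved by brute force.
-/

/-! ### Upper bounds for the Fréchet distance -/

/-- The polygonal curve through `v 0, v 1, …`, which reaches `v i` at the time `i`. -/
noncomputable def interpolate (v : ℕ → ℝ) (x : ℝ) : ℝ :=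
  AffineMap.lineMap (v ⌊x⌋₊) (v (⌊x⌋₊ + 1)) (Int.fract x)

lemma interpolate_eq (v : ℕ → ℝ) {x : ℝ} {j : ℕ} (hj : (j : ℝ) ≤ x) (hx : x ≤ j + 1) :
    interpolate v x = v j + (x - j) * (v (j + 1) - v j) := by
  have h0 : 0 ≤ x := le_trans (Nat.cast_nonneg _) hj
  rcases eq_or_lt_of_le hx with h | h
  · have h1 : ⌊x⌋₊ = j + 1 := by
      rw [h]; exact_mod_cast Nat.floor_natCast (R := ℝ) (j + 1)
    have h2 : Int.fract x = 0 := by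
      rw [h]; exact_mod_cast Int.fract_natCast (R := ℝ) (j + 1)
    rw [interpolate, h1, h2, AffineMap.lineMap_apply_zero, h]; ring
  · have h1 : ⌊x⌋₊ = j := (Nat.floor_eq_iff h0).2 ⟨hj, h⟩
    have h2 : Int.fract x = x - j := by
      rw [Int.fract, ← natCast_floor_eq_intCast_floor h0, h1]
    rw [interpolate, h1, h2, AffineMap.lineMap_apply]
    simp only [vsub_eq_sub, smul_eq_mul, vadd_eq_add]; ring

lemma interpolate_natCast (v : ℕ → ℝ) (j : ℕ) : interpolate v j = v j := by
  rw [interpolate_eq v (j := j) le_rfl (by linarith)]; ring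

/-- A vertex sequence, continued by `0`. -/
def vertexSeq {m : ℕ} (p : Fin m → ℚ) (i : ℕ) : ℝ := if h : i < m then (p ⟨i, h⟩ : ℝ) else 0

lemma polygonalCurve_eq {m : ℕ} (p : Fin m → ℚ) (t : unitInterval) :
    polygonalCurve p t = interpolate (vertexSeq p) ((t : ℝ) * ((m : ℝ) - 1)) := rfl

lemma exists_cell {M : ℕ} (hM : 1 ≤ M) {x : ℝ} (h0 : 0 ≤ x) (hx : x ≤ M) :
    ∃ i, i < M ∧ (i : ℝ) ≤ x ∧ x ≤ i + 1 := by
  rcases eq_or_lt_of_le hx with h | h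
  · refine ⟨M - 1, by omega, ?_, ?_⟩ <;> rw [h] <;> push_cast [Nat.cast_sub hM] <;> linarith
  · exact ⟨⌊x⌋₊, (Nat.floor_lt h0).2 h, Nat.floor_le h0, (Nat.lt_floor_add_one x).le⟩

lemma exists_cell_value {u : ℕ → ℝ} {y : ℝ} (h0 : u 0 ≤ y) :
    ∀ M : ℕ, 1 ≤ M → y ≤ u M → ∃ i, i < M ∧ u i ≤ y ∧ y ≤ u (i + 1)
  | 0, h, _ => by omega
  | M + 1, _, h => by
    by_cases hy : u M ≤ y
    · exact ⟨M, by omega, hy, h⟩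
    · rcases Nat.eq_zero_or_pos M with rfl | hM
      · exact absurd h0 hy
      · obtain ⟨i, hi, h⟩ := exists_cell_value h0 M hM (not_le.1 hy).le
        exact ⟨i, by omega, h⟩

lemma interpolate_mem_cell {u : ℕ → ℝ} {i : ℕ} (h : u i ≤ u (i + 1)) {x : ℝ} (h1 : (i : ℝ) ≤ x)
    (h2 : x ≤ i + 1) : u i ≤ interpolate u x ∧ interpolate u x ≤ u (i + 1) := by
  rw [interpolate_eq u h1 h2]
  constructor <;> nlinarith

lemma monotone_upto {u : ℕ → ℝ} {M : ℕ} (hu : ∀ i < M, u i ≤ u (i + 1)) {a b : ℕ} (hab : a ≤ b)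
    (hb : b ≤ M) : u a ≤ u b := by
  induction b, hab using Nat.le_induction with
  | base => exact le_rfl
  | succ b _ ih => exact (ih (by omega)).trans (hu b (by omega))

lemma interpolate_mono {u : ℕ → ℝ} {M : ℕ} (hM : 1 ≤ M) (hu : ∀ i < M, u i ≤ u (i + 1)) {x y : ℝ}
    (h0 : 0 ≤ x) (hxy : x ≤ y) (hy : y ≤ M) : interpolate u x ≤ interpolate u y := by
  obtain ⟨i, hi, h1, h2⟩ := exists_cell hM h0 (hxy.trans hy)
  by_cases hyi : y ≤ i + 1
  · have := hu i hi
    rw [interpolate_eq u h1 h2, interpolate_eq u (h1.trans hxy) hyi]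
    nlinarith
  · obtain ⟨j, hj, h3, h4⟩ := exists_cell hM (h0.trans hxy) hy
    have hij : i + 1 ≤ j := by
      by_contra hc
      have : (j : ℝ) + 1 ≤ i + 1 := by exact_mod_cast (by omega : j + 1 ≤ i + 1)
      linarith
    calc interpolate u x ≤ u (i + 1) := (interpolate_mem_cell (hu i hi) h1 h2).2
      _ ≤ u j := monotone_upto hu hij hj.le
      _ ≤ interpolate u y := (interpolate_mem_cell (hu j hj) h3 h4).1

lemma isReparam_id : IsReparam id := ⟨monotone_id, Function.surjective_id⟩

lemma bddBelow_frechet (P Q : unitInterval → ℝ) :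
    BddBelow {r : ℝ | ∃ f g : unitInterval → unitInterval, IsReparam f ∧ IsReparam g ∧
      r = ⨆ t : unitInterval, |P (f t) - Q (g t)|} := by
  refine ⟨0, ?_⟩
  rintro r ⟨f, g, -, -, rfl⟩
  exact Real.iSup_nonneg fun t => abs_nonneg _

/-- An upper bound for the Fréchet distance from a matching: the vertex `i` of `p` is matched with
the point of `q` at the time `u i`.  Between two consecutive matched points, `q` has no vertex, so
that both curves are affine there and their distance is largest at an end. -/
theorem polyDist_le_of_matching {m k : ℕ} (p : Fin m → ℚ) (q : Fin k → ℚ) (hm : 2 ≤ m) (hk : 2 ≤ k)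
    (u : ℕ → ℝ) (h0 : u 0 = 0) (h1 : u (m - 1) = k - 1)
    (hcell : ∀ i, i + 1 < m → ∃ j : ℕ, (j : ℝ) ≤ u i ∧ u i ≤ u (i + 1) ∧ u (i + 1) ≤ j + 1)
    (δ : ℝ) (hd : ∀ i, i < m → |vertexSeq p i - interpolate (vertexSeq q) (u i)| ≤ δ) :
    polyDist p q ≤ δ := by
  have hM : 1 ≤ m - 1 := by omega
  have hmc : ((m - 1 : ℕ) : ℝ) = (m : ℝ) - 1 := by push_cast [Nat.cast_sub (by omega : 1 ≤ m)]; rfl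
  have hm1 : (1 : ℝ) ≤ (m : ℝ) - 1 := by rw [← hmc]; exact_mod_cast hM
  have hk1 : (1 : ℝ) ≤ (k : ℝ) - 1 := by
    have : (2 : ℝ) ≤ k := by exact_mod_cast hk
    linarith
  have hu : ∀ i < m - 1, u i ≤ u (i + 1) := fun i hi => by
    obtain ⟨j, _, h, _⟩ := hcell i (by omega); exact h
  have hx : ∀ t : unitInterval, 0 ≤ (t : ℝ) * ((m : ℝ) - 1) ∧
      (t : ℝ) * ((m : ℝ) - 1) ≤ (m - 1 : ℕ) :=
    fun t => ⟨mul_nonneg t.2.1 (by linarith), by rw [hmc]; nlinarith [t.2.2]⟩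
  have hrange : ∀ x : ℝ, 0 ≤ x → x ≤ (m - 1 : ℕ) → interpolate u x ∈ Set.Icc (0 : ℝ) (k - 1) := by
    intro x hx0 hx1
    constructor
    · have := interpolate_mono hM hu (x := ((0 : ℕ) : ℝ)) (by simp) (by simpa using hx0) hx1
      rwa [interpolate_natCast, h0] at this
    · have := interpolate_mono hM hu hx0 hx1 le_rfl
      rwa [interpolate_natCast, h1] at this
  let g : unitInterval → unitInterval := fun t =>
    ⟨interpolate u ((t : ℝ) * ((m : ℝ) - 1)) / (k - 1),
      div_nonneg (hrange _ (hx t).1 (hx t).2).1 (by linarith),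
      (div_le_one (by linarith)).2 (hrange _ (hx t).1 (hx t).2).2⟩
  have hg : IsReparam g := by
    constructor
    · intro s t hst
      change interpolate u _ / _ ≤ interpolate u _ / _
      have : (s : ℝ) ≤ t := hst
      exact div_le_div_of_nonneg_right (interpolate_mono hM hu (hx s).1
        (mul_le_mul_of_nonneg_right this (by linarith)) (hx t).2) (by linarith)
    · intro y
      have hy0 : 0 ≤ (y : ℝ) * (k - 1) := mul_nonneg y.2.1 (by linarith)
      have hy1 : (y : ℝ) * (k - 1) ≤ k - 1 := by nlinarith [y.2.2]
      obtain ⟨i, hi, ha, hb⟩ := exists_cell_value (u := u) (y := (y : ℝ) * (k - 1))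
        (h0.le.trans hy0) (m - 1) hM
        (by rw [h1]; exact hy1)
      obtain ⟨θ, hθ0, hθ1, hθ⟩ : ∃ θ : ℝ, 0 ≤ θ ∧ θ ≤ 1 ∧
          u i + θ * (u (i + 1) - u i) = (y : ℝ) * (k - 1) := by
        rcases eq_or_lt_of_le (ha.trans hb) with h | h
        · exact ⟨0, le_rfl, zero_le_one, by linarith⟩
        · refine ⟨((y : ℝ) * (k - 1) - u i) / (u (i + 1) - u i),
            div_nonneg (by linarith) (by linarith), (div_le_one (by linarith)).2 (by linarith), ?_⟩
          rw [div_mul_cancel₀ _ (by linarith)]; ring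
      have hi1 : (i : ℝ) + 1 ≤ (m : ℝ) - 1 := by rw [← hmc]; exact_mod_cast hi
      have hi0 : (0 : ℝ) ≤ i := Nat.cast_nonneg _
      refine ⟨⟨(i + θ) / (m - 1), div_nonneg (by linarith) (by linarith),
        (div_le_one (by linarith)).2 (by linarith)⟩, Subtype.ext ?_⟩
      change interpolate u ((i + θ) / (m - 1) * (m - 1)) / (k - 1) = y
      rw [div_mul_cancel₀ _ (by linarith), interpolate_eq u (j := i) (by linarith) (by linarith),
        div_eq_iff (by linarith), ← hθ]
      ring
  refine (csInf_le (bddBelow_frechet _ _) ⟨id, g, isReparam_id, hg, rfl⟩).trans ?_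
  refine ciSup_le fun t => ?_
  rw [polygonalCurve_eq, polygonalCurve_eq]
  change |interpolate _ ((t : ℝ) * (m - 1)) -
    interpolate _ (interpolate u ((t : ℝ) * ((m : ℝ) - 1)) / (k - 1) * (k - 1))| ≤ δ
  rw [div_mul_cancel₀ _ (by linarith)]
  obtain ⟨i, hi, ha, hb⟩ := exists_cell hM (hx t).1 (hx t).2
  set x := (t : ℝ) * ((m : ℝ) - 1)
  obtain ⟨j, hj0, hj, hj1⟩ := hcell i (by omega)
  have hd0 := hd i (by omega)
  have hd1 := hd (i + 1) (by omega)
  have hm' := interpolate_mem_cell hj ha hb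
  rw [interpolate_eq _ (hj0.trans hm'.1) (hm'.2.trans hj1), interpolate_eq _ ha hb,
    interpolate_eq _ ha hb]
  rw [interpolate_eq _ hj0 (hj.trans hj1)] at hd0
  rw [interpolate_eq _ (hj0.trans hj) hj1] at hd1
  rw [abs_le] at hd0 hd1 ⊢
  set θ := x - i
  have hθ0 : 0 ≤ θ := by simp only [θ]; linarith
  have hθ1 : θ ≤ 1 := by simp only [θ]; linarith
  constructor <;>
    nlinarith [mul_le_mul_of_nonneg_left hd0.1 (sub_nonneg.2 hθ1),
      mul_le_mul_of_nonneg_left hd0.2 (sub_nonneg.2 hθ1),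
      mul_le_mul_of_nonneg_left hd1.1 hθ0, mul_le_mul_of_nonneg_left hd1.2 hθ0]

/-! ### Lower bounds for the Fréchet distance -/

lemma exists_abs_interpolate_le (v : ℕ → ℝ) (M : ℕ) :
    ∃ b : ℝ, ∀ x : ℝ, 0 ≤ x → x ≤ M → |interpolate v x| ≤ b := by
  refine ⟨∑ i ∈ Finset.range (M + 2), |v i|, fun x h0 hx => ?_⟩
  obtain ⟨i, hi, ha, hb⟩ := exists_cell (M := M + 1) (by omega) h0 (by push_cast; linarith)
  have key : ∀ a b c : ℝ, 0 ≤ c → c ≤ 1 → |a| ≤ b → ∀ a', |a'| ≤ b → |a + c * (a' - a)| ≤ b := by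
    intro a b c h0 h1 ha a' ha'
    rw [abs_le] at *
    constructor <;> nlinarith
  rw [interpolate_eq v ha hb]
  refine key _ _ _ (by linarith) (by linarith) ?_ _ ?_ <;>
    exact Finset.single_le_sum (f := fun i => |v i|) (fun _ _ => abs_nonneg _)
      (Finset.mem_range.2 (by omega))

/-- If `q` falls from a vertex of height at least `x + r` to a later vertex of height at most
`x - r`, while `p` stays below `x` up to some time `s` and above `x` from then on, then the Fréchet
distance is at least `r`. -/
theorem le_polyDist_of_drop {m k : ℕ} (p : Fin m → ℚ) (q : Fin k → ℚ) (hm : 1 ≤ m) (hk : 2 ≤ k)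
    {x r : ℝ} {i j : ℕ} (hij : i < j) (hj : j < k) (hi1 : x + r ≤ vertexSeq q i)
    (hj1 : vertexSeq q j ≤ x - r) (s : ℝ)
    (hbelow : ∀ y, 0 ≤ y → y ≤ (m : ℝ) - 1 → y ≤ s → interpolate (vertexSeq p) y ≤ x)
    (habove : ∀ y, 0 ≤ y → y ≤ (m : ℝ) - 1 → s ≤ y → x ≤ interpolate (vertexSeq p) y) :
    r ≤ polyDist p q := by
  refine le_csInf ⟨_, id, id, isReparam_id, isReparam_id, rfl⟩ ?_
  rintro _ ⟨f, g, hf, hg, rfl⟩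
  have hm1 : (0 : ℝ) ≤ (m : ℝ) - 1 := by
    have : (1 : ℝ) ≤ m := by exact_mod_cast hm
    linarith
  have hk1 : (1 : ℝ) ≤ (k : ℝ) - 1 := by
    have : (2 : ℝ) ≤ k := by exact_mod_cast hk
    linarith
  have hbdd : BddAbove (Set.range fun t => |polygonalCurve p (f t) - polygonalCurve q (g t)|) := by
    obtain ⟨b, hb⟩ := exists_abs_interpolate_le (vertexSeq p) m
    obtain ⟨b', hb'⟩ := exists_abs_interpolate_le (vertexSeq q) k
    refine ⟨b + b', ?_⟩
    rintro _ ⟨t, rfl⟩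
    refine (abs_sub _ _).trans (add_le_add (hb _ ?_ ?_) (hb' _ ?_ ?_))
    · exact mul_nonneg (f t).2.1 hm1
    · nlinarith [(f t).2.2]
    · exact mul_nonneg (g t).2.1 (by linarith)
    · nlinarith [(g t).2.2]
  have hle : ∀ t, |polygonalCurve p (f t) - polygonalCurve q (g t)| ≤
      ⨆ t, |polygonalCurve p (f t) - polygonalCurve q (g t)| := fun t => le_ciSup hbdd t
  have hvert : ∀ l : ℕ, l < k → ∃ t, ((g t : unitInterval) : ℝ) = l / ((k : ℝ) - 1) ∧
      polygonalCurve q (g t) = vertexSeq q l := by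
    intro l hl
    have hl1 : (l : ℝ) ≤ (k : ℝ) - 1 := by
      have : ((l + 1 : ℕ) : ℝ) ≤ k := by exact_mod_cast hl
      push_cast at this; linarith
    obtain ⟨t, ht⟩ := hg.2 ⟨l / ((k : ℝ) - 1), div_nonneg (Nat.cast_nonneg _) (by linarith),
      (div_le_one (by linarith)).2 hl1⟩
    refine ⟨t, by rw [ht], ?_⟩
    rw [polygonalCurve_eq, ht]
    change interpolate _ (l / ((k : ℝ) - 1) * (k - 1)) = _
    rw [div_mul_cancel₀ _ (by linarith), interpolate_natCast]
  obtain ⟨t₁, ht₁, hq₁⟩ := hvert i (hij.trans hj)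
  obtain ⟨t₂, ht₂, hq₂⟩ := hvert j hj
  have ht : t₁ ≤ t₂ := by
    by_contra hc
    have h : ((g t₂ : unitInterval) : ℝ) ≤ g t₁ := hg.1 (not_le.1 hc).le
    rw [ht₁, ht₂, div_le_div_iff_of_pos_right (by linarith)] at h
    have : (j : ℝ) ≤ i := h
    exact absurd (by exact_mod_cast this : j ≤ i) (by omega)
  have hfm : ((f t₁ : unitInterval) : ℝ) ≤ f t₂ := hf.1 ht
  have hrange : ∀ t, 0 ≤ ((f t : unitInterval) : ℝ) * ((m : ℝ) - 1) ∧
      ((f t : unitInterval) : ℝ) * ((m : ℝ) - 1) ≤ (m : ℝ) - 1 :=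
    fun t => ⟨mul_nonneg (f t).2.1 hm1, by nlinarith [(f t).2.2]⟩
  by_cases hs : ((f t₁ : unitInterval) : ℝ) * ((m : ℝ) - 1) ≤ s
  · have h := hbelow _ (hrange t₁).1 (hrange t₁).2 hs
    have h' := neg_abs_le (polygonalCurve p (f t₁) - polygonalCurve q (g t₁))
    rw [← polygonalCurve_eq] at h
    linarith [hle t₁]
  · have h := habove _ (hrange t₂).1 (hrange t₂).2
      ((not_le.1 hs).le.trans (mul_le_mul_of_nonneg_right hfm hm1))
    have h' := le_abs_self (polygonalCurve p (f t₂) - polygonalCurve q (g t₂))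
    rw [← polygonalCurve_eq] at h
    linarith [hle t₂]

/-! ### The gadget curves -/

/-- The vertex `v` of an input curve.  The location `v / 2` is visited at the height `v / 2 + 2` by
the two vertices `v` with the same `v / 2`.  The curve makes a zigzag of height `2` there if
`f (v / 2 - 1) = 0`, and rests there otherwise. -/
def inputVertex (f : ℕ → ℕ) (v : ℕ) : ℕ :=
  if f (v / 2 - 1) = 0 then (if v % 2 = 0 then v / 2 + 3 else v / 2 + 1) else v / 2 + 2

/-- The vertex `v` of a query curve of complexity `k`, for input curves of complexity `m`.  For
each `b < (k - 2) / 2`, in increasing order, the curve makes a zigzag of height `4` at the location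
`loc b + 1`, whose height is `loc b + 3`.  The first vertex is repeated if `k` is odd. -/
def queryVertex (loc : ℕ → ℕ) (k m v : ℕ) : ℕ :=
  if v - k % 2 = 0 then 2 else if v + 1 = k then (m - 1) / 2 + 2 else
    if (v - k % 2) % 2 = 1 then loc ((v - k % 2 - 1) / 2) + 5 else loc ((v - k % 2 - 1) / 2) + 1

/-- The polygonal curve with the vertices `f 0, …, f (m - 1)`. -/
def natCurve (m : ℕ) (f : ℕ → ℕ) : Fin m → ℚ := fun i => (f i : ℚ)

lemma vertexSeq_natCurve {m : ℕ} (f : ℕ → ℕ) {i : ℕ} (hi : i < m) :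
    vertexSeq (natCurve m f) i = f i := by
  simp [vertexSeq, natCurve, hi]

section Query

variable {loc : ℕ → ℕ} {k m b : ℕ}

lemma queryVertex_start : queryVertex loc k m (k % 2) = 2 := by simp [queryVertex]

lemma queryVertex_up (hb : b < (k - 2) / 2) :
    queryVertex loc k m (k % 2 + 2 * b + 1) = loc b + 5 := by
  have h1 : k % 2 + 2 * b + 1 - k % 2 = 2 * b + 1 := by omega
  rw [queryVertex, h1, if_neg (by omega), if_neg (by omega), if_pos (by omega),
    show (2 * b + 1 - 1) / 2 = b by omega]

lemma queryVertex_down :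
    queryVertex loc k m (k % 2 + 2 * b + 2) = loc b + 1 := by
  have h1 : k % 2 + 2 * b + 2 - k % 2 = 2 * b + 2 := by omega
  rw [queryVertex, h1, if_neg (by omega), if_neg (by omega), if_neg (by omega),
    show (2 * b + 2 - 1) / 2 = b by omega]

lemma queryVertex_end (hk : 2 ≤ k) :
    queryVertex loc k m (k % 2 + 2 * ((k - 2) / 2) + 1) = (m - 1) / 2 + 2 := by
  rw [queryVertex, if_neg (by omega), if_pos (by omega)]

end Query

/-- The number of query locations strictly below the location `ℓ`, found by a left-to-right scan. -/
def scanCount (loc : ℕ → ℕ) (B : ℕ) : ℕ → ℕ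
  | 0 => 0
  | ℓ + 1 => if scanCount loc B ℓ < B ∧ ℓ = loc (scanCount loc B ℓ) + 1
      then scanCount loc B ℓ + 1 else scanCount loc B ℓ

lemma scanCount_spec {loc : ℕ → ℕ} {B : ℕ} (hmono : ∀ b, b + 1 < B → loc b < loc (b + 1)) (ℓ : ℕ) :
    scanCount loc B ℓ ≤ B ∧ (scanCount loc B ℓ < B → ℓ ≤ loc (scanCount loc B ℓ) + 1) ∧
      (∀ b, scanCount loc B ℓ = b + 1 → loc b + 1 < ℓ) := by
  induction ℓ with
  | zero => simp [scanCount]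
  | succ ℓ ih =>
    obtain ⟨h1, h2, h3⟩ := ih
    rw [scanCount]
    split_ifs with h
    · refine ⟨h.1, fun h' => ?_, fun b hb => ?_⟩
      · have := hmono _ h'; omega
      · obtain rfl : scanCount loc B ℓ = b := by omega
        omega
    · refine ⟨h1, fun h' => ?_, fun b hb => ?_⟩
      · have := h2 h'
        have : ¬ ℓ = loc (scanCount loc B ℓ) + 1 := fun hc => h ⟨h', hc⟩
        omega
      · have := h3 b hb; omega

/-- If every query location is a zigzag of the input curve, then the curves have distance at most
`1`: at every query location, both curves go up and down, and elsewhere the query moves slowly past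
the zigzags of height `2` of the input curve. -/
theorem polyDist_gadget_le {f loc : ℕ → ℕ} {k m : ℕ} (hk : 4 ≤ k)
    (hmono : ∀ b, b + 1 < (k - 2) / 2 → loc b < loc (b + 1))
    (hloc : ∀ b < (k - 2) / 2, 2 * loc b + 5 ≤ m) (hf : ∀ b < (k - 2) / 2, f (loc b) = 0) :
    polyDist (natCurve m (inputVertex f)) (natCurve k (queryVertex loc k m)) ≤ 1 := by
  set B := (k - 2) / 2 with hB
  set c := scanCount loc B with hc
  have hspec := scanCount_spec (B := B) hmono
  simp only [← hc] at hspec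
  have hm : 5 ≤ m := by have := hloc 0 (by omega); omega
  let s := k % 2
  let q : ℕ → ℝ := vertexSeq (natCurve k (queryVertex loc k m))
  have hq : ∀ i < k, q i = (queryVertex loc k m i : ℝ) := fun i hi => vertexSeq_natCurve _ hi
  -- `frac ℓ` is where the query passes the height of the location `ℓ` on its edge
  let frac : ℕ → ℝ := fun ℓ => ((ℓ : ℝ) + 2 - q (s + 2 * c ℓ)) /
    (q (s + 2 * c ℓ + 1) - q (s + 2 * c ℓ))
  let u : ℕ → ℝ := fun v => if v = 0 then 0 else
    if c (v / 2) < B ∧ v / 2 = loc (c (v / 2)) + 1 then (s + 1 + 2 * c (v / 2) + v % 2 : ℕ)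
    else ((s + 2 * c (v / 2) : ℕ) : ℝ) + frac (v / 2)
  have hα : ∀ ℓ, q (s + 2 * c ℓ) ≤ (ℓ : ℝ) + 2 ∧
      (2 * ℓ + 1 ≤ m → q (s + 2 * c ℓ) < q (s + 2 * c ℓ + 1) ∧
        ((ℓ : ℝ) + 2 ≤ q (s + 2 * c ℓ + 1)) ∧
        (c ℓ = B → q (s + 2 * c ℓ + 1) = ((m - 1) / 2 + 2 : ℕ))) := by
    intro ℓ
    obtain ⟨h1, h2, h3⟩ := hspec ℓ
    rw [hq _ (by omega), hq _ (by omega)]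
    have e1 : queryVertex loc k m (s + 2 * c ℓ) ≤ ℓ + 2 ∧
        (c ℓ = B → queryVertex loc k m (s + 2 * c ℓ) < (m - 1) / 2 + 2) ∧
        (c ℓ < B → queryVertex loc k m (s + 2 * c ℓ) < loc (c ℓ) + 5) := by
      rcases hcl : c ℓ with _ | b
      · simp only [mul_zero, add_zero, s, queryVertex_start]; omega
      · have := h3 b hcl
        rw [show s + 2 * (b + 1) = k % 2 + 2 * b + 2 by simp only [s]; omega,
          queryVertex_down]
        have h5 := hloc b (by omega)
        refine ⟨by omega, by omega, fun h => ?_⟩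
        have := hmono b h; omega
    refine ⟨by exact_mod_cast e1.1, fun hℓ => ?_⟩
    rcases Nat.lt_or_ge (c ℓ) B with h | h
    · have h4 := h2 h
      have : queryVertex loc k m (s + 2 * c ℓ + 1) = _ := queryVertex_up h
      rw [this]
      have h5 := e1.2.2 h
      exact ⟨by exact_mod_cast h5, by exact_mod_cast (by omega : ℓ + 2 ≤ loc (c ℓ) + 5),
        fun h' => by omega⟩
    · have h4 : c ℓ = B := le_antisymm h1 h
      have : queryVertex loc k m (s + 2 * c ℓ + 1) = (m - 1) / 2 + 2 := by
        rw [h4]; exact queryVertex_end (by omega)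
      rw [this]
      have h5 := e1.2.1 h4
      exact ⟨by exact_mod_cast h5, by exact_mod_cast (by omega : ℓ + 2 ≤ (m - 1) / 2 + 2),
        fun _ => rfl⟩
  have hfrac : ∀ ℓ, 2 * ℓ + 1 ≤ m → 0 ≤ frac ℓ ∧ frac ℓ ≤ 1 := by
    intro ℓ hℓ
    obtain ⟨h1, h2⟩ := hα ℓ
    obtain ⟨h2, h3, -⟩ := h2 hℓ
    exact ⟨div_nonneg (by linarith) (by linarith), (div_le_one (by linarith)).2 (by linarith)⟩
  have hfracmono : ∀ ℓ, 2 * ℓ + 1 ≤ m → c (ℓ + 1) = c ℓ → frac ℓ ≤ frac (ℓ + 1) := by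
    intro ℓ hℓ h
    simp only [frac, h]
    obtain ⟨h1, h2⟩ := hα ℓ
    obtain ⟨h2, h3, -⟩ := h2 hℓ
    apply div_le_div_of_nonneg_right _ (by linarith)
    push_cast; linarith
  have hstep : ∀ ℓ, c (ℓ + 1) = if c ℓ < B ∧ ℓ = loc (c ℓ) + 1 then c ℓ + 1 else c ℓ := fun ℓ => rfl
  have hc0 : c 0 = 0 := rfl
  have hq0 : q s = 2 := by
    rw [hq _ (by omega)]; exact_mod_cast queryVertex_start
  have hfrac0 : frac 0 = 0 := by simp [frac, hc0, hq0]
  have hu1 : u 1 = s := by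
    simp [u, hc0, hfrac0]
  have hu : ∀ v ℓ par, v ≠ 0 → v / 2 = ℓ → v % 2 = par → u v =
      if c ℓ < B ∧ ℓ = loc (c ℓ) + 1 then ((s + 1 + 2 * c ℓ + par : ℕ) : ℝ)
      else ((s + 2 * c ℓ : ℕ) : ℝ) + frac ℓ := by
    rintro v _ _ hv rfl rfl
    exact if_neg hv
  refine polyDist_le_of_matching _ _ (by omega) (by omega) u (by simp [u]) ?_ ?_ 1 ?_
  · have hcB : c ((m - 1) / 2) = B := by
      obtain ⟨h1, h2, h3⟩ := hspec ((m - 1) / 2)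
      by_contra hne
      have h := h2 (by omega)
      have := hloc (c ((m - 1) / 2)) (by omega)
      omega
    have hfr : frac ((m - 1) / 2) = 1 := by
      obtain ⟨h1, h2⟩ := hα ((m - 1) / 2)
      obtain ⟨h2, h3, h4⟩ := h2 (by omega)
      have h4 := h4 hcB
      simp only [frac]
      rw [div_eq_one_iff_eq (by linarith), h4]; push_cast; ring
    have : u (m - 1) = ((s + 2 * B : ℕ) : ℝ) + 1 := by
      simp only [u]
      rw [if_neg (by omega), hcB, if_neg (by omega), hfr]
    rw [this, eq_sub_iff_add_eq]
    have hkk : s + 2 * B + 1 + 1 = k := by simp only [s]; omega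
    exact_mod_cast hkk
  · intro i hi
    rcases Nat.eq_zero_or_pos i with rfl | hi0
    · refine ⟨0, by simp [u], ?_, ?_⟩ <;> rw [zero_add, hu1]
      · simp [u]
      · have : s ≤ 1 := by simp only [s]; omega
        exact_mod_cast by omega
    · set ℓ := i / 2 with hℓ
      rcases Nat.mod_two_eq_zero_or_one i with hpar | hpar
      · -- both vertices belong to the same location
        have h2 : (i + 1) / 2 = ℓ := by omega
        have h3 : (i + 1) % 2 = 1 := by omega
        rw [hu i ℓ 0 (by omega) rfl hpar, hu (i + 1) ℓ 1 (by omega) h2 h3]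
        obtain ⟨ha, hb⟩ := hfrac ℓ (by omega)
        split_ifs with hhit
        · refine ⟨s + 1 + 2 * c ℓ, by push_cast; linarith, by push_cast; linarith,
            by push_cast; linarith⟩
        · refine ⟨s + 2 * c ℓ, by push_cast; linarith, by push_cast; linarith,
            by push_cast; linarith⟩
      · have h2 : (i + 1) / 2 = ℓ + 1 := by omega
        have h3 : (i + 1) % 2 = 0 := by omega
        rw [hu i ℓ 1 (by omega) rfl hpar, hu (i + 1) (ℓ + 1) 0 (by omega) h2 h3]
        obtain ⟨ha, hb⟩ := hfrac ℓ (by omega)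
        obtain ⟨ha', hb'⟩ := hfrac (ℓ + 1) (by omega)
        have hst := hstep ℓ
        have hmn := hfracmono ℓ (by omega)
        by_cases hhit : c ℓ < B ∧ ℓ = loc (c ℓ) + 1
        · rw [if_pos hhit] at hst
          rw [if_pos hhit, hst]
          refine ⟨s + 2 * (c ℓ + 1), by push_cast; linarith, ?_, ?_⟩ <;> split_ifs <;>
            push_cast <;> linarith
        · rw [if_neg hhit] at hst
          have hmn := hmn hst
          rw [if_neg hhit, hst]
          refine ⟨s + 2 * c ℓ, by push_cast; linarith, ?_, ?_⟩ <;> split_ifs <;>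
            push_cast <;> linarith
  · intro i hi
    rw [vertexSeq_natCurve _ hi]
    set ℓ := i / 2 with hℓ
    have hmain : |((inputVertex f i : ℕ) : ℝ) - ((ℓ : ℝ) + 2)| ≤ 1 := by
      rw [inputVertex, ← hℓ, abs_le]
      split_ifs <;> push_cast <;> constructor <;> linarith
    rcases Nat.eq_zero_or_pos i with rfl | hi0
    · have : interpolate q (u 0) = 2 := by
        simp only [u, if_true]
        have h0 := interpolate_natCast q 0
        rw [Nat.cast_zero] at h0
        rw [h0, hq 0 (by omega)]
        simp [queryVertex]
      change |_ - interpolate q (u 0)| ≤ 1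
      rw [this]
      simpa [hℓ] using hmain
    · by_cases hhit : c ℓ < B ∧ ℓ = loc (c ℓ) + 1
      · have : u i = (s + 1 + 2 * c ℓ + i % 2 : ℕ) := by
          simp only [u]; rw [if_neg (by omega), if_pos hhit]
        change |_ - interpolate q (u i)| ≤ 1
        rw [this, interpolate_natCast, hq _ (by simp only [s]; omega), inputVertex, ← hℓ]
        have hz : f (ℓ - 1) = 0 := by
          rw [show ℓ - 1 = loc (c ℓ) by omega]; exact hf _ hhit.1
        rw [if_pos hz]
        have hl : ((ℓ : ℕ) : ℝ) = (loc (c ℓ) : ℝ) + 1 := by exact_mod_cast hhit.2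
        rcases Nat.mod_two_eq_zero_or_one i with hpar | hpar
        · rw [hpar, if_pos rfl, show s + 1 + 2 * c ℓ + 0 = k % 2 + 2 * c ℓ + 1 by
            simp only [s]; omega, queryVertex_up hhit.1]
          push_cast
          rw [hl, abs_le]; constructor <;> linarith
        · rw [hpar, if_neg (by omega), show s + 1 + 2 * c ℓ + 1 = k % 2 + 2 * c ℓ + 2 by
            simp only [s]; omega, queryVertex_down]
          push_cast
          rw [hl, abs_le]; constructor <;> linarith
      · have : u i = ((s + 2 * c ℓ : ℕ) : ℝ) + frac ℓ := by
          simp only [u]; rw [if_neg (by omega), if_neg hhit]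
        change |_ - interpolate q (u i)| ≤ 1
        obtain ⟨ha, hb⟩ := hfrac ℓ (by omega)
        obtain ⟨h1, h2⟩ := hα ℓ
        obtain ⟨h2, h3, -⟩ := h2 (by omega)
        rw [this, interpolate_eq q (j := s + 2 * c ℓ) (by linarith) (by linarith),
          add_sub_cancel_left]
        have : frac ℓ * (q (s + 2 * c ℓ + 1) - q (s + 2 * c ℓ)) = (ℓ : ℝ) + 2 - q (s + 2 * c ℓ) :=
          div_mul_cancel₀ _ (by linarith)
        rw [this, add_sub_cancel]
        exact hmain

/-- If the input curve rests at some query location, then the curves have distance at least `2`. -/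
theorem le_polyDist_gadget {f loc : ℕ → ℕ} {k m b : ℕ} (hb : b < (k - 2) / 2)
    (hloc : 2 * loc b + 5 ≤ m) (hf : f (loc b) ≠ 0) :
    2 ≤ polyDist (natCurve m (inputVertex f)) (natCurve k (queryVertex loc k m)) := by
  set ℓ := loc b + 1 with hℓ
  have hlow : ∀ i, i ≤ 2 * ℓ + 1 → inputVertex f i ≤ ℓ + 2 := by
    intro i hi
    by_cases h : i / 2 = ℓ
    · rw [inputVertex, h, hℓ, Nat.add_sub_cancel, if_neg hf]
    · rw [inputVertex]; split_ifs <;> omega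
  have hhigh : ∀ i, 2 * ℓ ≤ i → ℓ + 2 ≤ inputVertex f i := by
    intro i hi
    by_cases h : i / 2 = ℓ
    · rw [inputVertex, h, hℓ, Nat.add_sub_cancel, if_neg hf]
    · rw [inputVertex]; split_ifs <;> omega
  have hm1 : ((m - 1 : ℕ) : ℝ) = (m : ℝ) - 1 := by
    push_cast [Nat.cast_sub (by omega : 1 ≤ m)]; rfl
  refine le_polyDist_of_drop (x := ((ℓ + 2 : ℕ) : ℝ)) (i := k % 2 + 2 * b + 1)
    (j := k % 2 + 2 * b + 2) _ _ (by omega) (by omega) (by omega) (by omega) ?_ ?_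
    (2 * ℓ + 1 / 2) ?_ ?_
  · rw [vertexSeq_natCurve _ (by omega), queryVertex_up hb]
    push_cast [hℓ]; linarith
  · rw [vertexSeq_natCurve _ (by omega), queryVertex_down]
    push_cast [hℓ]; linarith
  · intro y h0 h1 h2
    rw [← hm1] at h1
    obtain ⟨i, hi, ha, hb'⟩ := exists_cell (by omega) h0 h1
    have hi2 : i ≤ 2 * ℓ := by
      by_contra hcon
      have : ((2 * ℓ + 1 : ℕ) : ℝ) ≤ i := by exact_mod_cast (by omega : 2 * ℓ + 1 ≤ i)
      push_cast at this; linarith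
    have e1 : ((inputVertex f i : ℕ) : ℝ) ≤ ((ℓ + 2 : ℕ) : ℝ) := by
      exact_mod_cast hlow i (by omega)
    have e2 : ((inputVertex f (i + 1) : ℕ) : ℝ) ≤ ((ℓ + 2 : ℕ) : ℝ) := by
      exact_mod_cast hlow (i + 1) (by omega)
    rw [interpolate_eq _ ha hb', vertexSeq_natCurve _ (by omega), vertexSeq_natCurve _ (by omega)]
    nlinarith
  · intro y h0 h1 h2
    rw [← hm1] at h1
    obtain ⟨i, hi, ha, hb'⟩ := exists_cell (by omega) h0 h1
    have hi2 : 2 * ℓ ≤ i := by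
      by_contra hcon
      have : ((i + 1 : ℕ) : ℝ) ≤ ((2 * ℓ : ℕ) : ℝ) := by exact_mod_cast (by omega : i + 1 ≤ 2 * ℓ)
      push_cast at this; linarith
    have e1 : ((ℓ + 2 : ℕ) : ℝ) ≤ ((inputVertex f i : ℕ) : ℝ) := by
      exact_mod_cast hhigh i (by omega)
    have e2 : ((ℓ + 2 : ℕ) : ℝ) ≤ ((inputVertex f (i + 1) : ℕ) : ℝ) := by
      exact_mod_cast hhigh (i + 1) (by omega)
    rw [interpolate_eq _ ha hb', vertexSeq_natCurve _ (by omega), vertexSeq_natCurve _ (by omega)]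
    nlinarith

/-! ### Running programs -/

namespace WordRAM

/-- The program `p`, started in `s`, halts without overflow, and the number of steps and the final
state satisfy `Q`. -/
def Run (bits : ℕ) (p : Prog) (s : State) (Q : ℕ → State → Prop) : Prop :=
  ∃ t s', Exec bits p s t s' ∧ Q t s'

section Run

variable {bits : ℕ} {s : State} {Q Q' : ℕ → State → Prop} {p q : Prog}

lemma Run.mono (h : Run bits p s Q) (hQ : ∀ t s', Q t s' → Q' t s') : Run bits p s Q' := by
  obtain ⟨t, s', h, h'⟩ := h
  exact ⟨t, s', h, hQ _ _ h'⟩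

lemma run_skip (h : Q 1 s) : Run bits .skip s Q := ⟨_, _, .skip s, h⟩

lemma run_const {r v : ℕ} (hv : v < 2 ^ bits) (h : Q 1 (s.setReg r v)) :
    Run bits (.const r v) s Q := ⟨_, _, .const s r v hv, h⟩

lemma run_op {o : BinOp} {r x y : ℕ} (hv : o.eval (s.reg x) (s.reg y) < 2 ^ bits)
    (h : Q 1 (s.setReg r (o.eval (s.reg x) (s.reg y)))) : Run bits (.op o r x y) s Q :=
  ⟨_, _, .op s o r x y hv, h⟩

lemma run_load {b r x : ℕ} (hv : s.mem b (s.reg x) < 2 ^ bits)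
    (h : Q 1 (s.setReg r (s.mem b (s.reg x)))) : Run bits (.load b r x) s Q :=
  ⟨_, _, .load s b r x hv, h⟩

lemma run_store {b x y : ℕ} (hx : s.reg x < 2 ^ bits) (hy : s.reg y < 2 ^ bits)
    (h : Q 1 (s.setMem b (s.reg x) (s.reg y))) : Run bits (.store b x y) s Q :=
  ⟨_, _, .store s b x y hx hy, h⟩

lemma run_seq (h : Run bits p s fun t s' => Run bits q s' fun t' s'' => Q (t + t') s'') :
    Run bits (.seq p q) s Q := by
  obtain ⟨t, s', h, t', s'', h', hQ⟩ := h
  exact ⟨_, _, .seq h h', hQ⟩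

lemma run_cond {x : ℕ} (h1 : s.reg x ≠ 0 → Run bits p s fun t => Q (t + 1))
    (h2 : s.reg x = 0 → Run bits q s fun t => Q (t + 1)) : Run bits (.cond x p q) s Q := by
  by_cases h : s.reg x = 0
  · obtain ⟨t, s', h', hQ⟩ := h2 h
    exact ⟨_, _, .condFalse h h', hQ⟩
  · obtain ⟨t, s', h', hQ⟩ := h1 h
    exact ⟨_, _, .condTrue h h', hQ⟩

end Run

section States

variable (s : State) (r v x b i c j : ℕ)

lemma State.setReg_reg : (s.setReg r v).reg x = if x = r then v else s.reg x := by
  simp [State.setReg, Function.update_apply]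

lemma State.setReg_mem : (s.setReg r v).mem = s.mem := rfl

lemma State.setMem_reg : (s.setMem b i v).reg = s.reg := rfl

lemma State.setMem_mem :
    (s.setMem b i v).mem c j = if c = b ∧ j = i then v else s.mem c j := by
  simp only [State.setMem, Function.update_apply]
  by_cases h : c = b
  · subst h; simp [Function.update_apply]
  · simp [h]

lemma State.setMem_mem_ne {b c : ℕ} (h : c ≠ b) : (s.setMem b i v).mem c = s.mem c := by
  simp [State.setMem, h]

end States

/-! ### Clocked simulation -/

local notation "rSize" => (4 : ℕ)
local notation "rFuel" => (5 : ℕ)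
local notation "rTop" => (6 : ℕ)
local notation "rBase" => (7 : ℕ)
local notation "rT0" => (10 : ℕ)
local notation "rT1" => (11 : ℕ)
local notation "rT2" => (12 : ℕ)
local notation "rT3" => (13 : ℕ)
local notation "rOne" => (25 : ℕ)
local notation "rTwo" => (26 : ℕ)

/-- Copy the register `x` to the register `r`. -/
def Prog.copy (r x : ℕ) : Prog := .op .lor r x x

/-- Store the word in `rT0` in the simulated register `r`, or give up if it is too large. -/
def clockedResult (r : ℕ) : Prog :=
  .seq (.op .lt rT1 rT0 rSize) (.cond rT1 (.copy (64 + r) rT0) (.const rFuel 0))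

/-- Set `rT3` to a nonzero word iff there is fuel left and the simulated register `x` is nonzero. -/
def clockedTest (x : ℕ) : Prog :=
  .cond rFuel (.copy rT3 (64 + x)) (.const rT3 0)

/-- The clocked simulation of a program `p`, which halts for every `p`.

The register `r` of `p` is kept in the register `64 + r`.  The cell `i` of the bank `b` of `p`
is kept in the bank `b + 2`, at the address `top + i`, as its content plus `1`; if that word is
`0`, then the cell has not been written since the start of the simulation, and its content is found
in the same way at the address `base + i`.  Here `top` and `base` are the contents of the registers
`6` and `7`.  Every word of the simulation stays below the bound in register `4`.  The fuel in
register `5` decreases by at least `1` with every iteration of a loop, and is set to `0`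
if a word becomes too large; without fuel, no loop is entered or continued. -/
def clocked : Prog → Prog
  | .skip => .skip
  | .const r v => .seq (.const rT0 v) (clockedResult r)
  | .op o r x y => .seq (.op o rT0 (64 + x) (64 + y)) (clockedResult r)
  | .load b r x =>
      .seq (.op .add rT0 rTop (64 + x)) <| .seq (.load (b + 2) rT1 rT0) <|
      .seq (.cond rT1 .skip (.seq (.op .add rT0 rBase (64 + x)) (.load (b + 2) rT1 rT0))) <|
      .op .sub (64 + r) rT1 rOne
  | .store b x y =>
      .seq (.op .add rT0 rTop (64 + x)) <| .seq (.op .add rT1 (64 + y) rOne) <|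
      .store (b + 2) rT0 rT1
  | .seq p q => .seq (clocked p) (clocked q)
  | .cond x p q => .cond (64 + x) (clocked p) (clocked q)
  | .loop x p =>
      .seq (clockedTest x) <| .loop rT3 <|
        .seq (.op .sub rFuel rFuel rOne) <| .seq (clocked p) <| clockedTest x

/-- The time of the clocked simulation per unit of fuel. -/
def clockCost : Prog → ℕ
  | .skip => 8
  | .const _ _ => 8
  | .op _ _ _ _ => 8
  | .load _ _ _ => 8
  | .store _ _ _ => 8
  | .seq p q => clockCost p + clockCost q
  | .cond _ p q => clockCost p + clockCost q + 1
  | .loop _ p => clockCost p + 4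

/-- All registers and constants of a program are below `M`. -/
def Fits (M : ℕ) : Prog → Prop
  | .skip => True
  | .const r v => r < M ∧ v < M
  | .op _ r x y => r < M ∧ x < M ∧ y < M
  | .load _ r x => r < M ∧ x < M
  | .store _ x y => x < M ∧ y < M
  | .seq p q => Fits M p ∧ Fits M q
  | .cond x p q => x < M ∧ Fits M p ∧ Fits M q
  | .loop x p => x < M ∧ Fits M p

lemma Fits.mono {M M' : ℕ} (h : M ≤ M') : ∀ {p : Prog}, Fits M p → Fits M' p
  | .skip, _ => trivial
  | .const _ _, hp => ⟨hp.1.trans_le h, hp.2.trans_le h⟩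
  | .op _ _ _ _, hp => ⟨hp.1.trans_le h, hp.2.1.trans_le h, hp.2.2.trans_le h⟩
  | .load _ _ _, hp => ⟨hp.1.trans_le h, hp.2.trans_le h⟩
  | .store _ _ _, hp => ⟨hp.1.trans_le h, hp.2.trans_le h⟩
  | .seq _ _, hp => ⟨hp.1.mono h, hp.2.mono h⟩
  | .cond _ _ _, hp => ⟨hp.1.trans_le h, hp.2.1.mono h, hp.2.2.mono h⟩
  | .loop _ _, hp => ⟨hp.1.trans_le h, hp.2.mono h⟩

lemma exists_fits : ∀ p : Prog, ∃ M, Fits M p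
  | .skip => ⟨0, trivial⟩
  | .const r v => ⟨r + v + 1, by simp only [Fits]; omega⟩
  | .op _ r x y => ⟨r + x + y + 1, by simp only [Fits]; omega⟩
  | .load _ r x => ⟨r + x + 1, by simp only [Fits]; omega⟩
  | .store _ x y => ⟨x + y + 1, by simp only [Fits]; omega⟩
  | .seq p q => by
    obtain ⟨M, hM⟩ := exists_fits p
    obtain ⟨M', hM'⟩ := exists_fits q
    exact ⟨M + M', hM.mono (by omega), hM'.mono (by omega)⟩
  | .cond x p q => by
    obtain ⟨M, hM⟩ := exists_fits p
    obtain ⟨M', hM'⟩ := exists_fits q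
    exact ⟨M + M' + x + 1, by omega, hM.mono (by omega), hM'.mono (by omega)⟩
  | .loop x p => by
    obtain ⟨M, hM⟩ := exists_fits p
    exact ⟨M + x + 1, by omega, hM.mono (by omega)⟩

/-- The simulated content of the cell `i` of the bank `b`. -/
def overlay (e₁ e₀ : ℕ) (σ : State) (b i : ℕ) : ℕ :=
  (if σ.mem (b + 2) (e₁ + i) = 0 then σ.mem (b + 2) (e₀ + i) else σ.mem (b + 2) (e₁ + i)) - 1

/-- `σ` is ready for a clocked simulation of programs with registers below `R`, for words below
`S`, which writes at the addresses from `e₁` on. -/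
structure SimReady (R S e₁ e₀ : ℕ) (σ : State) : Prop where
  size : σ.reg rSize = S
  top : σ.reg rTop = e₁
  base : σ.reg rBase = e₀
  one : σ.reg rOne = 1
  fuel_le : σ.reg rFuel ≤ S
  reg_lt : ∀ r < R, σ.reg (64 + r) < S
  mem_le : ∀ b i, σ.mem (b + 2) i ≤ S

/-- `σ` and `σ'` agree on everything that a clocked simulation leaves alone. -/
structure SimFrame (R S e₁ : ℕ) (σ σ' : State) : Prop where
  reg : ∀ r, r ∉ [5, 10, 11, 12, 13] → (r < 64 ∨ 64 + R ≤ r) → σ'.reg r = σ.reg r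
  mem_bank : ∀ b < 2, σ'.mem b = σ.mem b
  mem_addr : ∀ b i, i < e₁ ∨ e₁ + S ≤ i → σ'.mem b i = σ.mem b i

lemma SimFrame.refl {R S e₁ : ℕ} (σ : State) : SimFrame R S e₁ σ σ :=
  ⟨fun _ _ _ => rfl, fun _ _ => rfl, fun _ _ _ => rfl⟩

lemma SimFrame.trans {R S e₁ : ℕ} {σ σ' σ'' : State} (h : SimFrame R S e₁ σ σ')
    (h' : SimFrame R S e₁ σ' σ'') : SimFrame R S e₁ σ σ'' :=
  ⟨fun r h1 h2 => (h'.reg r h1 h2).trans (h.reg r h1 h2),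
    fun b hb => (h'.mem_bank b hb).trans (h.mem_bank b hb),
    fun b i hi => (h'.mem_addr b i hi).trans (h.mem_addr b i hi)⟩

/-- `σ` represents the state `s` of the simulated program. -/
structure Represents (R S e₁ e₀ : ℕ) (s σ : State) : Prop where
  reg : ∀ r < R, σ.reg (64 + r) = s.reg r
  mem : ∀ b i, i < S → overlay e₁ e₀ σ b i = s.mem b i

/-- What the clocked simulation of `p` achieves from `σ`, if it ends in `σ'` after `t` steps. -/
structure ClockedPost (R S e₁ e₀ : ℕ) (p : Prog) (σ : State) (t : ℕ) (σ' : State) : Prop where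
  time : t + clockCost p * σ'.reg rFuel ≤ clockCost p * (σ.reg rFuel + 1)
  fuel_le : σ'.reg rFuel ≤ σ.reg rFuel
  ready : SimReady R S e₁ e₀ σ'
  frame : SimFrame R S e₁ σ σ'
  sim : ∀ b s u s', 2 ^ b ≤ S → Represents R S e₁ e₀ s σ → Exec b p s u s' → u < σ.reg rFuel →
    Represents R S e₁ e₀ s' σ' ∧ σ.reg rFuel ≤ σ'.reg rFuel + u

variable {R S e₁ e₀ bits : ℕ}

lemma SimReady.setReg {σ : State} (h : SimReady R S e₁ e₀ σ) {r v : ℕ}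
    (hr : r ∈ [10, 11, 12, 13]) : SimReady R S e₁ e₀ (σ.setReg r v) := by
  simp only [List.mem_cons, List.not_mem_nil, or_false] at hr
  refine ⟨?_, ?_, ?_, ?_, ?_, fun x hx => ?_, h.mem_le⟩ <;> rw [State.setReg_reg, if_neg (by omega)]
  exacts [h.size, h.top, h.base, h.one, h.fuel_le, h.reg_lt x hx]

lemma SimReady.setFuel {σ : State} (h : SimReady R S e₁ e₀ σ) {v : ℕ} (hv : v ≤ S) :
    SimReady R S e₁ e₀ (σ.setReg rFuel v) := by
  refine ⟨?_, ?_, ?_, ?_, ?_, fun x hx => ?_, h.mem_le⟩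
  · exact h.size
  · exact h.top
  · exact h.base
  · exact h.one
  · exact hv
  · rw [State.setReg_reg, if_neg (by omega)]; exact h.reg_lt x hx

lemma SimReady.setSim {σ : State} (h : SimReady R S e₁ e₀ σ) {r v : ℕ} (hv : v < S) :
    SimReady R S e₁ e₀ (σ.setReg (64 + r) v) := by
  refine ⟨?_, ?_, ?_, ?_, ?_, fun x hx => ?_, h.mem_le⟩ <;> rw [State.setReg_reg]
  · rw [if_neg (by omega), h.size]
  · rw [if_neg (by omega), h.top]
  · rw [if_neg (by omega), h.base]
  · rw [if_neg (by omega), h.one]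
  · rw [if_neg (by omega)]; exact h.fuel_le
  · split_ifs
    exacts [hv, h.reg_lt x hx]

lemma SimFrame.setReg (σ : State) {r v : ℕ} (hr : r ∈ [5, 10, 11, 12, 13]) :
    SimFrame R S e₁ σ (σ.setReg r v) := by
  refine ⟨fun x h1 _ => ?_, fun _ _ => rfl, fun _ _ _ => rfl⟩
  rw [State.setReg_reg, if_neg]
  rintro rfl; exact h1 hr

lemma SimFrame.setSim (σ : State) {r v : ℕ} (hr : r < R) :
    SimFrame R S e₁ σ (σ.setReg (64 + r) v) := by
  refine ⟨fun x _ h => ?_, fun _ _ => rfl, fun _ _ _ => rfl⟩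
  rw [State.setReg_reg, if_neg (by omega)]

lemma Represents.setReg {s σ : State} (h : Represents R S e₁ e₀ s σ) {r v : ℕ}
    (hr : r ∈ [5, 10, 11, 12, 13]) : Represents R S e₁ e₀ s (σ.setReg r v) := by
  simp only [List.mem_cons, List.not_mem_nil, or_false] at hr
  refine ⟨fun x hx => ?_, h.mem⟩
  rw [State.setReg_reg, if_neg (by omega), h.reg x hx]

lemma Represents.setSim {s σ : State} (h : Represents R S e₁ e₀ s σ) (r v : ℕ) :
    Represents R S e₁ e₀ (s.setReg r v) (σ.setReg (64 + r) v) := by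
  refine ⟨fun x hx => ?_, h.mem⟩
  rw [State.setReg_reg, State.setReg_reg, h.reg x hx]
  by_cases hxr : x = r <;> simp [hxr]

lemma run_copy {s : State} {Q : ℕ → State → Prop} {r x : ℕ} (hv : s.reg x < 2 ^ bits)
    (h : Q 1 (s.setReg r (s.reg x))) : Run bits (.copy r x) s Q := by
  have e : BinOp.lor.eval (s.reg x) (s.reg x) = s.reg x := Nat.or_self _
  exact run_op (by rwa [e]) (by rwa [e])

lemma clockedResult_spec (hS : S < 2 ^ bits) {σ : State} (h : SimReady R S e₁ e₀ σ) {r : ℕ}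
    (hr : r < R) :
    Run bits (clockedResult r) σ fun t σ' => t ≤ 3 ∧ SimReady R S e₁ e₀ σ' ∧
      SimFrame R S e₁ σ σ' ∧ σ'.reg rFuel ≤ σ.reg rFuel ∧
      ∀ s v, Represents R S e₁ e₀ s σ → v = σ.reg rT0 → v < S →
        Represents R S e₁ e₀ (s.setReg r v) σ' ∧ σ'.reg rFuel = σ.reg rFuel := by
  have hS0 := h.reg_lt r hr
  refine run_seq (run_op ?_ ?_)
  · simp only [BinOp.eval]
    split_ifs <;> omega
  · simp only [BinOp.eval, h.size]
    have h' := h.setReg (r := rT1) (v := if σ.reg rT0 < S then 1 else 0) (by simp)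
    have hfr := SimFrame.setReg (R := R) (S := S) (e₁ := e₁) σ (r := rT1)
      (v := if σ.reg rT0 < S then 1 else 0) (by simp)
    refine run_cond (fun hc => ?_) (fun hc => ?_)
    · have hlt : σ.reg rT0 < S := by
        by_contra hn
        simp [State.setReg_reg, hn] at hc
      have e : (σ.setReg rT1 (if σ.reg rT0 < S then 1 else 0)).reg rT0 = σ.reg rT0 := by
        simp [State.setReg_reg]
      refine run_copy (by rw [e]; omega) ?_
      rw [e]
      refine ⟨by norm_num, h'.setSim hlt, hfr.trans (SimFrame.setSim _ hr), ?_, ?_⟩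
      · simp only [State.setReg_reg]
        rw [if_neg (by omega), if_neg (by omega)]
      · rintro s v hs rfl _
        refine ⟨(hs.setReg (by simp)).setSim _ _, ?_⟩
        simp only [State.setReg_reg]
        rw [if_neg (by omega), if_neg (by omega)]
    · have hlt : ¬ σ.reg rT0 < S := by
        intro hn
        simp [State.setReg_reg, hn] at hc
      refine run_const (by omega) ⟨by norm_num, h'.setFuel (by omega),
        hfr.trans (SimFrame.setReg _ (by simp)), by simp [State.setReg_reg], ?_⟩
      rintro s v hs rfl hv
      exact absurd hv hlt

lemma clockedTest_spec (hS : S < 2 ^ bits) {σ : State} (h : SimReady R S e₁ e₀ σ) {x : ℕ}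
    (hx : x < R) :
    Run bits (clockedTest x) σ fun t σ' => t = 2 ∧
      ∃ v, σ' = σ.setReg rT3 v ∧ (v = 0 ↔ σ.reg rFuel = 0 ∨ σ.reg (64 + x) = 0) := by
  refine run_cond (fun hc => run_copy ((h.reg_lt x hx).trans hS) ?_)
    (fun hc => run_const (by omega) ?_)
  · exact ⟨rfl, _, rfl, by simp [hc]⟩
  · exact ⟨rfl, _, rfl, by simp [hc]⟩

lemma eval_lt_of_lt (o : BinOp) {x y : ℕ} (hS : S * S < 2 ^ bits) (hx : x < S) (hy : y < S) :
    o.eval x y < 2 ^ bits := by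
  have hle : S ≤ S * S := Nat.le_mul_self S
  have h2 : x + y ≤ S * S := by nlinarith
  cases o <;> simp only [BinOp.eval]
  · omega
  · omega
  · have := Nat.mul_le_mul hx.le hy.le; omega
  · have := Nat.div_le_self x y; omega
  · have := Nat.mod_le x y; omega
  · exact Nat.and_lt_two_pow _ (by omega)
  · exact Nat.or_lt_two_pow (by omega) (by omega)
  · exact Nat.xor_lt_two_pow (by omega) (by omega)
  · split_ifs <;> omega
  · split_ifs <;> omega

lemma SimReady.setMem {σ : State} (h : SimReady R S e₁ e₀ σ) {b i v : ℕ} (hv : v ≤ S) :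
    SimReady R S e₁ e₀ (σ.setMem b i v) := by
  refine ⟨h.size, h.top, h.base, h.one, h.fuel_le, h.reg_lt, fun c j => ?_⟩
  rw [State.setMem_mem]
  split_ifs
  exacts [hv, h.mem_le _ _]

lemma SimFrame.setMem (σ : State) {b i v : ℕ} (hi : i < S) :
    SimFrame R S e₁ σ (σ.setMem (b + 2) (e₁ + i) v) := by
  refine ⟨fun _ _ _ => rfl, fun c hc => State.setMem_mem_ne _ _ _ (by omega), fun c j hj => ?_⟩
  rw [State.setMem_mem, if_neg (by omega)]

lemma overlay_setMem (he : e₀ + S ≤ e₁) (σ : State) (b i v c j : ℕ) (hj : j < S) :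
    overlay e₁ e₀ (σ.setMem (b + 2) (e₁ + i) (v + 1)) c j =
      if c = b ∧ j = i then v else overlay e₁ e₀ σ c j := by
  by_cases h : c = b ∧ j = i
  · obtain ⟨rfl, rfl⟩ := h
    simp [overlay, State.setMem_mem]
  · have h1 : ¬ (c + 2 = b + 2 ∧ e₁ + j = e₁ + i) := by omega
    have h2 : ¬ (c + 2 = b + 2 ∧ e₀ + j = e₁ + i) := by omega
    simp only [overlay, State.setMem_mem, if_neg h1, if_neg h2, if_neg h]

lemma Represents.setMem {s σ : State} (h : Represents R S e₁ e₀ s σ) (he : e₀ + S ≤ e₁)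
    (b i v : ℕ) : Represents R S e₁ e₀ (s.setMem b i v) (σ.setMem (b + 2) (e₁ + i) (v + 1)) := by
  refine ⟨h.reg, fun c j hj => ?_⟩
  rw [overlay_setMem he _ _ _ _ _ _ hj, State.setMem_mem, h.mem c j hj]

lemma clockCost_pos (p : Prog) : 1 ≤ clockCost p := by
  induction p <;> simp only [clockCost] <;> omega

lemma clocked_loop_spec {p : Prog} {x : ℕ} (hx : x < R) (hS : S * S < 2 ^ bits)
    (hp : ∀ σ, SimReady R S e₁ e₀ σ → Run bits (clocked p) σ (ClockedPost R S e₁ e₀ p σ)) :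
    ∀ (F : ℕ) (σ : State), σ.reg rFuel = F → SimReady R S e₁ e₀ σ →
      (σ.reg rT3 = 0 ↔ σ.reg rFuel = 0 ∨ σ.reg (64 + x) = 0) →
      Run bits (.loop rT3 (.seq (.op .sub rFuel rFuel rOne) (.seq (clocked p) (clockedTest x)))) σ
        fun t σ' => t + clockCost (.loop x p) * σ'.reg rFuel ≤
            clockCost (.loop x p) * σ.reg rFuel + 1 ∧
          σ'.reg rFuel ≤ σ.reg rFuel ∧ SimReady R S e₁ e₀ σ' ∧ SimFrame R S e₁ σ σ' ∧
          ∀ b s u s', 2 ^ b ≤ S → Represents R S e₁ e₀ s σ → Exec b (.loop x p) s u s' →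
            u < σ.reg rFuel →
            Represents R S e₁ e₀ s' σ' ∧ σ.reg rFuel ≤ σ'.reg rFuel + u := by
  have hS1 : S < 2 ^ bits := lt_of_le_of_lt (Nat.le_mul_self S) hS
  intro F
  induction F using Nat.strong_induction_on with
  | _ F ih =>
  intro σ hF h hflag
  by_cases h3 : σ.reg rT3 = 0
  · refine ⟨_, _, .loopFalse h3, by omega, le_rfl, h, .refl _, ?_⟩
    intro b s u s' _ hs hex hu
    have hz : s.reg x = 0 := by
      rw [← hs.reg x hx]
      exact (hflag.1 h3).resolve_left (by omega)
    cases hex with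
    | loopTrue h0 => exact absurd hz h0
    | loopFalse => exact ⟨hs, by omega⟩
  · have hne : σ.reg rFuel ≠ 0 ∧ σ.reg (64 + x) ≠ 0 := by
      constructor <;> intro hc <;> exact h3 (hflag.2 (by tauto))
    set σ₁ := σ.setReg rFuel (σ.reg rFuel - 1) with hσ₁
    have hfS := h.fuel_le
    have hr1 : SimReady R S e₁ e₀ σ₁ := h.setFuel (by omega)
    have hf1 : SimFrame R S e₁ σ σ₁ := .setReg _ (by simp)
    have hfuel1 : σ₁.reg rFuel = σ.reg rFuel - 1 := by simp [hσ₁, State.setReg_reg]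
    obtain ⟨t₂, σ₂, hex₂, post⟩ := hp σ₁ hr1
    obtain ⟨t₃, σ₃, hex₃, rfl, v, rfl, hv⟩ := clockedTest_spec hS1 post.ready hx
    have hfuel3 : (σ₂.setReg rT3 v).reg rFuel = σ₂.reg rFuel := by simp [State.setReg_reg]
    have hle2 := post.fuel_le
    obtain ⟨t₄, σ₄, hex₄, htime, hle, hready, hframe, hsim⟩ := ih (σ₂.reg rFuel) (by omega)
      (σ₂.setReg rT3 v) hfuel3 (post.ready.setReg (by simp)) (by
        rw [hfuel3, State.setReg_reg, State.setReg_reg, if_pos rfl, if_neg (by omega)]; exact hv)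
    rw [hfuel3] at htime hle hsim
    have hdec : Exec bits (.op .sub rFuel rFuel rOne) σ 1 σ₁ := by
      have := Exec.op (bits := bits) σ .sub rFuel rFuel rOne
        (by simp only [BinOp.eval, h.one]; omega)
      simpa only [BinOp.eval, h.one] using this
    refine ⟨_, _, .loopTrue h3 (.seq hdec (.seq hex₂ hex₃)) hex₄, ?_, by omega, hready,
      hf1.trans (post.frame.trans ((SimFrame.setReg _ (by simp)).trans hframe)), ?_⟩
    · have ht := post.time
      have hpos := clockCost_pos p
      rw [hfuel1] at ht
      rw [Nat.sub_add_cancel (by omega)] at ht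
      simp only [clockCost] at htime ⊢
      have hge : σ₂.reg rFuel + 1 ≤ σ.reg rFuel := by omega
      nlinarith
    · intro b s u s' hb hs hex hu
      cases hex with
      | loopFalse h0 => exact absurd ((hs.reg x hx).trans h0) hne.2
      | @loopTrue _ _ _ s₁ _ u₁ u₂ h0 hbody hrest =>
        obtain ⟨hs1, hu1⟩ := post.sim b s u₁ s₁ hb (hs.setReg (by simp)) hbody (by omega)
        obtain ⟨hs2, hu2⟩ := hsim b s₁ u₂ s' hb (hs1.setReg (by simp)) hrest (by omega)
        exact ⟨hs2, by omega⟩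

/-- The clocked simulation of `p` always halts, within a time proportional to the fuel, without
overflow, and touches nothing outside its own memory.  If `p` halts on words bounded by `S` and
there is enough fuel, then it computes what `p` computes. -/
theorem clocked_spec (hS : S * S < 2 ^ bits) (hR : R ≤ 2 ^ bits) (he : e₀ + S ≤ e₁)
    (he₁ : e₁ + S < 2 ^ bits) :
    ∀ (p : Prog), Fits R p → ∀ σ, SimReady R S e₁ e₀ σ →
      Run bits (clocked p) σ (ClockedPost R S e₁ e₀ p σ) := by
  have hS1 : S < 2 ^ bits := lt_of_le_of_lt (Nat.le_mul_self S) hS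
  have result : ∀ (p : Prog) (σ σ₁ : State) (r v : ℕ), r < R → clockCost p = 8 →
      SimReady R S e₁ e₀ σ → σ₁ = σ.setReg rT0 v →
      (∀ b s u s', 2 ^ b ≤ S → Represents R S e₁ e₀ s σ → Exec b p s u s' →
        v < S ∧ s' = s.setReg r v) →
      Run bits (clockedResult r) σ₁ (fun t => ClockedPost R S e₁ e₀ p σ (1 + t)) := by
    rintro p σ _ r v hr hp h rfl hsim
    refine (clockedResult_spec hS1 (h.setReg (r := rT0) (v := v) (by simp)) hr).mono ?_
    rintro t σ' ⟨ht, hready, hframe, hle, hres⟩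
    have hfu : (σ.setReg rT0 v).reg rFuel = σ.reg rFuel := by simp [State.setReg_reg]
    rw [hfu] at hle hres
    refine ⟨by rw [hp]; omega, hle, hready, (SimFrame.setReg _ (by simp)).trans hframe, ?_⟩
    intro b s u s' hb hs hex hu
    obtain ⟨hv, rfl⟩ := hsim b s u s' hb hs hex
    obtain ⟨h1, h2⟩ := hres s v (hs.setReg (by simp)) (by simp [State.setReg_reg]) hv
    exact ⟨h1, by omega⟩
  intro p
  induction p with
  | skip =>
    intro _ σ h
    refine run_skip ⟨by simp only [clockCost]; omega, le_rfl, h, .refl _, ?_⟩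
    intro b s u s' _ hs hex _
    cases hex
    exact ⟨hs, by omega⟩
  | const r v =>
    intro hfit σ h
    refine run_seq (run_const (hfit.2.trans_le hR) (result _ _ _ r v hfit.1 rfl h rfl ?_))
    intro b s u s' hb hs hex
    cases hex with
    | const _ _ _ hv => exact ⟨hv.trans_le hb, rfl⟩
  | op o r x y =>
    intro hfit σ h
    refine run_seq (run_op (eval_lt_of_lt o hS (h.reg_lt x hfit.2.1) (h.reg_lt y hfit.2.2))
      (result _ _ _ r _ hfit.1 rfl h rfl ?_))
    intro b s u s' hb hs hex
    cases hex with
    | op _ _ _ _ _ hv =>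
      rw [← hs.reg x hfit.2.1, ← hs.reg y hfit.2.2] at hv ⊢
      exact ⟨hv.trans_le hb, rfl⟩
  | load b r x =>
    intro hfit σ h
    have hx := h.reg_lt x hfit.2
    have hm := h.mem_le b
    -- `w` is the word found on top of the base memory
    have finish : ∀ (σ' : State) (w t : ℕ), t ≤ 6 → w ≤ S → SimReady R S e₁ e₀ σ' →
        SimFrame R S e₁ σ σ' → σ'.reg rFuel = σ.reg rFuel → σ'.reg rT1 = w →
        (w - 1 = overlay e₁ e₀ σ b (σ.reg (64 + x))) →
        (∀ s, Represents R S e₁ e₀ s σ → Represents R S e₁ e₀ s σ') →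
        Run bits (.op .sub (64 + r) rT1 rOne) σ'
          (fun t' => ClockedPost R S e₁ e₀ (.load b r x) σ (t + t')) := by
      intro σ' w t ht hw hready hframe hfu hw1 hov hrep
      have e : BinOp.sub.eval (σ'.reg rT1) (σ'.reg rOne) = w - 1 := by
        rw [hw1, hready.one]; rfl
      refine run_op (by rw [e]; omega) ?_
      rw [e]
      have hfu' : (σ'.setReg (64 + r) (w - 1)).reg rFuel = σ.reg rFuel := by
        rw [State.setReg_reg, if_neg (by omega), hfu]
      refine ⟨by simp only [clockCost]; omega, hfu'.le, hready.setSim (by omega),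
        hframe.trans (.setSim _ hfit.1), ?_⟩
      intro b' s u s' hb hs hex hu
      cases hex with
      | load _ _ _ _ hv =>
        have : w - 1 = s.mem b (s.reg x) := by
          rw [hov, hs.mem b _ hx, hs.reg x hfit.2]
        rw [← this]
        exact ⟨(hrep s hs).setSim _ _, by omega⟩
    refine run_seq (run_op ?_ (run_seq (run_load ?_ (run_seq ?_))))
    · simp only [BinOp.eval, h.top]; omega
    · simp only [State.setReg_mem]
      exact (hm _).trans_lt hS1
    · have e : (σ.setReg rT0 (BinOp.add.eval (σ.reg rTop) (σ.reg (64 + x)))).reg rT0 =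
          e₁ + σ.reg (64 + x) := by
        rw [State.setReg_reg, if_pos rfl, h.top]; rfl
      rw [e, State.setReg_mem]
      set σ₁ := σ.setReg rT0 (BinOp.add.eval (σ.reg rTop) (σ.reg (64 + x)))
      set σ₂ := σ₁.setReg rT1 (σ.mem (b + 2) (e₁ + σ.reg (64 + x))) with hσ₂
      have hr2 : SimReady R S e₁ e₀ σ₂ := (h.setReg (by simp)).setReg (by simp)
      have hf2 : SimFrame R S e₁ σ σ₂ := (SimFrame.setReg σ (by simp)).trans (.setReg _ (by simp))
      have hp2 : ∀ s, Represents R S e₁ e₀ s σ → Represents R S e₁ e₀ s σ₂ :=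
        fun s hs => (hs.setReg (by simp)).setReg (by simp)
      have hT1 : σ₂.reg rT1 = σ.mem (b + 2) (e₁ + σ.reg (64 + x)) := by
        rw [hσ₂, State.setReg_reg, if_pos rfl]
      refine run_cond (fun hc => run_skip ?_) (fun hc => run_seq (run_op ?_ (run_load ?_ ?_)))
      · rw [hT1] at hc
        refine (finish σ₂ _ (1 + (1 + (1 + 1))) (by omega) (hm _) hr2 hf2
          (by simp [hσ₂, σ₁, State.setReg_reg]) hT1 (by rw [overlay, if_neg hc]) hp2).mono ?_
        intro t s' hpost
        rwa [show 1 + (1 + (1 + 1 + t)) = 1 + (1 + (1 + 1)) + t by ring]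
      · simp only [BinOp.eval, hr2.base]
        have : σ₂.reg (64 + x) < S := hr2.reg_lt x hfit.2
        omega
      · exact ((hr2.setReg (r := rT0) (by simp)).mem_le _ _).trans_lt hS1
      · rw [hT1] at hc
        have e : (σ₂.setReg rT0 (BinOp.add.eval (σ₂.reg rBase) (σ₂.reg (64 + x)))).reg rT0 =
            e₀ + σ.reg (64 + x) := by
          rw [State.setReg_reg, if_pos rfl, hr2.base]
          simp only [BinOp.eval, hσ₂, σ₁, State.setReg_reg]
          rw [if_neg (by omega), if_neg (by omega)]
        rw [e, State.setReg_mem]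
        refine (finish _ (σ₂.mem (b + 2) (e₀ + σ.reg (64 + x))) (1 + (1 + (1 + 1 + 1)))
          (by omega) (hm _) ((hr2.setReg (by simp)).setReg (by simp))
          (hf2.trans ((SimFrame.setReg _ (by simp)).trans (.setReg _ (by simp))))
          (by simp [hσ₂, σ₁, State.setReg_reg]) (by rw [State.setReg_reg, if_pos rfl])
          (by rw [overlay, if_pos hc]; rfl)
          (fun s hs => ((hp2 s hs).setReg (by simp)).setReg (by simp))).mono ?_
        intro t s' hpost
        rwa [show 1 + (1 + (1 + 1 + 1 + t)) = 1 + (1 + (1 + 1 + 1)) + t by ring]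
  | store b x y =>
    intro hfit σ h
    have hx := h.reg_lt x hfit.1
    have hy := h.reg_lt y hfit.2
    have e1 : BinOp.add.eval (σ.reg rTop) (σ.reg (64 + x)) = e₁ + σ.reg (64 + x) := by
      rw [h.top]; rfl
    refine run_seq (run_op (by rw [e1]; omega) ?_)
    rw [e1]
    set σ₁ := σ.setReg rT0 (e₁ + σ.reg (64 + x)) with hσ₁
    have hy1 : σ₁.reg (64 + y) = σ.reg (64 + y) := by
      rw [hσ₁, State.setReg_reg, if_neg (by omega)]
    have hr1 : SimReady R S e₁ e₀ σ₁ := h.setReg (by simp)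
    have e2 : BinOp.add.eval (σ₁.reg (64 + y)) (σ₁.reg rOne) = σ.reg (64 + y) + 1 := by
      rw [hy1, hr1.one]; rfl
    refine run_seq (run_op (by rw [e2]; omega) ?_)
    rw [e2]
    have hT0 : (σ₁.setReg rT1 (σ.reg (64 + y) + 1)).reg rT0 = e₁ + σ.reg (64 + x) := by
      simp [hσ₁, State.setReg_reg]
    have hT1 : (σ₁.setReg rT1 (σ.reg (64 + y) + 1)).reg rT1 = σ.reg (64 + y) + 1 := by
      simp [State.setReg_reg]
    refine run_store (by rw [hT0]; omega) (by rw [hT1]; omega) ?_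
    rw [hT0, hT1]
    have hfu : ((σ₁.setReg rT1 (σ.reg (64 + y) + 1)).setMem (b + 2) (e₁ + σ.reg (64 + x))
        (σ.reg (64 + y) + 1)).reg rFuel = σ.reg rFuel := by
      simp [hσ₁, State.setReg_reg, State.setMem_reg]
    refine ⟨by simp only [clockCost]; omega, hfu.le, (hr1.setReg (by simp)).setMem (by omega),
      (SimFrame.setReg σ (by simp)).trans ((SimFrame.setReg _ (by simp)).trans
        (SimFrame.setMem _ hx)), ?_⟩
    intro b' s u s' hb hs hex hu
    cases hex with
    | store _ _ _ _ _ _ =>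
      rw [← hs.reg x hfit.1, ← hs.reg y hfit.2]
      exact ⟨((hs.setReg (by simp)).setReg (by simp)).setMem he _ _ _, by omega⟩
  | seq p q ihp ihq =>
    intro hfit σ h
    refine run_seq ((ihp hfit.1 σ h).mono fun t σ₁ h1 => (ihq hfit.2 σ₁ h1.ready).mono ?_)
    intro t' σ₂ h2
    refine ⟨?_, h2.fuel_le.trans h1.fuel_le, h2.ready, h1.frame.trans h2.frame, ?_⟩
    · have := h1.time
      have := h2.time
      have := h1.fuel_le
      have := h2.fuel_le
      simp only [clockCost]
      nlinarith
    · intro b s u s' hb hs hex hu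
      cases hex with
      | @seq _ _ _ s₁ _ u₁ u₂ hex1 hex2 =>
        obtain ⟨hs1, hu1⟩ := h1.sim b s u₁ s₁ hb hs hex1 (by omega)
        obtain ⟨hs2, hu2⟩ := h2.sim b s₁ u₂ s' hb hs1 hex2 (by omega)
        exact ⟨hs2, by omega⟩
  | cond x p q ihp ihq =>
    intro hfit σ h
    refine run_cond (fun hc => (ihp hfit.2.1 σ h).mono fun t σ₁ h1 => ?_)
      (fun hc => (ihq hfit.2.2 σ h).mono fun t σ₁ h1 => ?_)
    all_goals
      refine ⟨?_, h1.fuel_le, h1.ready, h1.frame, ?_⟩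
      · have := h1.time
        have := h1.fuel_le
        simp only [clockCost]
        nlinarith
      · intro b s u s' hb hs hex hu
        rw [hs.reg x hfit.1] at hc
        cases hex with
        | condTrue h0 hex1 =>
          first
          | exact absurd hc h0
          | obtain ⟨hs1, hu1⟩ := h1.sim b s _ s' hb hs hex1 (by omega)
            exact ⟨hs1, by omega⟩
        | condFalse h0 hex1 =>
          first
          | exact absurd h0 hc
          | obtain ⟨hs1, hu1⟩ := h1.sim b s _ s' hb hs hex1 (by omega)
            exact ⟨hs1, by omega⟩
  | loop x p ih =>
    intro hfit σ h
    refine run_seq ((clockedTest_spec hS1 h hfit.1).mono ?_)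
    rintro _ _ ⟨rfl, v, rfl, hv⟩
    have hfu : (σ.setReg rT3 v).reg rFuel = σ.reg rFuel := by simp [State.setReg_reg]
    refine (clocked_loop_spec hfit.1 hS (ih hfit.2) _ _ rfl (h.setReg (by simp)) ?_).mono ?_
    · rw [hfu, State.setReg_reg, State.setReg_reg, if_pos rfl, if_neg (by omega)]; exact hv
    · rintro t σ' ⟨ht, hle, hready, hframe, hsim⟩
      rw [hfu] at ht hle hsim
      refine ⟨?_, hle, hready, (SimFrame.setReg _ (by simp)).trans hframe, ?_⟩
      · simp only [clockCost] at ht ⊢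
        nlinarith
      · intro b s u s' hb hs hex hu
        exact hsim b s u s' hb (hs.setReg (by simp)) hex hu

/-! ### Loops and straight-line code

The programs of the reduction use the following registers.  The registers `0` and `1` hold the
number `N` and the dimension `d` of the vectors, `2` and `3` the root `r` and the size `n = r ^ z`
of a group, `14` and `15` the numbers of groups and of guesses, and `25` and `26` the constants
`1` and `2`.  The guess counter is in register `16`, and the guess itself in `17` to `20` and
`22`.  Register `8` is the first unused address, register `9` the answer found so far, and
register `23` the number of the current query.  The registers `4` to `7`, `10` to `13` and those
from `64` on belong to the clocked simulation, and those from `30` to `47` are for intermediate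
results. -/

/-- Run `p` once for each value `n - 1, …, 0` of the register `c`, where `n` is its initial value.
The register `25` must hold `1`. -/
def Prog.countdown (c : ℕ) (p : Prog) : Prog := .loop c (.seq (.op .sub c c rOne) p)

lemma run_countdown {bits c T : ℕ} {p : Prog} (I : ℕ → State → Prop)
    (hI : ∀ i s, I i s → s.reg c = i ∧ s.reg rOne = 1) (hc : c ≠ rOne)
    (hp : ∀ i s, i < 2 ^ bits → I (i + 1) s →
      Run bits p (s.setReg c i) fun t s' => t ≤ T ∧ I i s') :
    ∀ (n : ℕ) (s : State), n < 2 ^ bits → I n s →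
      Run bits (.countdown c p) s fun t s' => t ≤ n * (T + 2) + 1 ∧ I 0 s'
  | 0, s, _, h => ⟨_, _, .loopFalse (hI 0 s h).1, by omega, h⟩
  | n + 1, s, hn, h => by
    have h1 := hI _ _ h
    have e : BinOp.sub.eval (s.reg c) (s.reg rOne) = n := by rw [h1.1, h1.2]; rfl
    have hex := Exec.op (bits := bits) s .sub c c rOne (by rw [e]; omega)
    rw [e] at hex
    obtain ⟨t, s', hp', ht, hs'⟩ := hp n s (by omega) h
    obtain ⟨t', s'', hl, ht', hs''⟩ := run_countdown I hI hc hp n s' (by omega) hs'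
    refine ⟨_, _, .loopTrue (by omega) (.seq hex hp') hl, ?_, hs''⟩
    rw [Nat.succ_mul]; omega

section Iff

variable {bits : ℕ} {s : State} {Q : ℕ → State → Prop}

lemma run_const_iff {r v : ℕ} : Run bits (.const r v) s Q ↔ v < 2 ^ bits ∧ Q 1 (s.setReg r v) :=
  ⟨fun ⟨_, _, h, hQ⟩ => by cases h with | const _ _ _ h => exact ⟨h, hQ⟩,
    fun h => run_const h.1 h.2⟩

lemma run_op_iff {o : BinOp} {r x y : ℕ} : Run bits (.op o r x y) s Q ↔
    o.eval (s.reg x) (s.reg y) < 2 ^ bits ∧ Q 1 (s.setReg r (o.eval (s.reg x) (s.reg y))) :=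
  ⟨fun ⟨_, _, h, hQ⟩ => by cases h with | op _ _ _ _ _ h => exact ⟨h, hQ⟩, fun h => run_op h.1 h.2⟩

lemma run_load_iff {b r x : ℕ} : Run bits (.load b r x) s Q ↔
    s.mem b (s.reg x) < 2 ^ bits ∧ Q 1 (s.setReg r (s.mem b (s.reg x))) :=
  ⟨fun ⟨_, _, h, hQ⟩ => by cases h with | load _ _ _ _ h => exact ⟨h, hQ⟩,
    fun h => run_load h.1 h.2⟩

lemma run_store_iff {b x y : ℕ} : Run bits (.store b x y) s Q ↔
    s.reg x < 2 ^ bits ∧ s.reg y < 2 ^ bits ∧ Q 1 (s.setMem b (s.reg x) (s.reg y)) :=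
  ⟨fun ⟨_, _, h, hQ⟩ => by cases h with | store _ _ _ _ h h' => exact ⟨h, h', hQ⟩,
    fun h => run_store h.1 h.2.1 h.2.2⟩

lemma run_seq_iff {p q : Prog} : Run bits (.seq p q) s Q ↔
    Run bits p s fun t s' => Run bits q s' fun t' s'' => Q (t + t') s'' :=
  ⟨fun ⟨_, _, h, hQ⟩ => by cases h with | seq h h' => exact ⟨_, _, h, _, _, h', hQ⟩, run_seq⟩

lemma run_copy_iff {r x : ℕ} : Run bits (.copy r x) s Q ↔
    s.reg x < 2 ^ bits ∧ Q 1 (s.setReg r (s.reg x)) := by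
  have e : BinOp.lor.eval (s.reg x) (s.reg x) = s.reg x := Nat.or_self _
  rw [Prog.copy, run_op_iff, e]

end Iff

/-! ### Blocks of coordinates -/

/-- The number of collisions of the bits `pos, pos + 1, …, pos + c - 1` of a vector with the `c`
lowest binary digits of `pat`. -/
def collisions (bit : ℕ → ℕ) : ℕ → ℕ → ℕ → ℕ
  | 0, _, _ => 0
  | c + 1, pos, pat => bit pos * (pat % 2) + collisions bit c (pos + 1) (pat / 2)

/-- The entry `pos` of the vector of length `d` that is stored from the address `a` on; `0` if
`pos ≥ d`. -/
def rowBit (mem : ℕ → ℕ) (d a pos : ℕ) : ℕ := mem (a + pos) * if pos < d then 1 else 0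

lemma collisions_le {bit : ℕ → ℕ} (hbit : ∀ i, bit i ≤ 1) :
    ∀ c pos pat, collisions bit c pos pat ≤ c
  | 0, _, _ => le_rfl
  | c + 1, pos, pat => by
    have h1 := collisions_le hbit c (pos + 1) (pat / 2)
    have h2 : bit pos * (pat % 2) ≤ 1 * 1 := Nat.mul_le_mul (hbit _) (by omega)
    rw [collisions]; omega

lemma rowBit_le {mem : ℕ → ℕ} (h : ∀ i, mem i ≤ 1) (d a pos : ℕ) : rowBit mem d a pos ≤ 1 := by
  have := h (a + pos)
  rw [rowBit]; split_ifs <;> omega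

/-- `s'` has the memory of `s`, and its registers outside of the list `l`. -/
def Touches (l : List ℕ) (s s' : State) : Prop :=
  s'.mem = s.mem ∧ ∀ x, x ∉ l → s'.reg x = s.reg x

lemma Touches.refl (l : List ℕ) (s : State) : Touches l s s := ⟨rfl, fun _ _ => rfl⟩

lemma Touches.setReg {l : List ℕ} {s s' : State} (h : Touches l s s') {r v : ℕ} (hr : r ∈ l) :
    Touches l s (s'.setReg r v) := by
  refine ⟨h.1, fun x hx => ?_⟩
  rw [State.setReg_reg, if_neg, h.2 x hx]
  rintro rfl; exact hx hr

/-- One step of the loop which counts the collisions of a vector with a pattern. -/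
def collideBody : Prog :=
  .seq (.op .lt 35 31 1) <| .seq (.op .add 36 30 31) <| .seq (.load 0 37 36) <|
  .seq (.op .mul 37 37 35) <| .seq (.op .mod 38 32 rTwo) <| .seq (.op .mul 37 37 38) <|
  .seq (.op .add 34 34 37) <| .seq (.op .div 32 32 rTwo) <| .op .add 31 31 rOne

/-- Compute in register `34` the collisions of the block of length `reg 33` that begins at the
position `reg 31` of the row of `A` at the address `reg 30`, with the pattern in register `32`. -/
def collide : Prog := .countdown 33 collideBody

lemma collide_spec {bits X : ℕ} (hX : 8 * (X * X) < 2 ^ bits) (hX1 : 1 ≤ X) {s : State} {l d : ℕ}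
    (h1 : s.reg 1 = d) (hone : s.reg rOne = 1) (htwo : s.reg rTwo = 2) (hmem : ∀ i, s.mem 0 i ≤ 1)
    (h33 : s.reg 33 = l) (h34 : s.reg 34 = 0) (hrow : s.reg 30 ≤ X * X)
    (hpos : s.reg 31 ≤ X * X) (hpat : s.reg 32 ≤ X) (hl : l ≤ X) :
    Run bits collide s fun t s' => t ≤ l * 11 + 1 ∧
      Touches [31, 32, 33, 34, 35, 36, 37, 38] s s' ∧
      s'.reg 34 = collisions (rowBit (s.mem 0) d (s.reg 30)) l (s.reg 31) (s.reg 32) := by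
  set bit := rowBit (s.mem 0) d (s.reg 30) with hbit
  have hbit1 : ∀ i, bit i ≤ 1 := rowBit_le hmem _ _
  have hXX : X ≤ X * X := Nat.le_mul_self X
  set total := collisions bit l (s.reg 31) (s.reg 32) with htotal
  have htot : total ≤ l := collisions_le hbit1 _ _ _
  refine (run_countdown (T := 9) (fun i s' => s'.reg 33 = i ∧ i ≤ l ∧
    Touches [31, 32, 33, 34, 35, 36, 37, 38] s s' ∧ s'.reg 31 + i = s.reg 31 + l ∧ s'.reg 32 ≤ X ∧
    s'.reg 34 + collisions bit i (s'.reg 31) (s'.reg 32) = total) ?_ (by norm_num) ?_ l s (by omega)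
    ?_).mono ?_
  · rintro i s' ⟨h, _, ⟨_, hreg⟩, _⟩
    exact ⟨h, by rw [hreg _ (by decide), hone]⟩
  · rintro i s' - ⟨h, hil, ⟨hm, hreg⟩, hp, hpt, hb⟩
    have e1 : s'.reg 1 = d := by rw [hreg _ (by decide), h1]
    have e25 : s'.reg 25 = 1 := by rw [hreg _ (by decide), hone]
    have e26 : s'.reg 26 = 2 := by rw [hreg _ (by decide), htwo]
    have e30 : s'.reg 30 = s.reg 30 := hreg _ (by decide)
    have hbp : s.mem 0 (s.reg 30 + s'.reg 31) * (if s'.reg 31 < d then 1 else 0) =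
      bit (s'.reg 31) := rfl
    have hb1 := hbit1 (s'.reg 31)
    have hm1 := hmem (s.reg 30 + s'.reg 31)
    rw [collisions] at hb
    have hb2 : bit (s'.reg 31) * (s'.reg 32 % 2) ≤ 1 * 1 := Nat.mul_le_mul hb1 (by omega)
    simp only [collideBody, run_seq_iff, run_op_iff, run_load_iff, State.setReg_reg,
      State.setReg_mem, BinOp.eval]
    simp only [Nat.reduceEqDiff, if_true, if_false, e1, e25, e26, e30, hm, hbp]
    refine ⟨by split_ifs <;> omega, by omega, by omega, by omega, by omega, by omega, by omega,
      by omega, by omega, by omega, by trivial, by omega, ?_, by omega, by omega, by omega⟩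
    iterate 9 refine Touches.setReg ?_ (by decide)
    exact .setReg ⟨hm, hreg⟩ (by decide)
  · exact ⟨h33, le_rfl, ⟨rfl, fun _ _ => rfl⟩, rfl, hpat, by rw [h34, zero_add]⟩
  · rintro t s' ⟨ht, _, _, hT, _, _, hb⟩
    exact ⟨by omega, hT, by simpa [collisions] using hb⟩

/-- The number with the `c` binary digits `bit pos, …, bit (pos + c - 1)`, the lowest first. -/
def pattern (bit : ℕ → ℕ) (pos : ℕ) : ℕ → ℕ
  | 0 => 0
  | c + 1 => pattern bit pos c + bit (pos + c) * 2 ^ c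

lemma pattern_lt {bit : ℕ → ℕ} (hbit : ∀ i, bit i ≤ 1) (pos : ℕ) :
    ∀ c, pattern bit pos c < 2 ^ c
  | 0 => by simp [pattern]
  | c + 1 => by
    have h1 := pattern_lt hbit pos c
    have h2 : bit (pos + c) * 2 ^ c ≤ 1 * 2 ^ c := Nat.mul_le_mul_right _ (hbit _)
    rw [pattern, pow_succ]; omega

/-- One step of the loop which reads a pattern: prepend a binary digit to register `32`. -/
def readPatternBody : Prog :=
  .seq (.op .add 35 31 33) <| .seq (.op .lt 36 35 1) <| .seq (.op .add 37 30 35) <|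
  .seq (.load 1 38 37) <| .seq (.op .mul 38 38 36) <| .seq (.op .mul 32 32 rTwo) <|
  .op .add 32 32 38

/-- Compute in register `32` the pattern of the block of length `reg 33` that begins at the
position `reg 31` of the row of `B` at the address `reg 30`. -/
def readPattern : Prog := .countdown 33 readPatternBody

lemma readPattern_spec {bits X : ℕ} (hX : 8 * (X * X) < 2 ^ bits) (hX1 : 1 ≤ X) {s : State}
    {l d : ℕ} (h1 : s.reg 1 = d) (hone : s.reg rOne = 1) (htwo : s.reg rTwo = 2)
    (hmem : ∀ i, s.mem 1 i ≤ 1) (h33 : s.reg 33 = l) (h32 : s.reg 32 = 0)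
    (hrow : s.reg 30 ≤ X * X) (hpos : s.reg 31 ≤ X * X) (hl : 2 ^ l ≤ X) :
    Run bits readPattern s fun t s' => t ≤ l * 9 + 1 ∧
      Touches [32, 33, 35, 36, 37, 38] s s' ∧
      s'.reg 32 = pattern (rowBit (s.mem 1) d (s.reg 30)) (s.reg 31) l := by
  set bit := rowBit (s.mem 1) d (s.reg 30) with hbit
  have hbit1 : ∀ i, bit i ≤ 1 := rowBit_le hmem _ _
  have hXX : X ≤ X * X := Nat.le_mul_self X
  have hl' : l < X := lt_of_lt_of_le Nat.lt_two_pow_self hl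
  set total := pattern bit (s.reg 31) l with htotal
  have htot : total < 2 ^ l := pattern_lt hbit1 _ _
  refine (run_countdown (T := 7) (fun i s' => s'.reg 33 = i ∧ i ≤ l ∧
    Touches [32, 33, 35, 36, 37, 38] s s' ∧
    s'.reg 32 * 2 ^ i + pattern bit (s.reg 31) i = total) ?_ (by norm_num) ?_ l s (by omega)
    ?_).mono ?_
  · rintro i s' ⟨h, _, ⟨_, hreg⟩, _⟩
    exact ⟨h, by rw [hreg _ (by decide), hone]⟩
  · rintro i s' - ⟨h, hil, ⟨hm, hreg⟩, hb⟩
    have e1 : s'.reg 1 = d := by rw [hreg _ (by decide), h1]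
    have e26 : s'.reg 26 = 2 := by rw [hreg _ (by decide), htwo]
    have e30 : s'.reg 30 = s.reg 30 := hreg _ (by decide)
    have e31 : s'.reg 31 = s.reg 31 := hreg _ (by decide)
    have hbp : s.mem 1 (s.reg 30 + (s.reg 31 + i)) * (if s.reg 31 + i < d then 1 else 0) =
      bit (s.reg 31 + i) := rfl
    have hb1 := hbit1 (s.reg 31 + i)
    have hm1 := hmem (s.reg 30 + (s.reg 31 + i))
    have hb' : (s'.reg 32 * 2 + bit (s.reg 31 + i)) * 2 ^ i + pattern bit (s.reg 31) i = total := by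
      rw [← hb, pattern, pow_succ]; ring
    have hle : s'.reg 32 * 2 + bit (s.reg 31 + i) ≤
        (s'.reg 32 * 2 + bit (s.reg 31 + i)) * 2 ^ i := Nat.le_mul_of_pos_right _ (by positivity)
    simp only [readPatternBody, run_seq_iff, run_op_iff, run_load_iff, State.setReg_reg,
      State.setReg_mem, BinOp.eval]
    simp only [Nat.reduceEqDiff, if_true, if_false, e1, e26, e30, e31, hm, hbp]
    refine ⟨by omega, by split_ifs <;> omega, by omega, by omega, by omega, by omega, by omega,
      by omega, by trivial, by omega, ?_, hb'⟩
    iterate 7 refine Touches.setReg ?_ (by decide)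
    exact .setReg ⟨hm, hreg⟩ (by decide)
  · exact ⟨h33, le_rfl, .refl _ _, by rw [h32, zero_mul, zero_add]⟩
  · rintro t s' ⟨ht, _, _, hT, hb⟩
    exact ⟨by omega, hT, by simpa [pattern] using hb⟩

/-- One step of the loop which computes an inner product. -/
def dotBody : Prog :=
  .seq (.op .add 35 30 33) <| .seq (.load 0 36 35) <| .seq (.op .add 37 31 33) <|
  .seq (.load 1 38 37) <| .seq (.op .mul 36 36 38) <| .op .add 34 34 36

/-- Add the inner product of the vectors that begin at the addresses in the registers `30` and `31`
to the register `34`. -/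
def dot : Prog := .countdown 33 dotBody

lemma dot_spec {bits X : ℕ} (hX : 8 * (X * X) < 2 ^ bits) (hX1 : 1 ≤ X) {s : State} {d : ℕ}
    (hone : s.reg rOne = 1) (hmem : ∀ i, s.mem 0 i ≤ 1) (hmem' : ∀ i, s.mem 1 i ≤ 1)
    (h33 : s.reg 33 = d) (h34 : s.reg 34 = 0) (hrow : s.reg 30 ≤ X * X) (hrow' : s.reg 31 ≤ X * X)
    (hd : d ≤ X) :
    Run bits dot s fun t s' => t ≤ d * 8 + 1 ∧ Touches [33, 34, 35, 36, 37, 38] s s' ∧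
      s'.reg 34 = ∑ x ∈ Finset.range d, s.mem 0 (s.reg 30 + x) * s.mem 1 (s.reg 31 + x) := by
  have hXX : X ≤ X * X := Nat.le_mul_self X
  set f : ℕ → ℕ := fun x => s.mem 0 (s.reg 30 + x) * s.mem 1 (s.reg 31 + x) with hf
  have hf1 : ∀ x, f x ≤ 1 := fun x => Nat.mul_le_mul (hmem _) (hmem' _)
  set total := ∑ x ∈ Finset.range d, f x with htotal
  have htot : total ≤ d := by
    simpa using Finset.sum_le_card_nsmul (Finset.range d) f 1 fun x _ => hf1 x
  refine (run_countdown (T := 6) (fun i s' => s'.reg 33 = i ∧ i ≤ d ∧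
    Touches [33, 34, 35, 36, 37, 38] s s' ∧ s'.reg 34 + ∑ x ∈ Finset.range i, f x = total)
    ?_ (by norm_num) ?_ d s (by omega) ?_).mono ?_
  · rintro i s' ⟨h, _, ⟨_, hreg⟩, _⟩
    exact ⟨h, by rw [hreg _ (by decide), hone]⟩
  · rintro i s' - ⟨h, hil, ⟨hm, hreg⟩, hb⟩
    have e30 : s'.reg 30 = s.reg 30 := hreg _ (by decide)
    have e31 : s'.reg 31 = s.reg 31 := hreg _ (by decide)
    have hfi : s.mem 0 (s.reg 30 + i) * s.mem 1 (s.reg 31 + i) = f i := rfl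
    have hf1i := hf1 i
    have hm0 := hmem (s.reg 30 + i)
    have hm1 := hmem' (s.reg 31 + i)
    rw [Finset.sum_range_succ] at hb
    simp only [dotBody, run_seq_iff, run_op_iff, run_load_iff, State.setReg_reg,
      State.setReg_mem, BinOp.eval]
    simp only [Nat.reduceEqDiff, if_true, if_false, e30, e31, hm, hfi]
    refine ⟨by omega, by omega, by omega, by omega, by omega, by omega, by omega, by trivial,
      by omega, ?_, by omega⟩
    iterate 6 refine Touches.setReg ?_ (by decide)
    exact .setReg ⟨hm, hreg⟩ (by decide)
  · exact ⟨h33, le_rfl, .refl _ _, by rw [h34, zero_add]⟩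
  · rintro t s' ⟨ht, _, _, hT, hb⟩
    exact ⟨by omega, hT, by simpa using hb⟩

/-! ### Writing the curves -/

/-- The vertex at the address `i` of the table of input curves. -/
def inputWord (A : ℕ → ℕ) (d start m l L i : ℕ) : ℕ :=
  inputVertex (fun q => collisions (rowBit A d ((start + i / m) * d)) l (q / L * l) (q % L)) (i % m)

/-- The vertex `v` of the query curve. -/
def queryWord (B : ℕ → ℕ) (d j k m l L v : ℕ) : ℕ :=
  queryVertex (fun b => b * L + pattern (rowBit B d (j * d)) (b * l) l) k m v

/-- The registers used for writing the curves. -/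
def writeRegs : List ℕ := [30, 31, 32, 33, 34, 35, 36, 37, 38, 40, 41, 42, 43, 44, 45]

lemma Touches.trans {l : List ℕ} {s s' s'' : State} (h : Touches l s s') (h' : Touches l s' s'') :
    Touches l s s'' := ⟨h'.1.trans h.1, fun x hx => (h'.2 x hx).trans (h.2 x hx)⟩

lemma Touches.mono {l l' : List ℕ} {s s' : State} (h : Touches l s s') (hl : l ⊆ l') :
    Touches l' s s' := ⟨h.1, fun x hx => h.2 x fun hx' => hx (hl hx')⟩

lemma inputVertex_le (f : ℕ → ℕ) (v : ℕ) : inputVertex f v ≤ v / 2 + 3 := by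
  rw [inputVertex]; split_ifs <;> omega

/-- Find the vector, the block and the pattern that belong to the vertex at the address
`reg 21` of the table of input curves. -/
def locateInput : Prog :=
  .seq (.op .div 40 21 18) <| .seq (.op .mod 41 21 18) <| .seq (.op .add 40 22 40) <|
  .seq (.op .mul 30 40 1) <| .seq (.op .div 42 41 rTwo) <| .seq (.op .sub 43 42 rOne) <|
  .seq (.op .div 31 43 20) <| .seq (.op .mul 31 31 19) <| .seq (.op .mod 32 43 20) <|
  .seq (.copy 33 19) <| .const 34 0

lemma locateInput_spec {bits X : ℕ} (hX : 8 * (X * X) < 2 ^ bits) (hX1 : 5 ≤ X) {s : State}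
    (h25 : s.reg rOne = 1) (h26 : s.reg rTwo = 2) (hi : s.reg 21 ≤ X)
    (hs : s.reg 22 + s.reg 21 / s.reg 18 ≤ X) (h1 : s.reg 1 ≤ X) (h19 : s.reg 19 ≤ X) :
    Run bits locateInput s fun t s' => t ≤ 11 ∧ Touches writeRegs s s' ∧
      s'.reg 30 = (s.reg 22 + s.reg 21 / s.reg 18) * s.reg 1 ∧
      s'.reg 31 = (s.reg 21 % s.reg 18 / 2 - 1) / s.reg 20 * s.reg 19 ∧
      s'.reg 32 = (s.reg 21 % s.reg 18 / 2 - 1) % s.reg 20 ∧ s'.reg 33 = s.reg 19 ∧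
      s'.reg 34 = 0 ∧ s'.reg 41 = s.reg 21 % s.reg 18 ∧ s'.reg 42 = s.reg 21 % s.reg 18 / 2 := by
  have hXX : 5 * X ≤ X * X := Nat.mul_le_mul_right _ hX1
  have hv : s.reg 21 % s.reg 18 ≤ X := (Nat.mod_le _ _).trans hi
  have hq : (s.reg 21 % s.reg 18 / 2 - 1) / s.reg 20 ≤ X := (Nat.div_le_self _ _).trans (by omega)
  have hpos : (s.reg 21 % s.reg 18 / 2 - 1) / s.reg 20 * s.reg 19 ≤ X * X := Nat.mul_le_mul hq h19
  have hpat : (s.reg 21 % s.reg 18 / 2 - 1) % s.reg 20 ≤ X := (Nat.mod_le _ _).trans (by omega)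
  have hrow := Nat.mul_le_mul hs h1
  simp only [locateInput, run_seq_iff, run_op_iff, run_copy_iff, run_const_iff,
    State.setReg_reg, BinOp.eval]
  simp only [Nat.reduceEqDiff, if_true, if_false, h25, h26]
  refine ⟨by omega, by omega, by omega, by omega, by omega, by omega, by omega, by omega,
    by omega, by omega, by omega, by omega, ?_, by trivial, by trivial, by trivial, by trivial,
    by trivial, by trivial, by trivial⟩
  iterate 11 refine Touches.setReg ?_ (by decide)
  exact .refl _ _

/-- Compute the vertex of the input curve from its location and from the collisions in register
`34`. -/
def shapeInput : Prog :=
  .seq (.op .add 42 42 rTwo) <| .seq (.op .mod 41 41 rTwo) <|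
  .cond 34 .skip (.cond 41 (.op .sub 42 42 rOne) (.op .add 42 42 rOne))

lemma shapeInput_spec {bits : ℕ} (hX : 8 < 2 ^ bits) {s : State}
    (h25 : s.reg rOne = 1) (h26 : s.reg rTwo = 2) (h42 : s.reg 42 + 3 < 2 ^ bits) :
    Run bits shapeInput s fun t s' => t ≤ 5 ∧ Touches writeRegs s s' ∧
      s'.reg 42 = if s.reg 34 = 0 then (if s.reg 41 % 2 = 0 then s.reg 42 + 3 else s.reg 42 + 1)
        else s.reg 42 + 2 := by
  simp only [shapeInput, run_seq_iff, run_op_iff, State.setReg_reg, BinOp.eval]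
  simp only [Nat.reduceEqDiff, if_false, h26]
  refine ⟨by omega, by omega, run_cond (fun hc => run_skip ?_) (fun hc => run_cond (fun hc' => ?_)
    (fun hc' => ?_))⟩
  · simp only [State.setReg_reg, Nat.reduceEqDiff, if_true, if_false] at hc ⊢
    refine ⟨by omega, ((Touches.refl _ _).setReg (by decide)).setReg (by decide), by simp [hc]⟩
  all_goals
    simp only [State.setReg_reg, Nat.reduceEqDiff, if_true, if_false] at hc hc'
    simp only [run_op_iff, State.setReg_reg, Nat.reduceEqDiff, if_true, if_false, BinOp.eval, h25]
    refine ⟨by omega, by omega, (((Touches.refl _ _).setReg (by decide)).setReg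
      (by decide)).setReg (by decide), ?_⟩
    simp only [hc, hc', if_false]; rfl

/-- Store the vertex in register `42`, with denominator `1`.  Stored words are increased by `1`, as
the clocked simulation demands. -/
def emitInput : Prog :=
  .seq (.op .add 42 42 rOne) <| .seq (.op .add 40 6 21) <| .seq (.store 2 40 42) <|
  .store 4 40 rTwo

lemma emitInput_spec {bits : ℕ} {s : State} (h25 : s.reg rOne = 1) (h26 : s.reg rTwo = 2)
    (h2 : 2 < 2 ^ bits) (h42 : s.reg 42 + 1 < 2 ^ bits) (h6 : s.reg 6 + s.reg 21 < 2 ^ bits) :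
    Run bits emitInput s fun t s' => t ≤ 4 ∧ (∀ x, x ∉ writeRegs → s'.reg x = s.reg x) ∧
      ∀ b c, s'.mem b c = if (b = 2 ∨ b = 4) ∧ c = s.reg 6 + s.reg 21 then
        (if b = 2 then s.reg 42 + 1 else 2) else s.mem b c := by
  simp only [emitInput, run_seq_iff, run_op_iff, run_store_iff, State.setReg_reg, BinOp.eval,
    State.setMem_reg]
  simp only [Nat.reduceEqDiff, if_true, if_false, h25, h26]
  refine ⟨by omega, by omega, by omega, by omega, by omega, by omega, by omega, fun x hx => ?_,
    fun b c => ?_⟩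
  · rw [if_neg (by rintro rfl; exact hx (by decide)), if_neg (by rintro rfl; exact hx (by decide))]
  · simp only [State.setMem_mem, State.setReg_mem]
    by_cases hc : c = s.reg 6 + s.reg 21
    · by_cases hb4 : b = 4
      · subst hb4; simp [hc]
      · by_cases hb2 : b = 2
        · subst hb2; simp [hc]
        · simp [hb2, hb4]
    · simp [hc]

/-- Write the table of input curves into the memory of the simulation, as numerators and
denominators. -/
def writeInput : Prog :=
  .seq (.op .mul 21 3 18) <| .countdown 21 <|
    .seq locateInput <| .seq collide <| .seq shapeInput emitInput

lemma writeInput_spec {bits X : ℕ} (hX : 8 * (X * X) < 2 ^ bits) (hX1 : 5 ≤ X) {s : State}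
    {l d n m L start : ℕ} (h1 : s.reg 1 = d) (h3 : s.reg 3 = n) (hone : s.reg rOne = 1)
    (htwo : s.reg rTwo = 2) (hmem : ∀ i, s.mem 0 i ≤ 1) (h18 : s.reg 18 = m) (h19 : s.reg 19 = l)
    (h20 : s.reg 20 = L) (h22 : s.reg 22 = start) (hstart : start + n ≤ X) (hnm : n * m ≤ X)
    (hd : d ≤ X) (hl : l ≤ X) (htop : s.reg 6 ≤ X) :
    Run bits writeInput s fun t s' => t ≤ n * m * (l * 11 + 23) + 2 ∧
      (∀ x, x ∉ 21 :: writeRegs → s'.reg x = s.reg x) ∧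
      ∀ b c, s'.mem b c = if (b = 2 ∨ b = 4) ∧ s.reg 6 ≤ c ∧ c < s.reg 6 + n * m then
        (if b = 2 then inputWord (s.mem 0) d start m l L (c - s.reg 6) + 1 else 2)
        else s.mem b c := by
  have hXX : 5 * X ≤ X * X := Nat.mul_le_mul_right _ hX1
  refine run_seq (run_op ?_ ?_)
  · simp only [BinOp.eval, h3, h18]; omega
  simp only [BinOp.eval, h3, h18]
  refine (run_countdown (T := l * 11 + 21) (fun i s' => s'.reg 21 = i ∧ i ≤ n * m ∧
      (∀ x, x ∉ 21 :: writeRegs → s'.reg x = s.reg x) ∧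
      ∀ b c, s'.mem b c = if (b = 2 ∨ b = 4) ∧ s.reg 6 + i ≤ c ∧ c < s.reg 6 + n * m then
        (if b = 2 then inputWord (s.mem 0) d start m l L (c - s.reg 6) + 1 else 2)
        else s.mem b c)
    ?_ (by norm_num) ?_ (n * m) _ (by omega) ?_).mono ?_
  · rintro i s' ⟨h, _, hreg, _⟩
    exact ⟨h, by rw [hreg _ (by decide), hone]⟩
  · rintro i s' - ⟨h, hil, hreg, hmm⟩
    have hin : i / m < n := Nat.div_lt_of_lt_mul (by rw [mul_comm]; omega)
    set σ := s'.setReg 21 i with hσ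
    have e0 : σ.mem 0 = s.mem 0 := by
      funext c; rw [hσ, State.setReg_mem, hmm, if_neg (by omega)]
    have hre : ∀ x, x ∉ 21 :: writeRegs → σ.reg x = s.reg x := by
      intro x hx
      rw [hσ, State.setReg_reg, if_neg (by rintro rfl; exact hx (by decide)), hreg x hx]
    have e21 : σ.reg 21 = i := by rw [hσ, State.setReg_reg, if_pos rfl]
    have e1 : σ.reg 1 = d := by rw [hre _ (by decide), h1]
    have e6 : σ.reg 6 = s.reg 6 := hre _ (by decide)
    have e18 : σ.reg 18 = m := by rw [hre _ (by decide), h18]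
    have e19 : σ.reg 19 = l := by rw [hre _ (by decide), h19]
    have e20 : σ.reg 20 = L := by rw [hre _ (by decide), h20]
    have e22 : σ.reg 22 = start := by rw [hre _ (by decide), h22]
    have e25 : σ.reg 25 = 1 := by rw [hre _ (by decide), hone]
    have e26 : σ.reg 26 = 2 := by rw [hre _ (by decide), htwo]
    have hq : (i % m / 2 - 1) / L ≤ X :=
      (Nat.div_le_self _ _).trans (by have := Nat.mod_le i m; omega)
    have hpos : (i % m / 2 - 1) / L * l ≤ X * X := Nat.mul_le_mul hq hl
    have hrow : (start + i / m) * d ≤ X * X := Nat.mul_le_mul (by omega) hd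
    have hmod := Nat.mod_le i m
    refine run_seq ((locateInput_spec hX hX1 e25 e26 (by omega) (by rw [e21, e18, e22]; omega)
      (by omega) (by omega)).mono ?_)
    rintro t₁ s₁ ⟨ht₁, hT₁, h30, h31, h32, h33, h34, h41, h42⟩
    rw [e1, e18, e21, e22] at h30
    rw [e18, e19, e20, e21] at h31
    rw [e18, e20, e21] at h32
    rw [e19] at h33
    rw [e18, e21] at h41 h42
    have f1 : s₁.reg 1 = d := by rw [hT₁.2 _ (by decide), e1]
    have f25 : s₁.reg 25 = 1 := by rw [hT₁.2 _ (by decide), e25]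
    have f26 : s₁.reg 26 = 2 := by rw [hT₁.2 _ (by decide), e26]
    have f0 : s₁.mem 0 = s.mem 0 := by rw [hT₁.1, e0]
    refine run_seq ((collide_spec hX (by omega) f1 f25 f26 (by rw [f0]; exact hmem) h33 h34
      (by omega) (by omega) (by rw [h32]; exact (Nat.mod_le _ _).trans (by omega)) hl).mono ?_)
    rintro t₂ s₂ ⟨ht₂, hT₂', hbad⟩
    rw [f0, h30, h31, h32] at hbad
    have g42 : s₂.reg 42 = i % m / 2 := by rw [hT₂'.2 _ (by decide), h42]
    have g41 : s₂.reg 41 = i % m := by rw [hT₂'.2 _ (by decide), h41]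
    have hT₂ := hT₁.trans (hT₂'.mono (by decide))
    refine run_seq ((shapeInput_spec (by omega) (by rw [hT₂.2 _ (by decide), e25])
      (by rw [hT₂.2 _ (by decide), e26]) (by omega)).mono ?_)
    rintro t₃ s₃ ⟨ht₃, hT₃', hword⟩
    have hw : s₃.reg 42 = inputWord (s.mem 0) d start m l L i := by
      rw [hword, hbad, g41, g42]; rfl
    have hle : inputWord (s.mem 0) d start m l L i ≤ i % m / 2 + 3 := inputVertex_le _ _
    have hT₃ := hT₂.trans hT₃'
    have k6 : s₃.reg 6 = s.reg 6 := by rw [hT₃.2 _ (by decide), e6]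
    have k21 : s₃.reg 21 = i := by rw [hT₃.2 _ (by decide), e21]
    refine (emitInput_spec (by rw [hT₃.2 _ (by decide), e25]) (by rw [hT₃.2 _ (by decide), e26])
      (by omega) (by omega) (by omega)).mono ?_
    rintro t₄ s₄ ⟨ht₄, hr₄, hm₄⟩
    refine ⟨by omega, ?_, by omega, fun x hx => ?_, fun b c => ?_⟩
    · rw [hr₄ _ (by decide), k21]
    · have hx' : x ∉ writeRegs := fun h => hx (List.mem_cons_of_mem _ h)
      rw [hr₄ x hx', hT₃.2 x hx', hre x hx]
    · rw [hm₄, k6, k21, hw, hT₃.1, hσ, State.setReg_mem, hmm]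
      by_cases hb : b = 2 ∨ b = 4
      · by_cases hc : c = s.reg 6 + i
        · have hlt : s.reg 6 + i < s.reg 6 + n * m := by omega
          simp only [hc, hb, hlt, true_and, if_true, le_refl, Nat.add_sub_cancel_left]
        · simp only [hb, hc, and_false, if_false, true_and]
          exact if_congr (by omega) rfl rfl
      · rw [if_neg (fun h => hb h.1), if_neg (fun h => hb h.1), if_neg (fun h => hb h.1)]
  · refine ⟨by rw [State.setReg_reg, if_pos rfl], le_rfl, fun x hx => ?_, fun b c => ?_⟩
    · rw [State.setReg_reg, if_neg (by rintro rfl; exact hx (by decide))]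
    · rw [if_neg (by omega), State.setReg_mem]
  · rintro t s' ⟨ht, _, _, hreg, hmm⟩
    exact ⟨by linarith, hreg, by simpa using hmm⟩

/-- Find the block that belongs to the vertex `reg 21` of the query curve. -/
def locateQuery : Prog :=
  .seq (.op .mod 40 17 rTwo) <| .seq (.op .sub 41 21 40) <| .seq (.op .sub 42 41 rOne) <|
  .seq (.op .div 42 42 rTwo) <| .seq (.op .mul 31 42 19) <| .seq (.op .mul 30 23 1) <|
  .seq (.const 32 0) <| .copy 33 19

lemma locateQuery_spec {bits X : ℕ} (hX : 8 * (X * X) < 2 ^ bits) (hX1 : 5 ≤ X) {s : State}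
    (h25 : s.reg rOne = 1) (h26 : s.reg rTwo = 2) (hi : s.reg 21 ≤ X)
    (hs : s.reg 23 ≤ X) (h1 : s.reg 1 ≤ X) (h19 : s.reg 19 ≤ X) :
    Run bits locateQuery s fun t s' => t ≤ 8 ∧ Touches writeRegs s s' ∧
      s'.reg 30 = s.reg 23 * s.reg 1 ∧
      s'.reg 31 = (s.reg 21 - s.reg 17 % 2 - 1) / 2 * s.reg 19 ∧
      s'.reg 32 = 0 ∧ s'.reg 33 = s.reg 19 ∧ s'.reg 41 = s.reg 21 - s.reg 17 % 2 ∧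
      s'.reg 42 = (s.reg 21 - s.reg 17 % 2 - 1) / 2 := by
  have hXX : 5 * X ≤ X * X := Nat.mul_le_mul_right _ hX1
  have hq : (s.reg 21 - s.reg 17 % 2 - 1) / 2 ≤ X := by omega
  have hpos := Nat.mul_le_mul hq h19
  have hrow := Nat.mul_le_mul hs h1
  simp only [locateQuery, run_seq_iff, run_op_iff, run_copy_iff, run_const_iff,
    State.setReg_reg, BinOp.eval]
  simp only [Nat.reduceEqDiff, if_true, if_false, h25, h26]
  refine ⟨by omega, by omega, by omega, by omega, by omega, by omega, by omega, by omega,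
    by omega, ?_, by trivial, by trivial, by trivial, by trivial, by trivial, by trivial⟩
  iterate 8 refine Touches.setReg ?_ (by decide)
  exact .refl _ _

/-- Compute the vertex of the query curve from its block and from the pattern in register `32`. -/
def shapeQuery : Prog :=
  .seq (.op .mul 42 42 20) <| .seq (.op .add 42 42 32) <| .seq (.op .add 43 21 rOne) <|
  .seq (.op .eq 43 43 17) <| .seq (.op .mod 44 41 rTwo) <|
  .cond 41
    (.cond 43 (.seq (.op .sub 42 18 rOne) <| .seq (.op .div 42 42 rTwo) <| .op .add 42 42 rTwo) <|
      .cond 44 (.seq (.const 45 5) <| .op .add 42 42 45) (.op .add 42 42 rOne))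
    (.copy 42 rTwo)

lemma shapeQuery_spec {bits X : ℕ} (hX : 8 * (X * X) < 2 ^ bits) (hX1 : 5 ≤ X) {s : State}
    (h25 : s.reg rOne = 1) (h26 : s.reg rTwo = 2) (h42 : s.reg 42 * s.reg 20 ≤ X * X)
    (h32 : s.reg 32 ≤ X) (h21 : s.reg 21 ≤ X) (h18 : s.reg 18 ≤ X) :
    Run bits shapeQuery s fun t s' => t ≤ 10 ∧ Touches writeRegs s s' ∧
      s'.reg 42 = if s.reg 41 = 0 then 2 else if s.reg 21 + 1 = s.reg 17 then
        (s.reg 18 - 1) / 2 + 2 else if s.reg 41 % 2 = 1 then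
        s.reg 42 * s.reg 20 + s.reg 32 + 5 else s.reg 42 * s.reg 20 + s.reg 32 + 1 := by
  have hXX : 5 * X ≤ X * X := Nat.mul_le_mul_right _ hX1
  simp only [shapeQuery, run_seq_iff, run_op_iff, State.setReg_reg, BinOp.eval]
  simp only [Nat.reduceEqDiff, if_true, if_false, h25, h26]
  refine ⟨by omega, by omega, by omega, by split_ifs <;> omega, by omega,
    run_cond (fun h41 => run_cond (fun h43 => ?_) (fun h43 => run_cond (fun h44 => ?_)
      (fun h44 => ?_))) (fun h41 => ?_)⟩
  all_goals
    simp only [State.setReg_reg, Nat.reduceEqDiff, if_true, if_false] at *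
    simp only [run_seq_iff, run_op_iff, run_copy_iff, run_const_iff, State.setReg_reg,
      Nat.reduceEqDiff, if_true, if_false, BinOp.eval, h25, h26]
  · have hc : s.reg 21 + 1 = s.reg 17 := by
      by_contra hc; simp [hc] at h43
    refine ⟨by omega, by omega, by omega, by omega, ?_, by rw [if_neg h41, if_pos hc]⟩
    iterate 8 refine Touches.setReg ?_ (by decide)
    exact .refl _ _
  · have hc : ¬ s.reg 21 + 1 = s.reg 17 := by
      intro hc; simp [hc] at h43
    refine ⟨by omega, by omega, by omega, ?_,
      by rw [if_neg h41, if_neg hc, if_pos (by omega)]⟩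
    iterate 7 refine Touches.setReg ?_ (by decide)
    exact .refl _ _
  · have hc : ¬ s.reg 21 + 1 = s.reg 17 := by
      intro hc; simp [hc] at h43
    refine ⟨by omega, by omega, ?_, by rw [if_neg h41, if_neg hc, if_neg (by omega)]⟩
    iterate 6 refine Touches.setReg ?_ (by decide)
    exact .refl _ _
  · refine ⟨by omega, by omega, ?_, by rw [if_pos h41]⟩
    iterate 6 refine Touches.setReg ?_ (by decide)
    exact .refl _ _

/-- Store the vertex in register `42`, with denominator `1`, increased by `1` like all words of the
simulation. -/
def emitQuery : Prog :=
  .seq (.op .add 42 42 rOne) <| .seq (.op .add 40 6 21) <| .seq (.store 5 40 42) <|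
  .seq (.store 6 40 rOne) <| .store 7 40 rTwo

lemma emitQuery_spec {bits : ℕ} {s : State} (h25 : s.reg rOne = 1) (h26 : s.reg rTwo = 2)
    (h2 : 2 < 2 ^ bits) (h42 : s.reg 42 + 1 < 2 ^ bits) (h6 : s.reg 6 + s.reg 21 < 2 ^ bits) :
    Run bits emitQuery s fun t s' => t ≤ 5 ∧ (∀ x, x ∉ writeRegs → s'.reg x = s.reg x) ∧
      ∀ b c, s'.mem b c = if (b = 5 ∨ b = 6 ∨ b = 7) ∧ c = s.reg 6 + s.reg 21 then
        (if b = 5 then s.reg 42 + 1 else if b = 6 then 1 else 2) else s.mem b c := by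
  simp only [emitQuery, run_seq_iff, run_op_iff, run_store_iff, State.setReg_reg, BinOp.eval,
    State.setMem_reg]
  simp only [Nat.reduceEqDiff, if_true, if_false, h25, h26]
  refine ⟨by omega, by omega, by omega, by omega, by omega, by omega, by omega, by omega, by omega,
    fun x hx => ?_, fun b c => ?_⟩
  · rw [if_neg (by rintro rfl; exact hx (by decide)), if_neg (by rintro rfl; exact hx (by decide))]
  · simp only [State.setMem_mem, State.setReg_mem]
    by_cases hc : c = s.reg 6 + s.reg 21
    · by_cases hb7 : b = 7
      · subst hb7; simp [hc]
      · by_cases hb6 : b = 6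
        · subst hb6; simp [hc]
        · by_cases hb5 : b = 5
          · subst hb5; simp [hc]
          · simp [hb5, hb6, hb7]
    · simp [hc]

/-- Write the query curve into the memory of the simulation, as positive and negative parts of the
numerators and as denominators. -/
def writeQuery : Prog :=
  .seq (.copy 21 17) <| .countdown 21 <|
    .seq locateQuery <| .seq readPattern <| .seq shapeQuery emitQuery

lemma writeQuery_spec {bits X : ℕ} (hX : 8 * (X * X) < 2 ^ bits) (hX1 : 5 ≤ X) {s : State}
    {l d k m L j : ℕ} (h1 : s.reg 1 = d) (hone : s.reg rOne = 1)
    (htwo : s.reg rTwo = 2) (hmem : ∀ i, s.mem 1 i ≤ 1) (h17 : s.reg 17 = k) (h18 : s.reg 18 = m)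
    (h19 : s.reg 19 = l) (h20 : s.reg 20 = L) (h23 : s.reg 23 = j) (hj : j ≤ X)
    (hd : d ≤ X) (hl : 2 ^ l ≤ X) (htop : s.reg 6 ≤ X) (hk : k ≤ X) (hm : m ≤ X) (hL : L ≤ X) :
    Run bits writeQuery s fun t s' => t ≤ k * (l * 9 + 26) + 2 ∧
      (∀ x, x ∉ 21 :: writeRegs → s'.reg x = s.reg x) ∧
      ∀ b c, s'.mem b c = if (b = 5 ∨ b = 6 ∨ b = 7) ∧ s.reg 6 ≤ c ∧ c < s.reg 6 + k then
        (if b = 5 then queryWord (s.mem 1) d j k m l L (c - s.reg 6) + 1 else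
          if b = 6 then 1 else 2)
        else s.mem b c := by
  have hXX : 5 * X ≤ X * X := Nat.mul_le_mul_right _ hX1
  have hlX : l ≤ X := (Nat.lt_two_pow_self (n := l)).le.trans hl
  refine run_seq (run_copy (by omega) ?_)
  rw [h17]
  refine (run_countdown (T := l * 9 + 24) (fun i s' => s'.reg 21 = i ∧ i ≤ k ∧
      (∀ x, x ∉ 21 :: writeRegs → s'.reg x = s.reg x) ∧
      ∀ b c, s'.mem b c = if (b = 5 ∨ b = 6 ∨ b = 7) ∧ s.reg 6 + i ≤ c ∧ c < s.reg 6 + k then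
        (if b = 5 then queryWord (s.mem 1) d j k m l L (c - s.reg 6) + 1 else
          if b = 6 then 1 else 2)
        else s.mem b c)
    ?_ (by norm_num) ?_ k _ (by omega) ?_).mono ?_
  · rintro i s' ⟨h, _, hreg, _⟩
    exact ⟨h, by rw [hreg _ (by decide), hone]⟩
  · rintro i s' - ⟨h, hil, hreg, hmm⟩
    set σ := s'.setReg 21 i with hσ
    have e0 : σ.mem 1 = s.mem 1 := by
      funext c; rw [hσ, State.setReg_mem, hmm, if_neg (by omega)]
    have hre : ∀ x, x ∉ 21 :: writeRegs → σ.reg x = s.reg x := by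
      intro x hx
      rw [hσ, State.setReg_reg, if_neg (by rintro rfl; exact hx (by decide)), hreg x hx]
    have e21 : σ.reg 21 = i := by rw [hσ, State.setReg_reg, if_pos rfl]
    have e1 : σ.reg 1 = d := by rw [hre _ (by decide), h1]
    have e6 : σ.reg 6 = s.reg 6 := hre _ (by decide)
    have e17 : σ.reg 17 = k := by rw [hre _ (by decide), h17]
    have e18 : σ.reg 18 = m := by rw [hre _ (by decide), h18]
    have e19 : σ.reg 19 = l := by rw [hre _ (by decide), h19]
    have e20 : σ.reg 20 = L := by rw [hre _ (by decide), h20]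
    have e23 : σ.reg 23 = j := by rw [hre _ (by decide), h23]
    have e25 : σ.reg 25 = 1 := by rw [hre _ (by decide), hone]
    have e26 : σ.reg 26 = 2 := by rw [hre _ (by decide), htwo]
    have hb : (i - k % 2 - 1) / 2 ≤ X := by omega
    have hpos : (i - k % 2 - 1) / 2 * l ≤ X * X := Nat.mul_le_mul hb hlX
    have hbL : (i - k % 2 - 1) / 2 * L ≤ X * X := Nat.mul_le_mul hb hL
    have hrow : j * d ≤ X * X := Nat.mul_le_mul hj hd
    refine run_seq ((locateQuery_spec hX hX1 e25 e26 (by omega) (by omega)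
      (by omega) (by omega)).mono ?_)
    rintro t₁ s₁ ⟨ht₁, hT₁, h30, h31, h32, h33, h41, h42⟩
    rw [e1, e23] at h30
    rw [e17, e19, e21] at h31
    rw [e19] at h33
    rw [e17, e21] at h41 h42
    have f1 : s₁.reg 1 = d := by rw [hT₁.2 _ (by decide), e1]
    have f25 : s₁.reg 25 = 1 := by rw [hT₁.2 _ (by decide), e25]
    have f26 : s₁.reg 26 = 2 := by rw [hT₁.2 _ (by decide), e26]
    have f0 : s₁.mem 1 = s.mem 1 := by rw [hT₁.1, e0]
    refine run_seq ((readPattern_spec hX (by omega) f1 f25 f26 (by rw [f0]; exact hmem) h33 h32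
      (by omega) (by omega) hl).mono ?_)
    rintro t₂ s₂ ⟨ht₂, hT₂', hpat⟩
    rw [f0, h30, h31] at hpat
    have hpatle : s₂.reg 32 < 2 ^ l := by rw [hpat]; exact pattern_lt (rowBit_le hmem _ _) _ _
    have hT₂ := hT₁.trans (hT₂'.mono (by decide))
    have g17 : s₂.reg 17 = k := by rw [hT₂.2 _ (by decide), e17]
    have g18 : s₂.reg 18 = m := by rw [hT₂.2 _ (by decide), e18]
    have g20 : s₂.reg 20 = L := by rw [hT₂.2 _ (by decide), e20]
    have g21 : s₂.reg 21 = i := by rw [hT₂.2 _ (by decide), e21]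
    have g42 : s₂.reg 42 = (i - k % 2 - 1) / 2 := by rw [hT₂'.2 _ (by decide), h42]
    have g41 : s₂.reg 41 = i - k % 2 := by rw [hT₂'.2 _ (by decide), h41]
    refine run_seq ((shapeQuery_spec hX hX1 (by rw [hT₂.2 _ (by decide), e25])
      (by rw [hT₂.2 _ (by decide), e26]) (by rw [g42, g20]; exact hbL) (by omega) (by omega)
      (by omega)).mono ?_)
    rintro t₃ s₃ ⟨ht₃, hT₃', hword⟩
    rw [g17, g18, g20, g21, g41, g42] at hword
    have hle : s₃.reg 42 + 1 < 2 ^ bits := by rw [hword]; split_ifs <;> omega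
    have hw : s₃.reg 42 = queryWord (s.mem 1) d j k m l L i := by
      rw [hword, hpat]; rfl
    have hT₃ := hT₂.trans hT₃'
    have k6 : s₃.reg 6 = s.reg 6 := by rw [hT₃.2 _ (by decide), e6]
    have k21 : s₃.reg 21 = i := by rw [hT₃.2 _ (by decide), e21]
    refine (emitQuery_spec (by rw [hT₃.2 _ (by decide), e25]) (by rw [hT₃.2 _ (by decide), e26])
      (by omega) hle (by omega)).mono ?_
    rintro t₄ s₄ ⟨ht₄, hr₄, hm₄⟩
    refine ⟨by omega, ?_, by omega, fun x hx => ?_, fun b c => ?_⟩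
    · rw [hr₄ _ (by decide), k21]
    · have hx' : x ∉ writeRegs := fun h => hx (List.mem_cons_of_mem _ h)
      rw [hr₄ x hx', hT₃.2 x hx', hre x hx]
    · rw [hm₄, k6, k21, hw, hT₃.1, hσ, State.setReg_mem, hmm]
      by_cases hb : b = 5 ∨ b = 6 ∨ b = 7
      · by_cases hc : c = s.reg 6 + i
        · have hlt : s.reg 6 + i < s.reg 6 + k := by omega
          simp only [hc, hb, hlt, true_and, if_true, le_refl, Nat.add_sub_cancel_left]
        · simp only [hb, hc, and_false, if_false, true_and]
          exact if_congr (by omega) rfl rfl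
      · rw [if_neg (fun h => hb h.1), if_neg (fun h => hb h.1), if_neg (fun h => hb h.1)]
  · refine ⟨by rw [State.setReg_reg, if_pos rfl], le_rfl, fun x hx => ?_, fun b c => ?_⟩
    · rw [State.setReg_reg, if_neg (by rintro rfl; exact hx (by decide))]
    · rw [if_neg (by omega), State.setReg_mem]
  · rintro t s' ⟨ht, _, _, hreg, hmm⟩
    exact ⟨by linarith, hreg, by simpa using hmm⟩

/-! ### One query -/

/-- Copy the registers `src, …, src + R - 1` to `dst, …, dst + R - 1`. -/
def copyRegs (src dst : ℕ) : ℕ → Prog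
  | 0 => .skip
  | R + 1 => .seq (copyRegs src dst R) (.copy (dst + R) (src + R))

lemma copyRegs_spec {bits src dst : ℕ} {s : State} : ∀ {R : ℕ},
    (∀ r < R, s.reg (src + r) < 2 ^ bits) →
    (src + R ≤ dst ∨ dst + R ≤ src) →
    Run bits (copyRegs src dst R) s fun t s' => t = R + 1 ∧ s'.mem = s.mem ∧
      ∀ x, s'.reg x = if dst ≤ x ∧ x < dst + R then s.reg (src + (x - dst)) else s.reg x
  | 0, _, _ => run_skip ⟨rfl, rfl, fun x => by rw [if_neg (by omega)]⟩
  | R + 1, h, hd => by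
    refine run_seq ((copyRegs_spec (fun r hr => h r (by omega)) (by omega)).mono ?_)
    rintro t s' ⟨rfl, hm, hr⟩
    have e : s'.reg (src + R) = s.reg (src + R) := by rw [hr, if_neg (by omega)]
    refine run_copy (by rw [e]; exact h R (by omega)) ⟨by omega, hm, fun x => ?_⟩
    rw [State.setReg_reg, e, hr]
    by_cases hx : x = dst + R
    · rw [if_pos hx, if_pos (by omega), hx, Nat.add_sub_cancel_left]
    · rw [if_neg hx]
      exact if_congr (by omega) rfl rfl

/-- The data of a run of the reduction: `N` vectors of dimension `d` on either side, with entries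
`A` and `B`, groups of `n` vectors, guesses below `r`, words of the simulation below `S`, simulated
registers below `R`, fuel `F₁` for the preprocessing and `F₂` for a query, `G` groups, and a
bound `X` for all words outside of the simulation. -/
structure Ctx where
  (bits X N d r n S R G F₁ F₂ : ℕ)
  (A B : ℕ → ℕ)

/-- The bounds under which the reduction runs without overflow. -/
structure Ctx.Valid (c : Ctx) : Prop where
  hX : 8 * (c.X * c.X) < 2 ^ c.bits
  X_ge : 5 ≤ c.X
  A_le : ∀ i, c.A i ≤ 1
  B_le : ∀ i, c.B i ≤ 1
  d_le : 2 ^ c.d ≤ c.X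
  n_le : c.n ≤ c.N
  N_le : c.N + c.n ≤ c.X
  r_pos : 1 ≤ c.r
  S_ge : c.r * c.r + 2 ^ c.d + c.n * c.r + c.n + c.r + 8 ≤ c.S
  S_le : c.S ≤ c.X
  R_ge : 5 ≤ c.R
  R_le : c.R ≤ c.X
  F₁_le : c.F₁ ≤ c.S
  F₂_le : c.F₂ ≤ c.S

lemma ite_lt {p : Prop} [Decidable p] {b : ℕ} (h : 1 < b) : (if p then 1 else 0) < b := by
  split_ifs <;> omega

/-- The vectors `i` and `j` are orthogonal. -/
def Ctx.Orth (c : Ctx) (i j : ℕ) : Prop :=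
  ∑ x ∈ Finset.range c.d, c.A (i * c.d + x) * c.B (j * c.d + x) = 0

/-- The state of the machine between two simulations.  Register `8` holds the first address of
the unused part of the memory; the first `S` cells of every bank are never used, and serve as the
blank base memory of the preprocessing. -/
structure Ctx.Inv (c : Ctx) (σ : State) : Prop where
  N : σ.reg 0 = c.N
  d : σ.reg 1 = c.d
  r : σ.reg 2 = c.r
  n : σ.reg 3 = c.n
  S : σ.reg 4 = c.S
  G : σ.reg 14 = c.G
  one : σ.reg rOne = 1
  two : σ.reg rTwo = 2
  F₁ : σ.reg 27 = c.F₁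
  F₂ : σ.reg 28 = c.F₂
  d1 : σ.reg 29 = c.d + 1
  A : σ.mem 0 = c.A
  B : σ.mem 1 = c.B
  mem_le : ∀ b i, σ.mem (b + 2) i ≤ c.S
  fresh : ∀ b i, σ.reg 8 ≤ i → σ.mem (b + 2) i = 0
  blank : ∀ b i, i < c.S → σ.mem (b + 2) i = 0
  free : c.S ≤ σ.reg 8
  reg_lt : ∀ r < c.R, σ.reg (64 + r) < c.S

/-- The registers that stay fixed after the initialisation. -/
def fixedRegs : List ℕ := [0, 1, 2, 3, 4, 14, 25, 26, 27, 28, 29]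

lemma Ctx.Inv.of_fixed {c : Ctx} {σ σ' : State} (h : c.Inv σ)
    (hr : ∀ x ∈ fixedRegs, σ'.reg x = σ.reg x) (hA : σ'.mem 0 = c.A) (hB : σ'.mem 1 = c.B)
    (mem_le : ∀ b i, σ'.mem (b + 2) i ≤ c.S) (fresh : ∀ b i, σ'.reg 8 ≤ i → σ'.mem (b + 2) i = 0)
    (blank : ∀ b i, i < c.S → σ'.mem (b + 2) i = 0) (free : c.S ≤ σ'.reg 8)
    (reg_lt : ∀ r < c.R, σ'.reg (64 + r) < c.S) : c.Inv σ' where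
  N := (hr 0 (by decide)).trans h.N
  d := (hr 1 (by decide)).trans h.d
  r := (hr 2 (by decide)).trans h.r
  n := (hr 3 (by decide)).trans h.n
  S := (hr 4 (by decide)).trans h.S
  G := (hr 14 (by decide)).trans h.G
  one := (hr 25 (by decide)).trans h.one
  two := (hr 26 (by decide)).trans h.two
  F₁ := (hr 27 (by decide)).trans h.F₁
  F₂ := (hr 28 (by decide)).trans h.F₂
  d1 := (hr 29 (by decide)).trans h.d1
  A := hA
  B := hB
  mem_le := mem_le
  fresh := fresh
  blank := blank
  free := free
  reg_lt := reg_lt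

/-- The guessed parameters: complexities `k` and `m`, length `l` of the blocks, number `L` of
patterns of a block, and index `start` of the first vector of the group. -/
structure Guess where
  (k m l L start : ℕ)

/-- The guess is within the ranges over which the reduction searches. -/
structure Guess.Valid (g : Guess) (c : Ctx) : Prop where
  k : g.k ≤ c.r
  m : g.m ≤ c.r
  l : g.l ≤ c.d
  L : g.L ≤ c.r
  start : g.start + c.n ≤ c.N

/-- The registers of `σ` hold the guess `g`. -/
structure Guess.Holds (g : Guess) (σ : State) : Prop where
  k : σ.reg 17 = g.k
  m : σ.reg 18 = g.m
  l : σ.reg 19 = g.l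
  L : σ.reg 20 = g.L
  start : σ.reg 22 = g.start

/-- If the answer of the simulated query is an orthogonal vector, then set register `9` to `1`. -/
def verify : Prog :=
  .cond 64 (.seq (.op .sub 46 64 rOne) <| .seq (.op .lt 47 46 3) <| .cond 47
    (.seq (.op .add 46 22 46) <| .seq (.op .mul 30 46 1) <| .seq (.op .mul 31 23 1) <|
      .seq (.copy 33 1) <| .seq (.const 34 0) <| .seq dot <| .cond 34 .skip (.const 9 1)) .skip)
    .skip

lemma verify_spec {c : Ctx} (hc : c.Valid) {g : Guess} (hg : g.Valid c) {σ : State} {j : ℕ}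
    (h1 : σ.reg 1 = c.d) (h3 : σ.reg 3 = c.n) (h22 : σ.reg 22 = g.start) (h23 : σ.reg 23 = j)
    (h25 : σ.reg rOne = 1) (hA : σ.mem 0 = c.A) (hB : σ.mem 1 = c.B) (hj : j < c.N)
    (h64 : σ.reg 64 < c.S) :
    Run c.bits verify σ fun t σ' => t ≤ c.d * 8 + 13 ∧
      Touches [9, 30, 31, 33, 34, 35, 36, 37, 38, 46, 47] σ σ' ∧
      (σ'.reg 9 = σ.reg 9 ∨ σ'.reg 9 = 1 ∧ ∃ i < c.N, c.Orth i j) ∧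
      ∀ i < c.n, σ.reg 64 = i + 1 → c.Orth (g.start + i) j → σ'.reg 9 = 1 := by
  have hX := hc.hX
  have hXX : 5 * c.X ≤ c.X * c.X := Nat.mul_le_mul_right _ hc.X_ge
  have hX1 := hc.X_ge
  have hSX := hc.S_le
  have hNX := hc.N_le
  have hst := hg.start
  have hdX : c.d ≤ c.X := (Nat.lt_two_pow_self).le.trans hc.d_le
  refine run_cond (fun h0 => ?_) (fun h0 => run_skip ?_)
  swap
  · exact ⟨by omega, .refl _ _, .inl rfl, fun i _ h => by omega⟩
  set a := σ.reg 64 - 1 with ha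
  refine run_seq (run_op ?_ (run_seq (run_op ?_ ?_)))
  · simp only [BinOp.eval, h25]; omega
  · exact ite_lt (by omega)
  simp only [BinOp.eval, State.setReg_reg, Nat.reduceEqDiff, if_true, if_false, h25, h3]
  rw [← ha]
  have hT : Touches [9, 30, 31, 33, 34, 35, 36, 37, 38, 46, 47] σ
      ((σ.setReg 46 a).setReg 47 (if a < c.n then 1 else 0)) :=
    ((Touches.refl _ _).setReg (by decide)).setReg (by decide)
  refine run_cond (fun h47 => ?_) (fun h47 => run_skip ?_)
  swap
  · have : ¬ a < c.n := by
      intro hlt; simp [State.setReg_reg, hlt] at h47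
    refine ⟨by omega, hT, .inl ?_, fun i hi h => by omega⟩
    simp [State.setReg_reg]
  have han : a < c.n := by
    by_contra hlt; simp [State.setReg_reg, hlt] at h47
  have hr1 : (g.start + a) * c.d ≤ c.X * c.X := Nat.mul_le_mul (by omega) hdX
  have hr2 : j * c.d ≤ c.X * c.X := Nat.mul_le_mul (by omega) hdX
  simp only [run_seq_iff, run_op_iff, run_copy_iff, run_const_iff, State.setReg_reg, BinOp.eval,
    Nat.reduceEqDiff, if_true, if_false, h1, h22, h23]
  refine ⟨by omega, by omega, by omega, by omega, by omega, ?_⟩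
  generalize hs₁ : State.setReg _ _ _ = s₁
  have hT₁ : Touches [9, 30, 31, 33, 34, 35, 36, 37, 38, 46, 47] σ s₁ := by
    rw [← hs₁]
    iterate 5 refine Touches.setReg ?_ (by decide)
    exact hT
  have e30 : s₁.reg 30 = (g.start + a) * c.d := by rw [← hs₁]; rfl
  have e31 : s₁.reg 31 = j * c.d := by rw [← hs₁]; rfl
  have e33 : s₁.reg 33 = c.d := by rw [← hs₁]; rfl
  have e34 : s₁.reg 34 = 0 := by rw [← hs₁]; rfl
  refine (dot_spec hX (by omega) (by rw [hT₁.2 _ (by decide), h25])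
    (by rw [hT₁.1, hA]; exact hc.A_le)
    (by rw [hT₁.1, hB]; exact hc.B_le) e33 e34 (by omega) (by omega) hdX).mono ?_
  rintro t s₂ ⟨ht, hT₂', hsum⟩
  rw [e30, e31, hT₁.1, hA, hB] at hsum
  have hT₂ := hT₁.trans (hT₂'.mono (by decide))
  have e9 : s₂.reg 9 = σ.reg 9 := by
    rw [hT₂'.2 _ (by decide), ← hs₁]
    simp only [State.setReg_reg, Nat.reduceEqDiff, if_false]
  refine run_cond (fun h34 => run_skip ?_) (fun h34 => run_const (by omega) ?_)
  · refine ⟨by omega, hT₂, .inl e9, fun i hi h ho => ?_⟩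
    obtain rfl : a = i := by omega
    exact absurd (hsum.trans ho) h34
  · exact ⟨by omega, hT₂.setReg (by decide),
      .inr ⟨by simp [State.setReg_reg], _, (by omega : g.start + a < c.N), hsum.symm.trans h34⟩,
      fun i hi h ho => by simp [State.setReg_reg]⟩

/-- The state in which the query program starts, if the preprocessing has ended in `s`. -/
def queryState (s : State) (k : ℕ) (w : ℕ → ℕ) : State where
  reg := s.reg
  mem b i := if i < k then
      (if b = 3 then w i else if b = 4 then 0 else if b = 5 then 1 else s.mem b i)
    else s.mem b i

/-- Run the query of the vector `reg 23` on a fresh part of the memory, on top of the result of the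
preprocessing, and verify its answer. -/
def queryStep (R : ℕ) (qry : Prog) : Prog :=
  .seq (.copy 6 8) <| .seq (.op .add 8 8 4) <| .seq writeQuery <| .seq (copyRegs (64 + R) 64 R) <|
  .seq (.copy 5 28) <| .seq (clocked qry) verify

/-- The registers below `64` that a query changes. -/
def queryRegs : List ℕ :=
  [5, 6, 8, 9, 10, 11, 12, 13, 46, 47, 21, 30, 31, 32, 33, 34, 35, 36, 37, 38, 40, 41, 42, 43, 44,
    45]

lemma inputWord_le (A : ℕ → ℕ) (d start l L i : ℕ) {m : ℕ} (hm : 0 < m) :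
    inputWord A d start m l L i ≤ m + 3 := by
  refine (inputVertex_le _ _).trans ?_
  have := Nat.mod_lt i hm
  omega

lemma queryWord_lt {B : ℕ → ℕ} (hB : ∀ i, B i ≤ 1) {d j k m l L v r : ℕ} (hk : k ≤ r) (hm : m ≤ r)
    (hl : l ≤ d) (hL : L ≤ r) (hv : v < k) :
    queryWord B d j k m l L v + 1 ≤ r * r + 2 ^ d + r + 7 := by
  have h1 : (v - k % 2 - 1) / 2 * L ≤ r * r := Nat.mul_le_mul (by omega) hL
  have h2 := pattern_lt (rowBit_le hB d (j * d)) ((v - k % 2 - 1) / 2 * l) l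
  have h3 : 2 ^ l ≤ 2 ^ d := Nat.pow_le_pow_right (by norm_num) hl
  rw [queryWord, queryVertex]
  split_ifs <;> omega

/-- The effect of a query `j`: register `9` is set only if an orthogonal pair is found, and
it is set if the query program, run on the result of the preprocessing, answers with a vector
that is orthogonal to the vector `j`. -/
lemma queryStep_spec {c : Ctx} (hc : c.Valid) {g : Guess} (hg : g.Valid c) {qry : Prog}
    (hq : Fits c.R qry) {σ : State} (hσ : c.Inv σ) (hgσ : g.Holds σ) {j e₀ : ℕ}
    (h23 : σ.reg 23 = j) (hj : j < c.N) (h7 : σ.reg 7 = e₀) (he₀ : e₀ + c.S ≤ σ.reg 8)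
    (hfree : σ.reg 8 + c.S ≤ c.X) (hsave : ∀ r < c.R, σ.reg (64 + c.R + r) < c.S) :
    Run c.bits (queryStep c.R qry) σ fun t σ' =>
      t ≤ c.r * (c.d * 9 + 26) + c.R + clockCost qry * (c.F₂ + 1) + c.d * 8 + 20 ∧
      (∀ x, x ∉ queryRegs → (x < 64 ∨ 64 + c.R ≤ x) → σ'.reg x = σ.reg x) ∧
      σ'.reg 8 = σ.reg 8 + c.S ∧ c.Inv σ' ∧
      (∀ b i, i < σ.reg 8 → σ'.mem b i = σ.mem b i) ∧
      (σ'.reg 9 = σ.reg 9 ∨ σ'.reg 9 = 1 ∧ ∃ i < c.N, c.Orth i j) ∧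
      ∀ b s u s' i, 2 ^ b ≤ c.S → (∀ r < c.R, σ.reg (64 + c.R + r) = s.reg r) →
        (∀ b i, i < c.S → overlay e₀ 0 σ b i = s.mem b i) →
        Exec b qry (queryState s g.k (queryWord c.B c.d j g.k g.m g.l g.L)) u s' → u < c.F₂ →
        s'.reg 0 = i + 1 → i < c.n → c.Orth (g.start + i) j → σ'.reg 9 = 1 := by
  have hX := hc.hX
  have hXX : 5 * c.X ≤ c.X * c.X := Nat.mul_le_mul_right _ hc.X_ge
  have hX1 := hc.X_ge
  have hSX := hc.S_le
  have hSge := hc.S_ge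
  have hF₂ := hc.F₂_le
  have hR := hc.R_le
  have hNX := hc.N_le
  have hk := hg.k
  have hm := hg.m
  have hl := hg.l
  have hL := hg.L
  have hdX : c.d ≤ c.X := (Nat.lt_two_pow_self).le.trans hc.d_le
  have hpow : 0 < 2 ^ c.d := by positivity
  have hlX : 2 ^ g.l ≤ c.X := (Nat.pow_le_pow_right (by norm_num) hl).trans hc.d_le
  set e₁ := σ.reg 8 with he₁
  refine run_seq (run_copy (by omega) (run_seq (run_op ?_ ?_)))
  · simp only [BinOp.eval, State.setReg_reg, Nat.reduceEqDiff, if_false, hσ.S]; omega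
  simp only [BinOp.eval, State.setReg_reg, Nat.reduceEqDiff, if_false, hσ.S, ← he₁]
  generalize hσ₂ : (σ.setReg 6 e₁).setReg 8 (e₁ + c.S) = σ₂
  have hm₂ : σ₂.mem = σ.mem := by rw [← hσ₂]; rfl
  have hr₂ : ∀ x, x ≠ 6 → x ≠ 8 → σ₂.reg x = σ.reg x := by
    intro x h6 h8
    rw [← hσ₂, State.setReg_reg, State.setReg_reg, if_neg h8, if_neg h6]
  have h6₂ : σ₂.reg 6 = e₁ := by rw [← hσ₂]; rfl
  have h8₂ : σ₂.reg 8 = e₁ + c.S := by rw [← hσ₂]; rfl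
  refine run_seq ((writeQuery_spec (d := c.d) (j := j) hX hX1
    (by rw [hr₂ _ (by decide) (by decide), hσ.d])
    (by rw [hr₂ _ (by decide) (by decide), hσ.one])
    (by rw [hr₂ _ (by decide) (by decide), hσ.two])
    (by rw [hm₂, hσ.B]; exact hc.B_le) (by rw [hr₂ _ (by decide) (by decide), hgσ.k])
    (by rw [hr₂ _ (by decide) (by decide), hgσ.m]) (by rw [hr₂ _ (by decide) (by decide), hgσ.l])
    (by rw [hr₂ _ (by decide) (by decide), hgσ.L]) (by rw [hr₂ _ (by decide) (by decide), h23])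
    (by omega) hdX hlX (by omega) (by omega) (by omega) (by omega)).mono ?_)
  rintro t₃ σ₃ ⟨ht₃, hr₃', hm₃⟩
  rw [h6₂, hm₂, hσ.B] at hm₃
  have hr₃ : ∀ x, x ∉ queryRegs → σ₃.reg x = σ.reg x := by
    intro x hx
    have h1 : x ∉ 21 :: writeRegs :=
      fun h => hx ((by decide : 21 :: writeRegs ⊆ queryRegs) h)
    rw [hr₃' x h1, hr₂ x (by rintro rfl; exact hx (by decide))
      (by rintro rfl; exact hx (by decide))]
  have hbig : ∀ r, 64 + r ∉ queryRegs := by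
    intro r hr
    have : ∀ x ∈ queryRegs, x < 64 := by decide
    have := this _ hr
    omega
  have hbig' : ∀ r, 64 + c.R + r ∉ queryRegs := by
    intro r; rw [add_assoc]; exact hbig _
  have h8₃ : σ₃.reg 8 = e₁ + c.S := by rw [hr₃' _ (by decide), h8₂]
  have h6₃ : σ₃.reg 6 = e₁ := by rw [hr₃' _ (by decide), h6₂]
  have h9₃ : σ₃.reg 9 = σ.reg 9 := by
    rw [hr₃' _ (by decide), hr₂ _ (by decide) (by decide)]
  refine run_seq ((copyRegs_spec (fun r hr => ?_) (by omega)).mono ?_)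
  · rw [hr₃ _ (hbig' r)]
    have := hsave r hr
    omega
  rintro t₄ σ₄ ⟨rfl, hm₄, hr₄'⟩
  have hr₄ : ∀ x, x < 64 ∨ 64 + c.R ≤ x → σ₄.reg x = σ₃.reg x := by
    intro x hx; rw [hr₄', if_neg (by omega)]
  have hs₄ : ∀ r < c.R, σ₄.reg (64 + r) = σ.reg (64 + c.R + r) := by
    intro r hr
    rw [hr₄', if_pos (by omega), Nat.add_sub_cancel_left, hr₃ _ (hbig' r)]
  have h28 : σ₄.reg 28 = c.F₂ := by
    rw [hr₄ _ (by omega), hr₃ _ (by decide), hσ.F₂]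
  refine run_seq (run_copy (by omega) ?_)
  rw [h28]
  generalize hσ₅ : σ₄.setReg 5 c.F₂ = σ₅
  have hm₅ : σ₅.mem = σ₃.mem := by rw [← hσ₅]; exact hm₄
  have hr₅ : ∀ x, x ≠ 5 → x < 64 ∨ 64 + c.R ≤ x → σ₅.reg x = σ₃.reg x := by
    intro x h5 hx
    rw [← hσ₅, State.setReg_reg, if_neg h5, hr₄ x hx]
  have hs₅ : ∀ r < c.R, σ₅.reg (64 + r) = σ.reg (64 + c.R + r) := by
    intro r hr
    rw [← hσ₅, State.setReg_reg, if_neg (by omega), hs₄ r hr]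
  have h5₅ : σ₅.reg 5 = c.F₂ := by rw [← hσ₅]; rfl
  have hmem5 : ∀ b i, σ₅.mem (b + 2) i = if (b = 3 ∨ b = 4 ∨ b = 5) ∧ e₁ ≤ i ∧ i < e₁ + g.k then
      (if b = 3 then queryWord c.B c.d j g.k g.m g.l g.L (i - e₁) + 1 else if b = 4 then 1 else 2)
      else σ.mem (b + 2) i := by
    intro b i
    simp only [hm₅, hm₃, Nat.reduceEqDiff]
  have hready : SimReady c.R c.S e₁ e₀ σ₅ := by
    refine ⟨?_, ?_, ?_, ?_, ?_, ?_, ?_⟩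
    · rw [hr₅ _ (by decide) (by omega), hr₃ _ (by decide), hσ.S]
    · rw [hr₅ _ (by decide) (by omega), h6₃]
    · rw [hr₅ _ (by decide) (by omega), hr₃ _ (by decide), h7]
    · rw [hr₅ _ (by decide) (by omega), hr₃ _ (by decide), hσ.one]
    · omega
    · intro r hr
      rw [hs₅ r hr]; exact hsave r hr
    · intro b i
      rw [hmem5]
      split_ifs with h1 h2 h3
      · have := queryWord_lt hc.B_le (d := c.d) (j := j) hk hm hl hL
          (by omega : i - e₁ < g.k)
        omega
      · omega
      · omega
      · exact hσ.mem_le b i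
  have hSS : c.S * c.S ≤ c.X * c.X := Nat.mul_le_mul hSX hSX
  refine run_seq ((clocked_spec (R := c.R) (S := c.S) (e₁ := e₁) (e₀ := e₀) (by omega) (by omega)
    he₀ (by omega) qry hq σ₅ hready).mono ?_)
  intro t₆ σ₆ hpost
  have hfr := hpost.frame
  have hr₆ : ∀ x, x ∉ queryRegs → (x < 64 ∨ 64 + c.R ≤ x) → σ₆.reg x = σ.reg x := by
    intro x hx hx'
    rw [hfr.reg x (fun h => hx ((by decide : [5, 10, 11, 12, 13] ⊆ queryRegs) h)) hx',
      hr₅ x (by rintro rfl; exact hx (by decide)) hx', hr₃ x hx]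
  have h8₆ : σ₆.reg 8 = e₁ + c.S := by
    rw [hfr.reg _ (by decide) (by omega), hr₅ _ (by decide) (by omega), h8₃]
  have h9₆ : σ₆.reg 9 = σ.reg 9 := by
    rw [hfr.reg _ (by decide) (by omega), hr₅ _ (by decide) (by omega), h9₃]
  have hA₆ : σ₆.mem 0 = c.A := by
    rw [hfr.mem_bank 0 (by omega), hm₅, ← hσ.A]
    funext i; rw [hm₃, if_neg (by omega)]
  have hB₆ : σ₆.mem 1 = c.B := by
    rw [hfr.mem_bank 1 (by omega), hm₅, ← hσ.B]
    funext i; rw [hm₃, if_neg (by omega)]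
  have hR5 := hc.R_ge
  refine (verify_spec hc hg (by rw [hr₆ _ (by decide) (by omega), hσ.d])
    (by rw [hr₆ _ (by decide) (by omega), hσ.n]) (by rw [hr₆ _ (by decide) (by omega), hgσ.start])
    (by rw [hr₆ _ (by decide) (by omega), h23]) (by rw [hr₆ _ (by decide) (by omega), hσ.one])
    hA₆ hB₆ hj (hpost.ready.reg_lt 0 (by omega))).mono ?_
  rintro t₇ σ₇ ⟨ht₇, hT₇, hor, hfound⟩
  have hr₇ : ∀ x, x ∉ queryRegs → (x < 64 ∨ 64 + c.R ≤ x) → σ₇.reg x = σ.reg x := by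
    intro x hx hx'
    rw [hT₇.2 x (fun h => hx
      ((by decide : [9, 30, 31, 33, 34, 35, 36, 37, 38, 46, 47] ⊆ queryRegs) h)), hr₆ x hx hx']
  have hlow : ∀ b i, i < e₁ → σ₇.mem b i = σ.mem b i := by
    intro b i hi
    rw [hT₇.1, hfr.mem_addr b i (.inl hi), hm₅, hm₃, if_neg (by omega)]
  have h8₇ : σ₇.reg 8 = e₁ + c.S := by rw [hT₇.2 _ (by decide), h8₆]
  refine ⟨?_, hr₇, h8₇, ?_, hlow, by rwa [h9₆] at hor, ?_⟩
  · have htime := hpost.time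
    rw [h5₅] at htime
    have hkl : g.k * (g.l * 9 + 26) ≤ c.r * (c.d * 9 + 26) := Nat.mul_le_mul hk (by omega)
    have htc : t₆ ≤ clockCost qry * (c.F₂ + 1) := le_trans (Nat.le_add_right _ _) htime
    omega
  · refine hσ.of_fixed (fun x hx => hr₇ x ?_ ?_) (by rw [hT₇.1, hA₆]) (by rw [hT₇.1, hB₆]) ?_ ?_ ?_
      ?_ ?_
    · exact (by decide : ∀ x ∈ fixedRegs, x ∉ queryRegs) x hx
    · exact .inl ((by decide : ∀ x ∈ fixedRegs, x < 64) x hx)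
    · intro b i; rw [hT₇.1]; exact hpost.ready.mem_le b i
    · intro b i hi
      rw [h8₇] at hi
      rw [hT₇.1, hfr.mem_addr _ i (.inr hi), hmem5, if_neg (by omega)]
      exact hσ.fresh b i (by omega)
    · intro b i hi
      rw [hlow _ _ (by omega)]; exact hσ.blank b i hi
    · omega
    · intro r hr
      rw [hT₇.2 _ (fun h => by
        have := (by decide : ∀ x ∈ [9, 30, 31, 33, 34, 35, 36, 37, 38, 46, 47], x < 64) _ h
        omega)]
      exact hpost.ready.reg_lt r hr
  · intro b s u s' i hb hs hmem hex hu hans hi ho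
    have hrep : Represents c.R c.S e₁ e₀
        (queryState s g.k (queryWord c.B c.d j g.k g.m g.l g.L)) σ₅ := by
      refine ⟨fun r hr => by rw [hs₅ r hr, hs r hr]; rfl, fun b' i' hi' => ?_⟩
      have hm' := hmem b' i' hi'
      have hbase : σ₅.mem (b' + 2) (e₀ + i') = σ.mem (b' + 2) (e₀ + i') := by
        rw [hmem5, if_neg (by omega)]
      have hold : (σ.mem (b' + 2) (e₀ + i')) - 1 = s.mem b' i' := by
        rw [← hm', overlay]
        split_ifs with h0
        · rw [h0, hσ.blank b' (0 + i') (by omega)]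
        · rfl
      have hfresh : σ.mem (b' + 2) (e₁ + i') = 0 := hσ.fresh _ _ (by omega)
      rw [overlay, hbase, hmem5, hfresh, Nat.add_sub_cancel_left]
      simp only [queryState]
      by_cases hik : i' < g.k
      · rw [if_pos hik]
        have hlt : e₁ + i' < e₁ + g.k := by omega
        by_cases h3 : b' = 3
        · subst h3; simp [hlt]
        by_cases h4 : b' = 4
        · subst h4; simp [hlt]
        by_cases h5 : b' = 5
        · subst h5; simp [hlt]
        simp only [h3, h4, h5, or_self, false_and, if_false, if_true]
        exact hold
      · have hlt : ¬ e₁ + i' < e₁ + g.k := by omega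
        simp only [hik, hlt, and_false, if_false, if_true]
        exact hold
    obtain ⟨hrep', hfu⟩ := hpost.sim b _ u s' hb hrep hex (by rw [h5₅]; exact hu)
    exact hfound i hi (by rw [← hans]; exact hrep'.reg 0 (by omega)) ho

/-! ### All queries to a group -/

/-- The simulated query `j` answers with a vector that is orthogonal to the vector `j`, if it is run
on the result of the preprocessing that `σ` has stored at the address `e₀`. -/
def Ctx.Finds (c : Ctx) (g : Guess) (qry : Prog) (σ : State) (e₀ j : ℕ) : Prop :=
  ∃ b s u s' i, 2 ^ b ≤ c.S ∧ (∀ r < c.R, σ.reg (64 + c.R + r) = s.reg r) ∧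
    (∀ b i, i < c.S → overlay e₀ 0 σ b i = s.mem b i) ∧
    Exec b qry (queryState s g.k (queryWord c.B c.d j g.k g.m g.l g.L)) u s' ∧ u < c.F₂ ∧
    s'.reg 0 = i + 1 ∧ i < c.n ∧ c.Orth (g.start + i) j

/-- A bound for the time of a query. -/
def Ctx.queryTime (c : Ctx) (qry : Prog) : ℕ :=
  c.r * (c.d * 9 + 26) + c.R + clockCost qry * (c.F₂ + 1) + c.d * 8 + 20

/-- Run the queries of all vectors of `B`. -/
def queryLoop (R : ℕ) (qry : Prog) : Prog := .seq (.copy 23 0) (.countdown 23 (queryStep R qry))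

lemma Guess.Holds.of_eq {g : Guess} {σ σ' : State} (h : g.Holds σ)
    (hr : ∀ x ∈ [17, 18, 19, 20, 22], σ'.reg x = σ.reg x) : g.Holds σ' :=
  ⟨(hr 17 (by decide)).trans h.k, (hr 18 (by decide)).trans h.m, (hr 19 (by decide)).trans h.l,
    (hr 20 (by decide)).trans h.L, (hr 22 (by decide)).trans h.start⟩

/-- The answer in register `9` changes only if there is an orthogonal pair, and it is `1` in the end
if one of the queries finds such a pair. -/
lemma queryLoop_spec {c : Ctx} (hc : c.Valid) {g : Guess} (hg : g.Valid c) {qry : Prog}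
    (hq : Fits c.R qry) {σ : State} (hσ : c.Inv σ) (hgσ : g.Holds σ) {e₀ : ℕ}
    (h7 : σ.reg 7 = e₀) (he₀ : e₀ + c.S ≤ σ.reg 8)
    (hfree : σ.reg 8 + c.S * c.N ≤ c.X) (hsave : ∀ r < c.R, σ.reg (64 + c.R + r) < c.S) :
    Run c.bits (queryLoop c.R qry) σ fun t σ' =>
      t ≤ c.N * (c.queryTime qry + 2) + 2 ∧
      (∀ x, x ∉ 23 :: queryRegs → (x < 64 ∨ 64 + c.R ≤ x) → σ'.reg x = σ.reg x) ∧
      σ'.reg 8 = σ.reg 8 + c.S * c.N ∧ c.Inv σ' ∧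
      (σ'.reg 9 = σ.reg 9 ∨ σ'.reg 9 = 1 ∧ ∃ i < c.N, ∃ j < c.N, c.Orth i j) ∧
      ∀ j < c.N, c.Finds g qry σ e₀ j → σ'.reg 9 = 1 := by
  have hX := hc.hX
  have hXX : 5 * c.X ≤ c.X * c.X := Nat.mul_le_mul_right _ hc.X_ge
  have hNX := hc.N_le
  have hlist : ∀ x ∈ 23 :: queryRegs, x < 64 := by decide
  refine run_seq (run_copy (by rw [hσ.N]; omega) ?_)
  rw [hσ.N]
  refine (run_countdown (T := c.queryTime qry) (fun j σ' => σ'.reg 23 = j ∧ j ≤ c.N ∧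
    (∀ x, x ∉ 23 :: queryRegs → (x < 64 ∨ 64 + c.R ≤ x) → σ'.reg x = σ.reg x) ∧
    σ'.reg 8 + c.S * j = σ.reg 8 + c.S * c.N ∧ σ.reg 8 ≤ σ'.reg 8 ∧ c.Inv σ' ∧
    (∀ b i, i < σ.reg 8 → σ'.mem b i = σ.mem b i) ∧
    (σ'.reg 9 = σ.reg 9 ∨ σ'.reg 9 = 1 ∧ ∃ i < c.N, ∃ j < c.N, c.Orth i j) ∧
    ∀ j', j ≤ j' → j' < c.N → c.Finds g qry σ e₀ j' → σ'.reg 9 = 1) ?_ (by norm_num) ?_ c.N _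
    (by omega) ?_).mono ?_
  · rintro j σ' ⟨h, _, _, _, _, hinv, _⟩
    exact ⟨h, hinv.one⟩
  · rintro j σ' - ⟨h23, hjN, hfr, h8, h8', hinv, hmem, hor, hfound⟩
    set σ₁ := σ'.setReg 23 j with hσ₁
    have hr₁ : ∀ x, x ≠ 23 → σ₁.reg x = σ'.reg x := by
      intro x hx; rw [hσ₁, State.setReg_reg, if_neg hx]
    have hfr₁ : ∀ x, x ∉ 23 :: queryRegs → (x < 64 ∨ 64 + c.R ≤ x) → σ₁.reg x = σ.reg x := by
      intro x hx hx'
      rw [hr₁ x (by rintro rfl; exact hx (by decide)), hfr x hx hx']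
    have hinv₁ : c.Inv σ₁ := by
      refine hinv.of_fixed (fun x hx => hr₁ x ?_) hinv.A hinv.B hinv.mem_le ?_ hinv.blank ?_ ?_
      · rintro rfl; exact absurd hx (by decide)
      · rw [hr₁ _ (by decide)]; exact hinv.fresh
      · rw [hr₁ _ (by decide)]; exact hinv.free
      · intro r hr; rw [hr₁ _ (by omega)]; exact hinv.reg_lt r hr
    have hmul : c.S * (j + 1) = c.S * j + c.S := Nat.mul_succ _ _
    have hs₁ : ∀ r, σ₁.reg (64 + c.R + r) = σ.reg (64 + c.R + r) := by
      intro r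
      exact hfr₁ _ (fun h => by have := hlist _ h; omega) (by omega)
    have h8₁ : σ₁.reg 8 = σ'.reg 8 := hr₁ _ (by decide)
    refine (queryStep_spec hc hg hq hinv₁ (j := j) (e₀ := e₀) (hgσ.of_eq fun x hx => hfr₁ x
      ((by decide : ∀ x ∈ [17, 18, 19, 20, 22], x ∉ 23 :: queryRegs) x hx)
      (.inl ((by decide : ∀ x ∈ [17, 18, 19, 20, 22], x < 64) x hx))) ?_ (by omega)
      (by rw [hfr₁ _ (by decide) (by omega), h7]) (by omega) (by omega) ?_).mono ?_
    · rw [hσ₁, State.setReg_reg, if_pos rfl]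
    · intro r hr
      rw [hs₁]; exact hsave r hr
    rintro t σ₂ ⟨ht, hfr₂, h8₂, hinv₂, hmem₂, hor₂, hfound₂⟩
    have h9₁ : σ₁.reg 9 = σ'.reg 9 := hr₁ _ (by decide)
    rw [h9₁] at hor₂
    refine ⟨ht, ?_, by omega, fun x hx hx' => ?_, by omega, by omega, hinv₂, fun b i hi => ?_, ?_,
      fun j' hj' hj'N hF => ?_⟩
    · rw [hfr₂ _ (by decide) (by omega), hσ₁, State.setReg_reg, if_pos rfl]
    · rw [hfr₂ x (fun h => hx (List.mem_cons_of_mem _ h)) hx', hfr₁ x hx hx']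
    · rw [hmem₂ b i (by omega), hσ₁, State.setReg_mem, hmem b i hi]
    · rcases hor₂ with h | ⟨h, i, hi, ho⟩
      · rwa [h]
      · exact .inr ⟨h, i, hi, j, by omega, ho⟩
    · rcases Nat.lt_or_ge j j' with hlt | hge
      · have := hfound j' hlt hj'N hF
        rcases hor₂ with h | h
        · rw [h, this]
        · exact h.1
      · obtain rfl : j = j' := by omega
        obtain ⟨b, s, u, s', i, hb, hs, hov, hex, hu, hans, hi, ho⟩ := hF
        refine hfound₂ b s u s' i hb (fun r hr => by rw [hs₁, hs r hr]) (fun b i hi => ?_) hex hu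
          hans hi ho
        have hbl := hσ.free
        rw [← hov b i hi, overlay, overlay, hσ₁, State.setReg_mem, hmem _ _ (by omega),
          hmem _ _ (by omega)]
  · refine ⟨by rw [State.setReg_reg, if_pos rfl], le_rfl, fun x hx _ => ?_, ?_, ?_, ?_,
      fun b i _ => rfl, .inl ?_, fun j' h h' => by omega⟩
    · rw [State.setReg_reg, if_neg (by rintro rfl; exact hx (by decide))]
    · simp [State.setReg_reg]
    · simp [State.setReg_reg]
    · have hr₁ : ∀ x, x ≠ 23 → (σ.setReg 23 c.N).reg x = σ.reg x := by
        intro x hx; rw [State.setReg_reg, if_neg hx]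
      refine hσ.of_fixed (fun x hx => hr₁ x ?_) hσ.A hσ.B hσ.mem_le ?_ hσ.blank ?_ ?_
      · rintro rfl; exact absurd hx (by decide)
      · rw [hr₁ _ (by decide)]; exact hσ.fresh
      · rw [hr₁ _ (by decide)]; exact hσ.free
      · intro r hr; rw [hr₁ _ (by omega)]; exact hσ.reg_lt r hr
    · simp [State.setReg_reg]
  · rintro t σ' ⟨ht, _, _, hfr, h8, _, hinv, _, hor, hfound⟩
    exact ⟨by omega, hfr, by omega, hinv, hor, fun j hj => hfound j (by omega) hj⟩

/-! ### The preprocessing of a group -/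

/-- Set the registers `64, …, 64 + R - 1` to `0`. -/
def clearRegs : ℕ → Prog
  | 0 => .skip
  | R + 1 => .seq (clearRegs R) (.const (64 + R) 0)

lemma clearRegs_spec {bits : ℕ} {s : State} : ∀ {R : ℕ},
    Run bits (clearRegs R) s fun t s' => t = R + 1 ∧ s'.mem = s.mem ∧
      ∀ x, s'.reg x = if 64 ≤ x ∧ x < 64 + R then 0 else s.reg x
  | 0 => run_skip ⟨rfl, rfl, fun x => by rw [if_neg (by omega)]⟩
  | R + 1 => by
    refine run_seq (clearRegs_spec.mono ?_)
    rintro t s' ⟨rfl, hm, hr⟩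
    refine run_const (by positivity) ⟨by omega, hm, fun x => ?_⟩
    rw [State.setReg_reg, hr]
    by_cases hx : x = 64 + R
    · rw [if_pos hx, if_pos (by omega)]
    · rw [if_neg hx]
      exact if_congr (by omega) rfl rfl

/-- The registers in the state in which the preprocessing starts. -/
def inputReg (n m k r : ℕ) : ℕ :=
  if r = 0 then n else if r = 1 then m else if r = 2 then k else if r = 3 ∨ r = 4 then 1 else 0

/-- The state in which the preprocessing starts, for `n` curves of complexity `m` that are stored
in the table `w` of natural numbers, for queries of complexity `k` and the threshold `1`. -/
def inputState (n m k : ℕ) (w : ℕ → ℕ) : State where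
  reg := inputReg n m k
  mem b i := if (b = 0 ∨ b = 2) ∧ i < n * m then (if b = 0 then w i else 1) else 0

/-- Set the simulated registers to the input of the preprocessing. -/
def initRegs (R : ℕ) : Prog :=
  .seq (clearRegs R) <| .seq (.copy 64 3) <| .seq (.copy 65 18) <| .seq (.copy 66 17) <|
  .seq (.copy 67 rOne) (.copy 68 rOne)

lemma initRegs_spec {bits R n m k : ℕ} {s : State} (hR : 5 ≤ R) (h3 : s.reg 3 = n)
    (h18 : s.reg 18 = m) (h17 : s.reg 17 = k) (hone : s.reg rOne = 1) (hn : n < 2 ^ bits)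
    (hm : m < 2 ^ bits) (hk : k < 2 ^ bits) (h1 : 1 < 2 ^ bits) :
    Run bits (initRegs R) s fun t s' => t = R + 6 ∧ s'.mem = s.mem ∧
      ∀ x, s'.reg x = if 64 ≤ x ∧ x < 64 + R then inputReg n m k (x - 64) else s.reg x := by
  refine run_seq (clearRegs_spec.mono ?_)
  rintro t s' ⟨rfl, hm', hr⟩
  have e3 : s'.reg 3 = n := by rw [hr, if_neg (by omega), h3]
  have e18 : s'.reg 18 = m := by rw [hr, if_neg (by omega), h18]
  have e17 : s'.reg 17 = k := by rw [hr, if_neg (by omega), h17]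
  have e25 : s'.reg 25 = 1 := by rw [hr, if_neg (by omega), hone]
  simp only [run_seq_iff, run_copy_iff, State.setReg_reg, Nat.reduceEqDiff, if_false, e3, e18, e17,
    e25]
  refine ⟨hn, hm, hk, h1, h1, by trivial, hm', fun x => ?_⟩
  rw [hr]
  by_cases hx : 64 ≤ x ∧ x < 64 + R
  · obtain ⟨y, rfl⟩ := Nat.exists_eq_add_of_le hx.1
    rw [if_pos hx, if_pos hx, Nat.add_sub_cancel_left, inputReg]
    by_cases h0 : y = 0
    · subst h0; rfl
    by_cases h1 : y = 1
    · subst h1; rfl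
    by_cases h2 : y = 2
    · subst h2; rfl
    by_cases h3 : y = 3
    · subst h3; rfl
    by_cases h4 : y = 4
    · subst h4; rfl
    simp only [h0, h1, h2, h3, h4, or_self, if_false]
    rw [if_neg (by omega), if_neg (by omega), if_neg (by omega), if_neg (by omega),
      if_neg (by omega)]
  · rw [if_neg hx, if_neg hx, if_neg (by omega), if_neg (by omega), if_neg (by omega),
      if_neg (by omega), if_neg (by omega)]

/-- Write the curves of the group, run the preprocessing on a fresh part of the memory, and save the
simulated registers in the registers from `64 + R` on. -/
def preprocess (R : ℕ) (pre : Prog) : Prog :=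
  .seq (.const 7 0) <| .seq (.copy 6 8) <| .seq (.op .add 8 8 4) <| .seq writeInput <|
  .seq (initRegs R) <| .seq (.copy 5 27) <| .seq (clocked pre) <|
  .seq (copyRegs 64 (64 + R) R) (.copy 7 6)

/-- The registers below `64` that the preprocessing changes. -/
def preprocessRegs : List ℕ :=
  [5, 6, 7, 8, 10, 11, 12, 13, 21, 30, 31, 32, 33, 34, 35, 36, 37, 38, 40, 41, 42, 43, 44, 45]

/-- If the preprocessing program halts in time in the state `s`, then `s` is represented by the
saved registers and by the memory from the old value of register `8` on. -/
lemma preprocess_spec {c : Ctx} (hc : c.Valid) {g : Guess} (hg : g.Valid c) {pre : Prog}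
    (hp : Fits c.R pre) {σ : State} (hσ : c.Inv σ) (hgσ : g.Holds σ)
    (hfree : σ.reg 8 + c.S ≤ c.X) :
    Run c.bits (preprocess c.R pre) σ fun t σ' =>
      t ≤ c.n * c.r * (c.d * 11 + 23) + 2 * c.R + clockCost pre * (c.F₁ + 1) + 16 ∧
      (∀ x, x ∉ preprocessRegs → x < 64 → σ'.reg x = σ.reg x) ∧
      σ'.reg 7 = σ.reg 8 ∧ σ'.reg 8 = σ.reg 8 + c.S ∧ c.Inv σ' ∧
      (∀ r < c.R, σ'.reg (64 + c.R + r) < c.S) ∧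
      ∀ b u s, 2 ^ b ≤ c.S →
        Exec b pre (inputState c.n g.m g.k (inputWord c.A c.d g.start g.m g.l g.L)) u s →
        u < c.F₁ → (∀ r < c.R, σ'.reg (64 + c.R + r) = s.reg r) ∧
          ∀ b i, i < c.S → overlay (σ.reg 8) 0 σ' b i = s.mem b i := by
  have hX := hc.hX
  have hXX : 5 * c.X ≤ c.X * c.X := Nat.mul_le_mul_right _ hc.X_ge
  have hX1 := hc.X_ge
  have hSX := hc.S_le
  have hSge := hc.S_ge
  have hF₁ := hc.F₁_le
  have hR := hc.R_le
  have hR5 := hc.R_ge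
  have hNX := hc.N_le
  have hk := hg.k
  have hm := hg.m
  have hl := hg.l
  have hL := hg.L
  have hst := hg.start
  have hdX : c.d ≤ c.X := (Nat.lt_two_pow_self).le.trans hc.d_le
  have hpow : 0 < 2 ^ c.d := by positivity
  have hnm : c.n * g.m ≤ c.n * c.r := Nat.mul_le_mul_left _ hm
  have hbl := hσ.free
  set e₁ := σ.reg 8 with he₁
  refine run_seq (run_const (by omega) (run_seq (run_copy ?_ (run_seq (run_op ?_ ?_)))))
  · simp only [State.setReg_reg, Nat.reduceEqDiff, if_false]; omega
  · simp only [BinOp.eval, State.setReg_reg, Nat.reduceEqDiff, if_false, hσ.S]; omega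
  simp only [BinOp.eval, State.setReg_reg, Nat.reduceEqDiff, if_false, hσ.S, ← he₁]
  generalize hσ₂ : ((σ.setReg 7 0).setReg 6 e₁).setReg 8 (e₁ + c.S) = σ₂
  have hm₂ : σ₂.mem = σ.mem := by rw [← hσ₂]; rfl
  have hr₂ : ∀ x, x ∉ [6, 7, 8] → σ₂.reg x = σ.reg x := by
    intro x hx
    simp only [List.mem_cons, List.not_mem_nil, or_false, not_or] at hx
    rw [← hσ₂, State.setReg_reg, State.setReg_reg, State.setReg_reg, if_neg hx.2.2, if_neg hx.1,
      if_neg hx.2.1]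
  have h6₂ : σ₂.reg 6 = e₁ := by rw [← hσ₂]; rfl
  have h7₂ : σ₂.reg 7 = 0 := by rw [← hσ₂]; rfl
  have h8₂ : σ₂.reg 8 = e₁ + c.S := by rw [← hσ₂]; rfl
  refine run_seq ((writeInput_spec hX hX1 (by rw [hr₂ _ (by decide), hσ.d])
    (by rw [hr₂ _ (by decide), hσ.n]) (by rw [hr₂ _ (by decide), hσ.one])
    (by rw [hr₂ _ (by decide), hσ.two]) (by rw [hm₂, hσ.A]; exact hc.A_le)
    (by rw [hr₂ _ (by decide), hgσ.m]) (by rw [hr₂ _ (by decide), hgσ.l])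
    (by rw [hr₂ _ (by decide), hgσ.L]) (by rw [hr₂ _ (by decide), hgσ.start])
    (by omega) (by omega) hdX (by omega) (by omega)).mono ?_)
  rintro t₃ σ₃ ⟨ht₃, hr₃', hm₃⟩
  rw [h6₂, hm₂, hσ.A] at hm₃
  have hr₃ : ∀ x, x ∉ preprocessRegs → σ₃.reg x = σ.reg x := by
    intro x hx
    rw [hr₃' x fun h => hx ((by decide : 21 :: writeRegs ⊆ preprocessRegs) h),
      hr₂ x fun h => hx ((by decide : [6, 7, 8] ⊆ preprocessRegs) h)]
  have h6₃ : σ₃.reg 6 = e₁ := by rw [hr₃' _ (by decide), h6₂]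
  have h7₃ : σ₃.reg 7 = 0 := by rw [hr₃' _ (by decide), h7₂]
  have h8₃ : σ₃.reg 8 = e₁ + c.S := by rw [hr₃' _ (by decide), h8₂]
  refine run_seq ((initRegs_spec hc.R_ge (by rw [hr₃ _ (by decide), hσ.n])
    (by rw [hr₃ _ (by decide), hgσ.m]) (by rw [hr₃ _ (by decide), hgσ.k])
    (by rw [hr₃ _ (by decide), hσ.one]) (by omega) (by omega) (by omega) (by omega)).mono ?_)
  rintro t₄ σ₄ ⟨rfl, hm₄, hr₄'⟩
  have hr₄ : ∀ x, x < 64 ∨ 64 + c.R ≤ x → σ₄.reg x = σ₃.reg x := by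
    intro x hx; rw [hr₄', if_neg (by omega)]
  have h27 : σ₄.reg 27 = c.F₁ := by
    rw [hr₄ _ (by omega), hr₃ _ (by decide), hσ.F₁]
  refine run_seq (run_copy (by omega) ?_)
  rw [h27]
  generalize hσ₅ : σ₄.setReg 5 c.F₁ = σ₅
  have hm₅ : σ₅.mem = σ₃.mem := by rw [← hσ₅]; exact hm₄
  have hr₅ : ∀ x, x ≠ 5 → x < 64 ∨ 64 + c.R ≤ x → σ₅.reg x = σ₃.reg x := by
    intro x h5 hx
    rw [← hσ₅, State.setReg_reg, if_neg h5, hr₄ x hx]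
  have hs₅ : ∀ r < c.R, σ₅.reg (64 + r) = inputReg c.n g.m g.k r := by
    intro r hr
    rw [← hσ₅, State.setReg_reg, if_neg (by omega), hr₄', if_pos (by omega),
      Nat.add_sub_cancel_left]
  have h5₅ : σ₅.reg 5 = c.F₁ := by rw [← hσ₅]; rfl
  have hmem5 : ∀ b i, σ₅.mem (b + 2) i = if (b = 0 ∨ b = 2) ∧ e₁ ≤ i ∧ i < e₁ + c.n * g.m then
      (if b = 0 then inputWord c.A c.d g.start g.m g.l g.L (i - e₁) + 1 else 2)
      else σ.mem (b + 2) i := by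
    intro b i
    simp only [hm₅, hm₃, Nat.reduceEqDiff]
  have hready : SimReady c.R c.S e₁ 0 σ₅ := by
    refine ⟨?_, ?_, ?_, ?_, ?_, ?_, ?_⟩
    · rw [hr₅ _ (by decide) (by omega), hr₃ _ (by decide), hσ.S]
    · rw [hr₅ _ (by decide) (by omega), h6₃]
    · rw [hr₅ _ (by decide) (by omega), h7₃]
    · rw [hr₅ _ (by decide) (by omega), hr₃ _ (by decide), hσ.one]
    · omega
    · intro r hr
      rw [hs₅ r hr, inputReg]
      split_ifs <;> omega
    · intro b i
      rw [hmem5]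
      split_ifs with h1 h2
      · have hm0 : 0 < g.m := by
          rcases Nat.eq_zero_or_pos g.m with h0 | h0
          · rw [h0, mul_zero] at h1; omega
          · exact h0
        have := inputWord_le c.A c.d g.start g.l g.L (i - e₁) hm0
        omega
      · omega
      · exact hσ.mem_le b i
  have hSS : c.S * c.S ≤ c.X * c.X := Nat.mul_le_mul hSX hSX
  refine run_seq ((clocked_spec (R := c.R) (S := c.S) (e₁ := e₁) (e₀ := 0) (by omega) (by omega)
    (by omega) (by omega) pre hp σ₅ hready).mono ?_)
  intro t₆ σ₆ hpost
  have hfr := hpost.frame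
  have hr₆ : ∀ x, x ∉ preprocessRegs → (x < 64 ∨ 64 + c.R ≤ x) → σ₆.reg x = σ.reg x := by
    intro x hx hx'
    rw [hfr.reg x (fun h => hx ((by decide : [5, 10, 11, 12, 13] ⊆ preprocessRegs) h)) hx',
      hr₅ x (by rintro rfl; exact hx (by decide)) hx', hr₃ x hx]
  have h6₆ : σ₆.reg 6 = e₁ := by
    rw [hfr.reg _ (by decide) (by omega), hr₅ _ (by decide) (by omega), h6₃]
  have h8₆ : σ₆.reg 8 = e₁ + c.S := by
    rw [hfr.reg _ (by decide) (by omega), hr₅ _ (by decide) (by omega), h8₃]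
  have hA₆ : σ₆.mem 0 = c.A := by
    rw [hfr.mem_bank 0 (by omega), hm₅, ← hσ.A]
    funext i; rw [hm₃, if_neg (by omega)]
  have hB₆ : σ₆.mem 1 = c.B := by
    rw [hfr.mem_bank 1 (by omega), hm₅, ← hσ.B]
    funext i; rw [hm₃, if_neg (by omega)]
  refine run_seq ((copyRegs_spec (fun r hr => ?_) (by omega)).mono ?_)
  · have := hpost.ready.reg_lt r hr
    omega
  rintro t₇ σ₇ ⟨rfl, hm₇, hr₇'⟩
  have hr₇ : ∀ x, x < 64 + c.R → σ₇.reg x = σ₆.reg x := by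
    intro x hx; rw [hr₇', if_neg (by omega)]
  have h6₇ : σ₇.reg 6 = e₁ := by rw [hr₇ _ (by omega), h6₆]
  refine run_copy (by omega) ?_
  rw [h6₇]
  generalize hσ₈ : σ₇.setReg 7 e₁ = σ₈
  have hm₈ : σ₈.mem = σ₆.mem := by rw [← hσ₈]; exact hm₇
  have hr₈ : ∀ x, x ≠ 7 → x < 64 + c.R → σ₈.reg x = σ₆.reg x := by
    intro x h7 hx
    rw [← hσ₈, State.setReg_reg, if_neg h7, hr₇ x hx]
  have hs₈ : ∀ r < c.R, σ₈.reg (64 + c.R + r) = σ₆.reg (64 + r) := by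
    intro r hr
    rw [← hσ₈, State.setReg_reg, if_neg (by omega), hr₇', if_pos (by omega),
      Nat.add_sub_cancel_left]
  have hfix : ∀ x, x ∉ preprocessRegs → x < 64 → σ₈.reg x = σ.reg x := by
    intro x hx hx'
    rw [hr₈ x (by rintro rfl; exact hx (by decide)) (by omega), hr₆ x hx (.inl hx')]
  have hlow : ∀ b i, i < e₁ → σ₈.mem b i = σ.mem b i := by
    intro b i hi
    rw [hm₈, hfr.mem_addr b i (.inl hi), hm₅, hm₃, if_neg (by omega)]
  have h8₈ : σ₈.reg 8 = e₁ + c.S := by rw [hr₈ _ (by decide) (by omega), h8₆]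
  refine ⟨?_, hfix, by rw [← hσ₈]; rfl, h8₈, ?_, ?_, ?_⟩
  · have htime := hpost.time
    rw [h5₅] at htime
    have hkl : c.n * g.m * (g.l * 11 + 23) ≤ c.n * c.r * (c.d * 11 + 23) :=
      Nat.mul_le_mul hnm (by omega)
    have htc : t₆ ≤ clockCost pre * (c.F₁ + 1) := le_trans (Nat.le_add_right _ _) htime
    omega
  · refine hσ.of_fixed (fun x hx => hfix x ?_ ?_) (by rw [hm₈, hA₆]) (by rw [hm₈, hB₆]) ?_ ?_ ?_
      ?_ ?_
    · exact (by decide : ∀ x ∈ fixedRegs, x ∉ preprocessRegs) x hx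
    · exact (by decide : ∀ x ∈ fixedRegs, x < 64) x hx
    · intro b i; rw [hm₈]; exact hpost.ready.mem_le b i
    · intro b i hi
      rw [h8₈] at hi
      rw [hm₈, hfr.mem_addr _ i (.inr hi), hmem5, if_neg (by omega)]
      exact hσ.fresh b i (by omega)
    · intro b i hi
      rw [hlow _ _ (by omega)]; exact hσ.blank b i hi
    · omega
    · intro r hr
      rw [hr₈ _ (by omega) (by omega)]
      exact hpost.ready.reg_lt r hr
  · intro r hr
    rw [hs₈ r hr]; exact hpost.ready.reg_lt r hr
  · intro b u s hb hex hu
    have hrep : Represents c.R c.S e₁ 0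
        (inputState c.n g.m g.k (inputWord c.A c.d g.start g.m g.l g.L)) σ₅ := by
      refine ⟨hs₅, fun b' i' hi' => ?_⟩
      have hfresh : σ.mem (b' + 2) (e₁ + i') = 0 := hσ.fresh _ _ (by omega)
      have hblank : σ₅.mem (b' + 2) (0 + i') = 0 := by
        rw [hmem5, if_neg (by omega)]; exact hσ.blank _ _ (by omega)
      rw [overlay, hblank, hmem5, hfresh, Nat.add_sub_cancel_left]
      simp only [inputState]
      by_cases hb' : b' = 0 ∨ b' = 2
      · by_cases hlt : i' < c.n * g.m
        · have hlt' : e₁ + i' < e₁ + c.n * g.m := by omega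
          rcases hb' with rfl | rfl <;> simp [hlt, hlt']
        · have hlt' : ¬ e₁ + i' < e₁ + c.n * g.m := by omega
          simp [hlt, hlt']
      · simp [hb']
    obtain ⟨hrep', hfu⟩ := hpost.sim b _ u s hb hrep hex (by rw [h5₅]; exact hu)
    refine ⟨fun r hr => by rw [hs₈ r hr, hrep'.reg r hr], fun b' i' hi' => ?_⟩
    rw [← hrep'.mem b' i' hi', overlay, overlay, hm₈]

/-! ### The loop over all guesses -/

/-- The guess that is encoded by the number `u`, in mixed radix notation. -/
def Ctx.guess (c : Ctx) (u : ℕ) : Guess where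
  k := u / c.G % c.r
  m := u / c.G / c.r % c.r
  l := u / c.G / c.r / c.r % (c.d + 1)
  L := u / c.G / c.r / c.r / (c.d + 1) % c.r
  start := if c.N - c.n < u % c.G * c.n then c.N - c.n else u % c.G * c.n

lemma Ctx.guess_valid {c : Ctx} (hc : c.Valid) (u : ℕ) : (c.guess u).Valid c where
  k := (Nat.mod_lt _ hc.r_pos).le
  m := (Nat.mod_lt _ hc.r_pos).le
  l := Nat.lt_succ_iff.mp (Nat.mod_lt _ (Nat.succ_pos _))
  L := (Nat.mod_lt _ hc.r_pos).le
  start := by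
    have := hc.n_le
    simp only [Ctx.guess]
    split_ifs <;> omega

/-- Decode the guess in register `16`. -/
def decodeGuess : Prog :=
  .seq (.op .mod 40 16 14) <| .seq (.op .div 41 16 14) <| .seq (.op .mod 17 41 2) <|
  .seq (.op .div 41 41 2) <| .seq (.op .mod 18 41 2) <| .seq (.op .div 41 41 2) <|
  .seq (.op .mod 19 41 29) <| .seq (.op .div 41 41 29) <| .seq (.op .mod 20 41 2) <|
  .seq (.op .mul 22 40 3) <| .seq (.op .sub 42 0 3) <| .seq (.op .lt 43 42 22) <|
  .cond 43 (.copy 22 42) .skip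

lemma decodeGuess_spec {c : Ctx} (hc : c.Valid) {σ : State} (hσ : c.Inv σ) {u : ℕ}
    (h16 : σ.reg 16 = u) (hu : u ≤ c.X) :
    Run c.bits decodeGuess σ fun t σ' => t = 14 ∧
      Touches [17, 18, 19, 20, 22, 40, 41, 42, 43] σ σ' ∧ (c.guess u).Holds σ' := by
  have hX := hc.hX
  have hXX : 5 * c.X ≤ c.X * c.X := Nat.mul_le_mul_right _ hc.X_ge
  have hX1 := hc.X_ge
  have hNX := hc.N_le
  have h1 : u / c.G ≤ u := Nat.div_le_self _ _
  have h2 : u / c.G / c.r ≤ u / c.G := Nat.div_le_self _ _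
  have h3 : u / c.G / c.r / c.r ≤ u / c.G / c.r := Nat.div_le_self _ _
  have h4 : u / c.G / c.r / c.r / (c.d + 1) ≤ u / c.G / c.r / c.r := Nat.div_le_self _ _
  have h5 : u % c.G ≤ u := Nat.mod_le _ _
  have h6 : u / c.G % c.r ≤ u / c.G := Nat.mod_le _ _
  have h7 : u / c.G / c.r % c.r ≤ u / c.G / c.r := Nat.mod_le _ _
  have h8 : u / c.G / c.r / c.r % (c.d + 1) ≤ u / c.G / c.r / c.r := Nat.mod_le _ _
  have h9 : u / c.G / c.r / c.r / (c.d + 1) % c.r ≤ u / c.G / c.r / c.r / (c.d + 1) :=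
    Nat.mod_le _ _
  have h10 : u % c.G * c.n ≤ c.X * c.X := Nat.mul_le_mul (by omega) (by omega)
  have e0 := hσ.N
  have e2 := hσ.r
  have e3 := hσ.n
  have e14 := hσ.G
  have e29 := hσ.d1
  simp only [decodeGuess, run_seq_iff, run_op_iff, State.setReg_reg, BinOp.eval]
  simp only [Nat.reduceEqDiff, if_true, if_false, e0, e2, e3, e14, e29, h16]
  refine ⟨by omega, by omega, by omega, by omega, by omega, by omega, by omega, by omega, by omega,
    by omega, by omega, ite_lt (by omega), ?_⟩
  generalize hs₁ : State.setReg _ 43 _ = s₁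
  have hT : Touches [17, 18, 19, 20, 22, 40, 41, 42, 43] σ s₁ := by
    rw [← hs₁]
    iterate 12 refine Touches.setReg ?_ (by decide)
    exact .refl _ _
  have e17 : s₁.reg 17 = (c.guess u).k := by rw [← hs₁]; rfl
  have e18 : s₁.reg 18 = (c.guess u).m := by rw [← hs₁]; rfl
  have e19 : s₁.reg 19 = (c.guess u).l := by rw [← hs₁]; rfl
  have e20 : s₁.reg 20 = (c.guess u).L := by rw [← hs₁]; rfl
  have e22 : s₁.reg 22 = u % c.G * c.n := by rw [← hs₁]; rfl
  have e42 : s₁.reg 42 = c.N - c.n := by rw [← hs₁]; rfl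
  have e43 : s₁.reg 43 = if c.N - c.n < u % c.G * c.n then 1 else 0 := by rw [← hs₁]; rfl
  refine run_cond (fun h => run_copy (by omega) ?_) (fun h => run_skip ?_)
  · refine ⟨by trivial, hT.setReg (by decide), ?_, ?_, ?_, ?_, ?_⟩
    · rw [State.setReg_reg, if_neg (by decide), e17]
    · rw [State.setReg_reg, if_neg (by decide), e18]
    · rw [State.setReg_reg, if_neg (by decide), e19]
    · rw [State.setReg_reg, if_neg (by decide), e20]
    · rw [State.setReg_reg, if_pos rfl, e42]
      simp only [Ctx.guess]
      rw [e43] at h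
      split_ifs at h ⊢ with h'
      · rfl
      · exact absurd rfl h
  · refine ⟨by trivial, hT, e17, e18, e19, e20, ?_⟩
    rw [e22]
    simp only [Ctx.guess]
    rw [e43] at h
    split_ifs at h ⊢ with h'
    rfl

/-- The preprocessing of the group of the guess `g` terminates in time, and some query terminates
in time and answers with a vector that is orthogonal to the query vector. -/
def Ctx.Succeeds (c : Ctx) (g : Guess) (pre qry : Prog) : Prop :=
  ∃ b u s, 2 ^ b ≤ c.S ∧
    Exec b pre (inputState c.n g.m g.k (inputWord c.A c.d g.start g.m g.l g.L)) u s ∧ u < c.F₁ ∧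
    ∃ j < c.N, ∃ b' u' s' i, 2 ^ b' ≤ c.S ∧
      Exec b' qry (queryState s g.k (queryWord c.B c.d j g.k g.m g.l g.L)) u' s' ∧ u' < c.F₂ ∧
      s'.reg 0 = i + 1 ∧ i < c.n ∧ c.Orth (g.start + i) j

/-- A bound for the time of a guess. -/
def Ctx.groupTime (c : Ctx) (pre qry : Prog) : ℕ :=
  c.n * c.r * (c.d * 11 + 23) + 2 * c.R + clockCost pre * (c.F₁ + 1) +
    c.N * (c.queryTime qry + 2) + 32

/-- Decode a guess, preprocess its group, and query all vectors of `B`. -/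
def groupStep (R : ℕ) (pre qry : Prog) : Prog :=
  .seq decodeGuess (.seq (preprocess R pre) (queryLoop R qry))

lemma groupStep_spec {c : Ctx} (hc : c.Valid) {pre qry : Prog} (hp : Fits c.R pre)
    (hq : Fits c.R qry) {σ : State} (hσ : c.Inv σ) {u : ℕ} (h16 : σ.reg 16 = u) (hu : u ≤ c.X)
    (hfree : σ.reg 8 + c.S * (c.N + 1) ≤ c.X) :
    Run c.bits (groupStep c.R pre qry) σ fun t σ' =>
      t ≤ c.groupTime pre qry ∧ c.Inv σ' ∧ σ'.reg 16 = u ∧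
      σ'.reg 8 = σ.reg 8 + c.S * (c.N + 1) ∧
      (σ'.reg 9 = σ.reg 9 ∨ σ'.reg 9 = 1 ∧ ∃ i < c.N, ∃ j < c.N, c.Orth i j) ∧
      (c.Succeeds (c.guess u) pre qry → σ'.reg 9 = 1) := by
  have hg := Ctx.guess_valid hc u
  have hmul : c.S * (c.N + 1) = c.S * c.N + c.S := Nat.mul_succ _ _
  refine run_seq ((decodeGuess_spec hc hσ h16 hu).mono ?_)
  rintro t₁ σ₁ ⟨rfl, hT₁, hg₁⟩
  have h8₁ : σ₁.reg 8 = σ.reg 8 := hT₁.2 _ (by decide)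
  have hσ₁ : c.Inv σ₁ := by
    refine hσ.of_fixed (fun x hx => hT₁.2 x ?_) (by rw [hT₁.1, hσ.A]) (by rw [hT₁.1, hσ.B])
      ?_ ?_ ?_ (by rw [h8₁]; exact hσ.free) ?_
    · exact (by decide : ∀ x ∈ fixedRegs, x ∉ [17, 18, 19, 20, 22, 40, 41, 42, 43]) x hx
    · rw [hT₁.1]; exact hσ.mem_le
    · rw [hT₁.1, h8₁]; exact hσ.fresh
    · rw [hT₁.1]; exact hσ.blank
    · intro r hr
      rw [hT₁.2 _ fun h => by
        have := (by decide : ∀ x ∈ [17, 18, 19, 20, 22, 40, 41, 42, 43], x < 64) _ h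
        omega]
      exact hσ.reg_lt r hr
  refine run_seq ((preprocess_spec hc hg hp hσ₁ hg₁ (by omega)).mono ?_)
  rintro t₂ σ₂ ⟨ht₂, hr₂, h7₂, h8₂, hσ₂, hlt₂, hsim⟩
  refine (queryLoop_spec hc hg hq hσ₂ (hg₁.of_eq fun x hx => hr₂ x ?_ ?_) h7₂ (by omega) (by omega)
    hlt₂).mono ?_
  · exact (by decide : ∀ x ∈ [17, 18, 19, 20, 22], x ∉ preprocessRegs) x hx
  · exact (by decide : ∀ x ∈ [17, 18, 19, 20, 22], x < 64) x hx
  rintro t₃ σ₃ ⟨ht₃, hr₃, h8₃, hσ₃, hor, hfound⟩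
  have h9 : σ₂.reg 9 = σ.reg 9 := by
    rw [hr₂ _ (by decide) (by decide), hT₁.2 _ (by decide)]
  refine ⟨?_, hσ₃, ?_, by omega, by rwa [h9] at hor, ?_⟩
  · unfold Ctx.groupTime; omega
  · rw [hr₃ _ (by decide) (by omega), hr₂ _ (by decide) (by decide), hT₁.2 _ (by decide), h16]
  · rintro ⟨b, w, s, hb, hex, hw, j, hj, b', w', s', i, hb', hex', hw', hans, hi, ho⟩
    obtain ⟨hreg, hmem⟩ := hsim b w s hb hex hw
    exact hfound j hj ⟨b', s, w', s', i, hb', hreg, by rw [h8₁] at hmem ⊢; exact hmem, hex', hw',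
      hans, hi, ho⟩

/-- Try all guesses; register `15` holds their number. -/
def guessLoop (R : ℕ) (pre qry : Prog) : Prog :=
  .seq (.copy 16 15) <| .seq (.countdown 16 (groupStep R pre qry)) (.copy 0 9)

/-- The answer is `1` only if there is an orthogonal pair, and it is `1` if some guess succeeds. -/
lemma guessLoop_spec {c : Ctx} (hc : c.Valid) {pre qry : Prog} (hp : Fits c.R pre)
    (hq : Fits c.R qry) {σ : State} (hσ : c.Inv σ) {U : ℕ} (h15 : σ.reg 15 = U) (hU : U ≤ c.X)
    (h9 : σ.reg 9 = 0) (hfree : σ.reg 8 + c.S * (c.N + 1) * U ≤ c.X) :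
    Run c.bits (guessLoop c.R pre qry) σ fun t σ' =>
      t ≤ U * (c.groupTime pre qry + 2) + 3 ∧
      (σ'.reg 0 = 0 ∨ σ'.reg 0 = 1 ∧ ∃ i < c.N, ∃ j < c.N, c.Orth i j) ∧
      ((∃ u < U, c.Succeeds (c.guess u) pre qry) → σ'.reg 0 = 1) := by
  have hX := hc.hX
  have hXX : 5 * c.X ≤ c.X * c.X := Nat.mul_le_mul_right _ hc.X_ge
  have hX1 := hc.X_ge
  refine run_seq (run_copy (by omega) ?_)
  rw [h15]
  have hset : ∀ {σ' : State} (v : ℕ), c.Inv σ' → c.Inv (σ'.setReg 16 v) := by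
    intro σ' v h
    have hr : ∀ x, x ≠ 16 → (σ'.setReg 16 v).reg x = σ'.reg x := by
      intro x hx; rw [State.setReg_reg, if_neg hx]
    refine h.of_fixed (fun x hx => hr x ?_) h.A h.B h.mem_le ?_ h.blank ?_ ?_
    · rintro rfl; exact absurd hx (by decide)
    · rw [hr _ (by decide)]; exact h.fresh
    · rw [hr _ (by decide)]; exact h.free
    · intro r hr'; rw [hr _ (by omega)]; exact h.reg_lt r hr'
  refine run_seq ((run_countdown (T := c.groupTime pre qry) (fun u σ' => σ'.reg 16 = u ∧ u ≤ U ∧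
    c.Inv σ' ∧ σ'.reg 8 + c.S * (c.N + 1) * u ≤ c.X ∧
    (σ'.reg 9 = 0 ∨ σ'.reg 9 = 1 ∧ ∃ i < c.N, ∃ j < c.N, c.Orth i j) ∧
    ∀ u', u ≤ u' → u' < U → c.Succeeds (c.guess u') pre qry → σ'.reg 9 = 1)
    ?_ (by norm_num) ?_ U _ (by omega) ?_).mono ?_)
  · rintro u σ' ⟨h, _, hinv, _⟩
    exact ⟨h, hinv.one⟩
  · rintro u σ' - ⟨_, huU, hinv, h8, hor, hfound⟩
    have hmul : c.S * (c.N + 1) * (u + 1) = c.S * (c.N + 1) * u + c.S * (c.N + 1) :=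
      Nat.mul_succ _ _
    have e8 : (σ'.setReg 16 u).reg 8 = σ'.reg 8 := by rw [State.setReg_reg, if_neg (by decide)]
    have e9 : (σ'.setReg 16 u).reg 9 = σ'.reg 9 := by rw [State.setReg_reg, if_neg (by decide)]
    refine (groupStep_spec hc hp hq (hset u hinv) (by rw [State.setReg_reg, if_pos rfl])
      (by omega) (by omega)).mono ?_
    rintro t σ₂ ⟨ht, hinv₂, h16, h8₂, hor₂, hfound₂⟩
    rw [e9] at hor₂
    refine ⟨ht, h16, by omega, hinv₂, by omega, ?_, fun u' hu' hu'U hs => ?_⟩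
    · rcases hor₂ with h | h
      · rwa [h]
      · exact .inr h
    · rcases Nat.lt_or_ge u u' with hlt | hge
      · have := hfound u' hlt hu'U hs
        rcases hor₂ with h | h
        · rw [h, this]
        · exact h.1
      · obtain rfl : u = u' := by omega
        exact hfound₂ hs
  · refine ⟨by rw [State.setReg_reg, if_pos rfl], le_rfl, hset _ hσ, ?_, .inl ?_,
      fun u' h h' => by omega⟩
    · rw [State.setReg_reg, if_neg (by decide)]; exact hfree
    · rw [State.setReg_reg, if_neg (by decide), h9]
  · rintro t σ' ⟨ht, _, _, hinv, _, hor, hfound⟩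
    refine run_copy ?_ ⟨by omega, ?_, ?_⟩
    · rcases hor with h | h <;> omega
    · rw [State.setReg_reg, if_pos rfl]; exact hor
    · rintro ⟨u, hu, hs⟩
      rw [State.setReg_reg, if_pos rfl]
      exact hfound u (Nat.zero_le _) hu hs

/-! ### Initialisation -/

/-- `reg dst := reg src ^ e` -/
def power (dst src : ℕ) : ℕ → Prog
  | 0 => .const dst 1
  | e + 1 => .seq (power dst src e) (.op .mul dst dst src)

lemma State.setReg_setReg (s : State) (r v w : ℕ) : (s.setReg r v).setReg r w = s.setReg r w := by
  simp only [State.setReg, Function.update_idem]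

lemma run_power {bits dst src x : ℕ} {s : State} (hne : src ≠ dst) (hs : s.reg src = x)
    (hx : 1 ≤ x) : ∀ {e : ℕ} {Q : ℕ → State → Prop}, x ^ e < 2 ^ bits →
      Q (e + 1) (s.setReg dst (x ^ e)) → Run bits (power dst src e) s Q
  | 0, Q, h, hQ => run_const (by rwa [pow_zero] at h) (by rwa [pow_zero] at hQ)
  | e + 1, Q, h, hQ => by
    have hle : x ^ e ≤ x ^ (e + 1) := Nat.pow_le_pow_right hx (Nat.le_succ e)
    refine run_seq (run_power hne hs hx (by omega) (run_op ?_ ?_))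
    all_goals
      simp only [BinOp.eval, State.setReg_reg, if_true, if_neg hne, hs, ← pow_succ]
    · exact h
    · rwa [State.setReg_setReg]

/-- `reg 2 :=` the largest `r` with `r ^ Z ≤ reg 0` -/
def root (Z : ℕ) : Prog :=
  .seq (.const 2 0) <| .seq (.copy 16 0) <| .countdown 16 <|
    .seq (.op .add 40 2 rOne) <| .seq (power 41 40 Z) <| .seq (.op .lt 42 0 41) <|
      .cond 42 .skip (.copy 2 40)

lemma root_spec {bits Z N r : ℕ} {σ : State} (hZ : Z ≠ 0) (h0 : σ.reg 0 = N) (h1 : σ.reg rOne = 1)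
    (hr : r ^ Z ≤ N) (hN : N < (r + 1) ^ Z) (hb : (r + 1) ^ Z < 2 ^ bits) :
    Run bits (root Z) σ fun t σ' => t ≤ N * (Z + 5 + 2) + 3 ∧
      Touches [2, 16, 40, 41, 42] σ σ' ∧ σ'.reg 2 = r := by
  have hrN : r ≤ N := (Nat.le_self_pow hZ r).trans hr
  have hr1 : r + 1 ≤ (r + 1) ^ Z := Nat.le_self_pow hZ _
  refine run_seq (run_const (by positivity) (run_seq (run_copy ?_ ?_)))
  · rw [State.setReg_reg, if_neg (by decide)]; omega
  simp only [State.setReg_reg, Nat.reduceEqDiff, if_false, h0]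
  refine (run_countdown (T := Z + 5) (fun i σ' => σ'.reg 16 = i ∧ i ≤ N ∧
    Touches [2, 16, 40, 41, 42] σ σ' ∧ σ'.reg 2 = min r (N - i)) ?_ (by norm_num) ?_ N _
    (by omega) ?_).mono ?_
  · rintro i σ' ⟨h, _, hT, _⟩
    exact ⟨h, by rw [hT.2 _ (by decide), h1]⟩
  · rintro i σ' - ⟨_, hiN, hT, h2⟩
    set v := min r (N - (i + 1)) with hv
    have hvr : v ≤ r := Nat.min_le_left _ _
    have e25 : σ'.reg rOne = 1 := by rw [hT.2 _ (by decide), h1]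
    have e0 : σ'.reg 0 = N := by rw [hT.2 _ (by decide), h0]
    have hpow : (v + 1) ^ Z ≤ (r + 1) ^ Z := Nat.pow_le_pow_left (by omega) Z
    refine run_seq (run_op ?_ (run_seq (run_power (x := v + 1) (by decide) ?_ (by omega) (by omega)
      (run_seq (run_op ?_ ?_)))))
    · simp only [BinOp.eval, State.setReg_reg, Nat.reduceEqDiff, if_false, h2, e25]; omega
    · simp only [BinOp.eval, State.setReg_reg, Nat.reduceEqDiff, if_true, if_false, h2, e25]
    · exact ite_lt (by omega)
    simp only [BinOp.eval, State.setReg_reg, Nat.reduceEqDiff, if_true, if_false, h2, e25, e0]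
    generalize hs₁ : State.setReg _ 42 _ = s₁
    have hT₁ : Touches [2, 16, 40, 41, 42] σ s₁ := by
      rw [← hs₁]
      iterate 4 refine Touches.setReg ?_ (by decide)
      exact hT
    have e16 : s₁.reg 16 = i := by rw [← hs₁]; rfl
    have e2 : s₁.reg 2 = v := by rw [← hs₁]; exact h2
    have e40 : s₁.reg 40 = v + 1 := by rw [← hs₁]; rfl
    have e42 : s₁.reg 42 = if N < (v + 1) ^ Z then 1 else 0 := by rw [← hs₁]; rfl
    refine run_cond (fun h => run_skip ?_) (fun h => run_copy (by omega) ?_)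
    · refine ⟨by omega, e16, by omega, hT₁, ?_⟩
      rw [e2]
      rw [e42] at h
      split_ifs at h with h'
      · have : r < v + 1 := by
          by_contra hc
          have := Nat.pow_le_pow_left (not_lt.mp hc) Z
          omega
        omega
      · exact absurd rfl h
    · refine ⟨by omega, by rw [State.setReg_reg, if_neg (by decide), e16], by omega,
        hT₁.setReg (by decide), ?_⟩
      rw [State.setReg_reg, if_pos rfl, e40]
      rw [e42] at h
      split_ifs at h with h'
      have : v < r := by
        by_contra hc
        have := Nat.pow_le_pow_left (by omega : r + 1 ≤ v + 1) Z
        omega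
      omega
  · exact ⟨by rw [State.setReg_reg, if_pos rfl], le_rfl,
      ((Touches.refl _ _).setReg (by decide)).setReg (by decide),
      by simp [State.setReg_reg]⟩
  · rintro t σ' ⟨ht, _, _, hT, h2⟩
    exact ⟨by omega, hT, by omega⟩

/-- The exponents and constants that determine the data of a run of the reduction on `N` vectors:
the groups have size `r ^ z`, where `r` is the largest number with `r ^ Z ≤ N`, the words of the
simulation are bounded by `(N + 1) ^ s`, and the fuel is `C * r ^ f₁` and `C * r ^ f₂`. -/
structure Params where
  (Z z s f₁ f₂ C R : ℕ)

/-- The data of a run. -/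
def Params.ctx (p : Params) (bits X N d r : ℕ) (A B : ℕ → ℕ) : Ctx where
  bits := bits
  X := X
  N := N
  d := d
  r := r
  n := r ^ p.z
  S := (N + 1) ^ p.s
  R := p.R
  G := N / r ^ p.z + 1
  F₁ := p.C * r ^ p.f₁
  F₂ := p.C * r ^ p.f₂
  A := A
  B := B

/-- The number of guesses. -/
def Ctx.guesses (c : Ctx) : ℕ := c.r ^ 3 * (c.d + 1) * c.G

/-- Compute the data of the run from `N` and `d`. -/
def initialise (p : Params) : Prog :=
  .seq (root p.Z) <| .seq (power 3 2 p.z) <| .seq (.op .add 40 0 rOne) <| .seq (power 4 40 p.s) <|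
  .seq (power 40 2 p.f₁) <| .seq (.const 41 p.C) <| .seq (.op .mul 27 41 40) <|
  .seq (power 40 2 p.f₂) <| .seq (.op .mul 28 41 40) <| .seq (.op .add 29 1 rOne) <|
  .seq (.op .div 14 0 3) <| .seq (.op .add 14 14 rOne) <| .seq (power 15 2 3) <|
  .seq (.op .mul 15 15 29) <| .seq (.op .mul 15 15 14) (.copy 8 4)

lemma initialise_spec {p : Params} {bits X N d r : ℕ} {A B : ℕ → ℕ} {σ : State} (hZ : p.Z ≠ 0)
    (hc : (p.ctx bits X N d r A B).Valid) (hC : 1 ≤ p.C) (h0 : σ.reg 0 = N) (h1 : σ.reg 1 = d)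
    (hA : σ.mem 0 = A) (hB : σ.mem 1 = B) (hmem : ∀ b i, σ.mem (b + 2) i = 0)
    (h25 : σ.reg rOne = 1) (h26 : σ.reg rTwo = 2) (hreg : ∀ x, 64 ≤ x → σ.reg x = 0)
    (h9 : σ.reg 9 = 0) (hr : r ^ p.Z ≤ N) (hN : N < (r + 1) ^ p.Z) (hrX : (r + 1) ^ p.Z ≤ X)
    (hU : (p.ctx bits X N d r A B).guesses ≤ X) :
    Run bits (initialise p) σ fun t σ' =>
      t ≤ N * (p.Z + 5 + 2) + p.z + p.s + p.f₁ + p.f₂ + 25 ∧ (p.ctx bits X N d r A B).Inv σ' ∧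
      σ'.reg 15 = (p.ctx bits X N d r A B).guesses ∧ σ'.reg 9 = 0 ∧
      σ'.reg 8 = (p.ctx bits X N d r A B).S := by
  have hX : 8 * (X * X) < 2 ^ bits := hc.hX
  have hX1 : 5 ≤ X := hc.X_ge
  have hXX : 5 * X ≤ X * X := Nat.mul_le_mul_right _ hX1
  have hNX : N + r ^ p.z ≤ X := hc.N_le
  have hr1 : 1 ≤ r := hc.r_pos
  have hdX : d ≤ X := (Nat.lt_two_pow_self).le.trans hc.d_le
  have hSX : (N + 1) ^ p.s ≤ X := hc.S_le
  have hF₁ : p.C * r ^ p.f₁ ≤ X := hc.F₁_le.trans hSX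
  have hF₂ : p.C * r ^ p.f₂ ≤ X := hc.F₂_le.trans hSX
  have hF₁' : r ^ p.f₁ ≤ p.C * r ^ p.f₁ := Nat.le_mul_of_pos_left _ hC
  have hF₂' : r ^ p.f₂ ≤ p.C * r ^ p.f₂ := Nat.le_mul_of_pos_left _ hC
  have hC' : p.C ≤ p.C * r ^ p.f₁ := Nat.le_mul_of_pos_right _ (pow_pos hr1 _)
  have hU' : r ^ 3 * (d + 1) * (N / r ^ p.z + 1) ≤ X := hU
  have hU1 : r ^ 3 * (d + 1) ≤ r ^ 3 * (d + 1) * (N / r ^ p.z + 1) :=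
    Nat.le_mul_of_pos_right _ (Nat.succ_pos _)
  have hU2 : r ^ 3 ≤ r ^ 3 * (d + 1) := Nat.le_mul_of_pos_right _ (Nat.succ_pos _)
  have hdiv : N / r ^ p.z ≤ N := Nat.div_le_self _ _
  refine run_seq ((root_spec hZ h0 h25 hr hN (by omega)).mono ?_)
  rintro t₁ σ₁ ⟨ht₁, hT₁, e2⟩
  have e0 : σ₁.reg 0 = N := by rw [hT₁.2 _ (by decide), h0]
  have e1 : σ₁.reg 1 = d := by rw [hT₁.2 _ (by decide), h1]
  have e9 : σ₁.reg 9 = 0 := by rw [hT₁.2 _ (by decide), h9]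
  have e25 : σ₁.reg rOne = 1 := by rw [hT₁.2 _ (by decide), h25]
  have e26 : σ₁.reg rTwo = 2 := by rw [hT₁.2 _ (by decide), h26]
  refine run_seq (run_power (by decide) e2 hr1 (by omega) (run_seq (run_op ?_
    (run_seq (run_power (x := N + 1) (by decide) ?_ (by omega) (by omega) ?_)))))
  · simp only [BinOp.eval, State.setReg_reg, Nat.reduceEqDiff, if_false, e0, e25]; omega
  · simp only [BinOp.eval, State.setReg_reg, Nat.reduceEqDiff, if_true, if_false, e0, e25]
  refine run_seq (run_power (x := r) (by decide) ?_ hr1 (by omega) ?_)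
  · simp only [BinOp.eval, State.setReg_reg, Nat.reduceEqDiff, if_false, e2]
  simp only [run_seq_iff, run_const_iff, run_op_iff]
  refine ⟨by omega, ?_, run_power (x := r) (by decide) ?_ hr1 (by omega) ?_⟩
  · simp only [BinOp.eval, State.setReg_reg, Nat.reduceEqDiff, if_true, if_false]; omega
  · simp only [BinOp.eval, State.setReg_reg, Nat.reduceEqDiff, if_true, if_false, e2]
  simp only [BinOp.eval, State.setReg_reg, Nat.reduceEqDiff, if_true, if_false, e0, e1, e25]
  refine ⟨by omega, by omega, by omega, by omega,
    run_power (x := r) (by decide) ?_ hr1 (by omega) ?_⟩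
  · simp only [State.setReg_reg, Nat.reduceEqDiff, if_false, e2]
  simp only [State.setReg_reg, Nat.reduceEqDiff, if_true, if_false]
  refine ⟨by omega, by omega, run_copy ?_ ?_⟩
  · simp only [State.setReg_reg, Nat.reduceEqDiff, if_true, if_false]; omega
  simp only [State.setReg_reg, Nat.reduceEqDiff, if_true, if_false]
  generalize hs₂ : State.setReg _ 8 _ = s₂
  have hT₂ : Touches [3, 4, 8, 14, 15, 27, 28, 29, 40, 41] σ₁ s₂ := by
    rw [← hs₂]
    iterate 15 refine Touches.setReg ?_ (by decide)
    exact .refl _ _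
  have hmem₂ : ∀ b i, s₂.mem (b + 2) i = 0 := by
    intro b i; rw [hT₂.1, hT₁.1, hmem]
  have e8 : s₂.reg 8 = (N + 1) ^ p.s := by rw [← hs₂]; rfl
  refine ⟨by omega, ?_, rfl, e9, rfl⟩
  exact {
    N := by rw [hT₂.2 _ (by decide), e0]; rfl
    d := by rw [hT₂.2 _ (by decide), e1]; rfl
    r := by rw [hT₂.2 _ (by decide), e2]; rfl
    n := by rw [← hs₂]; rfl
    S := by rw [← hs₂]; rfl
    G := by rw [← hs₂]; rfl
    one := by rw [hT₂.2 _ (by decide), e25]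
    two := by rw [hT₂.2 _ (by decide), e26]
    F₁ := by rw [← hs₂]; rfl
    F₂ := by rw [← hs₂]; rfl
    d1 := by rw [← hs₂]; rfl
    A := by rw [hT₂.1, hT₁.1, hA]; rfl
    B := by rw [hT₂.1, hT₁.1, hB]; rfl
    mem_le := fun b i => by rw [hmem₂]; exact Nat.zero_le _
    fresh := fun b i _ => hmem₂ b i
    blank := fun b i _ => hmem₂ b i
    free := by rw [e8]; exact le_rfl
    reg_lt := fun x _ => by
      have h : ∀ l : List ℕ, (∀ y ∈ l, y < 64) → 64 + x ∉ l := fun l hl h => by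
        have := hl _ h; omega
      rw [hT₂.2 _ (h _ (by decide)), hT₁.2 _ (h _ (by decide)), hreg _ (by omega)]
      exact pow_pos (Nat.succ_pos N) _ }

/-! ### Brute force -/

/-- Test all pairs of vectors. -/
def bruteForce : Prog :=
  .seq (.op .mul 16 0 0) <| .seq (.countdown 16 <|
    .seq (.op .div 30 16 0) <| .seq (.op .mod 31 16 0) <| .seq (.op .mul 30 30 1) <|
    .seq (.op .mul 31 31 1) <| .seq (.copy 33 1) <| .seq (.const 34 0) <| .seq dot <|
    .cond 34 .skip (.const 9 1)) (.copy 0 9)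

lemma bruteForce_spec {bits X N d : ℕ} {A B : ℕ → ℕ} {σ : State} (hX : 8 * (X * X) < 2 ^ bits)
    (hNX : N ≤ X) (hdX : d ≤ X) (hX1 : 1 ≤ X) (h0 : σ.reg 0 = N) (h1 : σ.reg 1 = d)
    (hA : σ.mem 0 = A) (hB : σ.mem 1 = B) (hA1 : ∀ i, A i ≤ 1) (hB1 : ∀ i, B i ≤ 1)
    (h25 : σ.reg rOne = 1) (h9 : σ.reg 9 = 0) :
    Run bits bruteForce σ fun t σ' => t ≤ N * N * (d * 8 + 9 + 2) + 3 ∧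
      (σ'.reg 0 = 0 ∨ σ'.reg 0 = 1 ∧ ∃ i < N, ∃ j < N,
        ∑ x ∈ Finset.range d, A (i * d + x) * B (j * d + x) = 0) ∧
      ((∃ i < N, ∃ j < N, ∑ x ∈ Finset.range d, A (i * d + x) * B (j * d + x) = 0) →
        σ'.reg 0 = 1) := by
  have hXX : X ≤ X * X := Nat.le_mul_of_pos_left _ hX1
  have hNN : N * N ≤ X * X := Nat.mul_le_mul hNX hNX
  refine run_seq (run_op ?_ ?_)
  · simp only [BinOp.eval, h0]; omega
  simp only [BinOp.eval, h0]
  refine run_seq ((run_countdown (T := d * 8 + 9) (fun u σ' => σ'.reg 16 = u ∧ u ≤ N * N ∧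
    Touches [9, 16, 30, 31, 33, 34, 35, 36, 37, 38] σ σ' ∧
    (σ'.reg 9 = 0 ∨ σ'.reg 9 = 1 ∧ ∃ i < N, ∃ j < N,
        ∑ x ∈ Finset.range d, A (i * d + x) * B (j * d + x) = 0) ∧
    ∀ u', u ≤ u' → u' < N * N →
      ∑ x ∈ Finset.range d, A (u' / N * d + x) * B (u' % N * d + x) = 0 → σ'.reg 9 = 1)
    ?_ (by norm_num) ?_ (N * N) _ (by omega) ?_).mono ?_)
  · rintro u σ' ⟨h, _, hT, _⟩
    exact ⟨h, by rw [hT.2 _ (by decide), h25]⟩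
  · rintro u σ' - ⟨_, huN, hT, hor, hfound⟩
    have hN0 : 0 < N := by
      rcases Nat.eq_zero_or_pos N with rfl | h
      · omega
      · exact h
    have hi : u / N < N := Nat.div_lt_of_lt_mul (by omega)
    have hj : u % N < N := Nat.mod_lt _ hN0
    have hid : u / N * d ≤ X * X := Nat.mul_le_mul (by omega) hdX
    have hjd : u % N * d ≤ X * X := Nat.mul_le_mul (by omega) hdX
    have e0 : σ'.reg 0 = N := by rw [hT.2 _ (by decide), h0]
    have e1 : σ'.reg 1 = d := by rw [hT.2 _ (by decide), h1]
    simp only [run_seq_iff, run_op_iff, run_copy_iff, run_const_iff, State.setReg_reg, BinOp.eval]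
    simp only [Nat.reduceEqDiff, if_true, if_false, e0, e1]
    refine ⟨by omega, by omega, by omega, by omega, by omega, by omega, ?_⟩
    generalize hs₁ : State.setReg _ 34 _ = s₁
    have hT₁ : Touches [9, 16, 30, 31, 33, 34, 35, 36, 37, 38] σ s₁ := by
      rw [← hs₁]
      iterate 7 refine Touches.setReg ?_ (by decide)
      exact hT
    have e30 : s₁.reg 30 = u / N * d := by rw [← hs₁]; rfl
    have e31 : s₁.reg 31 = u % N * d := by rw [← hs₁]; rfl
    have e33 : s₁.reg 33 = d := by rw [← hs₁]; rfl
    have e34 : s₁.reg 34 = 0 := by rw [← hs₁]; rfl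
    have e16 : s₁.reg 16 = u := by rw [← hs₁]; rfl
    refine (dot_spec hX hX1 (by rw [hT₁.2 _ (by decide), h25]) (by rw [hT₁.1, hA]; exact hA1)
      (by rw [hT₁.1, hB]; exact hB1) e33 e34 (by omega) (by omega) hdX).mono ?_
    rintro t s₂ ⟨ht, hT₂', hsum⟩
    rw [e30, e31, hT₁.1, hA, hB] at hsum
    have hT₂ := hT₁.trans (hT₂'.mono (by decide))
    have e9 : s₂.reg 9 = σ'.reg 9 := by
      rw [hT₂'.2 _ (by decide), ← hs₁]
      simp only [State.setReg_reg, Nat.reduceEqDiff, if_false]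
    have e16' : s₂.reg 16 = u := by rw [hT₂'.2 _ (by decide), e16]
    refine run_cond (fun h34 => run_skip ?_) (fun h34 => run_const (by omega) ?_)
    · refine ⟨by omega, e16', by omega, hT₂, by rwa [e9], fun u' hu' hu'N ho => ?_⟩
      rw [e9]
      rcases Nat.lt_or_ge u u' with hlt | hge
      · exact hfound u' hlt hu'N ho
      · obtain rfl : u = u' := by omega
        exact absurd (hsum.trans ho) h34
    · exact ⟨by omega, by rw [State.setReg_reg, if_neg (by decide), e16'], by omega,
        hT₂.setReg (by decide),
        .inr ⟨by simp [State.setReg_reg], _, hi, _, hj, hsum.symm.trans h34⟩,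
        fun u' _ _ _ => by simp [State.setReg_reg]⟩
  · refine ⟨by rw [State.setReg_reg, if_pos rfl], le_rfl, (Touches.refl _ _).setReg (by decide),
      .inl ?_, fun u' h h' => by omega⟩
    rw [State.setReg_reg, if_neg (by decide), h9]
  · rintro t σ' ⟨ht, _, _, hT, hor, hfound⟩
    refine run_copy ?_ ⟨by omega, ?_, ?_⟩
    · rcases hor with h | h <;> omega
    · rw [State.setReg_reg, if_pos rfl]; exact hor
    · rintro ⟨i, hi, j, hj, ho⟩
      rw [State.setReg_reg, if_pos rfl]
      have hlt : i * N + j < N * N := by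
        calc i * N + j < (i + 1) * N := by rw [Nat.succ_mul]; omega
          _ ≤ N * N := Nat.mul_le_mul_right _ hi
      refine hfound (i * N + j) (Nat.zero_le _) hlt ?_
      have h1 : (i * N + j) / N = i := by
        rw [mul_comm, Nat.mul_add_div (by omega), Nat.div_eq_of_lt hj, add_zero]
      have h2 : (i * N + j) % N = j := by
        rw [mul_comm, Nat.mul_add_mod, Nat.mod_eq_of_lt hj]
      rw [h1, h2]; exact ho

/-! ### The program of the reduction -/

lemma table_apply {n m : ℕ} (f : Fin n → Fin m → ℕ) (i : Fin n) (j : Fin m) :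
    table f (i * m + j) = f i j := by
  have hm : 0 < m := j.pos
  have h1 : (i * m + j : ℕ) / m = i := by
    rw [mul_comm, Nat.mul_add_div hm, Nat.div_eq_of_lt j.2, add_zero]
  have h2 : (i * m + j : ℕ) % m = j := by
    rw [mul_comm, Nat.mul_add_mod, Nat.mod_eq_of_lt j.2]
  simp only [table, h1, h2]
  rw [dif_pos ⟨i.2, j.2⟩]

/-- The table of the entries of the vectors `A i`. -/
def vectorTable {N d : ℕ} (A : Fin N → Fin d → Bool) : ℕ → ℕ := table fun i j => (A i j).toNat

lemma vectorTable_le {N d : ℕ} (A : Fin N → Fin d → Bool) (i : ℕ) : vectorTable A i ≤ 1 := by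
  unfold vectorTable table
  split_ifs
  · exact Bool.toNat_le _
  · exact Nat.zero_le _

lemma sum_vectorTable {N d : ℕ} (A B : Fin N → Fin d → Bool) (i j : Fin N) :
    ∑ x ∈ Finset.range d, vectorTable A (i * d + x) * vectorTable B (j * d + x) =
      ∑ l, (A i l).toNat * (B j l).toNat := by
  rw [Finset.sum_range]
  exact Finset.sum_congr rfl fun x _ => by simp only [vectorTable, table_apply]

lemma hasOrthogonalPair_iff {N d : ℕ} (A B : Fin N → Fin d → Bool) :
    HasOrthogonalPair A B ↔ ∃ i < N, ∃ j < N,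
      ∑ x ∈ Finset.range d, vectorTable A (i * d + x) * vectorTable B (j * d + x) = 0 := by
  constructor
  · rintro ⟨i, j, h⟩
    exact ⟨i, i.2, j, j.2, (sum_vectorTable A B i j).trans h⟩
  · rintro ⟨i, hi, j, hj, h⟩
    exact ⟨⟨i, hi⟩, ⟨j, hj⟩, (sum_vectorTable A B ⟨i, hi⟩ ⟨j, hj⟩).symm.trans h⟩

/-- Decide whether there is an orthogonal pair: by brute force for less than `N₀` vectors, and
otherwise with the data structure given by `pre` and `qry`. -/
def reduction (p : Params) (N₀ : ℕ) (pre qry : Prog) : Prog :=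
  .seq (.const rOne 1) <| .seq (.const rTwo 2) <| .seq (.const 40 N₀) <| .seq (.op .lt 41 0 40) <|
    .cond 41 bruteForce (.seq (initialise p) (guessLoop p.R pre qry))

lemma reduction_spec_of_lt {p : Params} {N₀ bits X N d : ℕ} {pre qry : Prog}
    (hX : 8 * (X * X) < 2 ^ bits) (hX2 : 2 ≤ X) (hN₀ : N₀ ≤ X) (hdX : d ≤ X) (hN : N < N₀)
    (A B : Fin N → Fin d → Bool) :
    Run bits (reduction p N₀ pre qry) (ovInput A B) fun t s =>
      t ≤ N * N * (d * 8 + 9 + 2) + 8 ∧ (HasOrthogonalPair A B → s.reg 0 = 1) ∧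
      (¬ HasOrthogonalPair A B → s.reg 0 = 0) := by
  have hXX : 2 * X ≤ X * X := Nat.mul_le_mul_right _ hX2
  refine run_seq (run_const (by omega) (run_seq (run_const (by omega) (run_seq (run_const (by omega)
    (run_seq (run_op (ite_lt (by omega)) ?_)))))))
  refine run_cond (fun _ => ?_) fun h => absurd h ?_
  · refine (bruteForce_spec (N := N) (A := vectorTable A) (B := vectorTable B) hX (by omega) hdX
      (by omega) rfl rfl rfl rfl (vectorTable_le A) (vectorTable_le B) rfl rfl).mono ?_
    rintro t s ⟨ht, hor, hfound⟩
    rw [hasOrthogonalPair_iff]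
    refine ⟨by omega, hfound, fun h => ?_⟩
    rcases hor with h' | ⟨_, h'⟩
    · exact h'
    · exact absurd h' h
  · have : (ovInput A B).reg 0 = N := rfl
    simp [State.setReg_reg, BinOp.eval, this, hN]

lemma reduction_spec_of_le {p : Params} {N₀ bits X N d r : ℕ} {pre qry : Prog}
    (hp : Fits p.R pre) (hq : Fits p.R qry) (A B : Fin N → Fin d → Bool) (hZ : p.Z ≠ 0)
    (hC : 1 ≤ p.C) (hN₀ : N₀ ≤ N) (hr : r ^ p.Z ≤ N) (hN : N < (r + 1) ^ p.Z)
    (hrX : (r + 1) ^ p.Z ≤ X) {c : Ctx}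
    (hc' : c = p.ctx bits X N d r (vectorTable A) (vectorTable B)) (hc : c.Valid)
    (hU : c.S + c.S * (N + 1) * c.guesses ≤ X)
    (hsucc : HasOrthogonalPair A B → ∃ u < c.guesses, c.Succeeds (c.guess u) pre qry) :
    Run bits (reduction p N₀ pre qry) (ovInput A B) fun t s =>
      t ≤ c.guesses * (c.groupTime pre qry + 2) +
        (N * (p.Z + 5 + 2) + p.z + p.s + p.f₁ + p.f₂ + 33) ∧
      (HasOrthogonalPair A B → s.reg 0 = 1) ∧ (¬ HasOrthogonalPair A B → s.reg 0 = 0) := by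
  have hX : 8 * (X * X) < 2 ^ bits := by have := hc.hX; rwa [hc'] at this
  have hX5 : 5 ≤ X := by have := hc.X_ge; rwa [hc'] at this
  have hNX : N ≤ X := by
    have := hc.N_le
    rw [hc'] at this
    exact (Nat.le_add_right _ _).trans this
  have hS8 := hc.S_ge
  have hpow : 0 < 2 ^ c.d := by positivity
  have hXX : 5 * X ≤ X * X := Nat.mul_le_mul_right _ hX5
  have hgX : c.guesses ≤ X := by
    refine le_trans ?_ hU
    refine (Nat.le_mul_of_pos_left c.guesses (?_ : 0 < c.S * (N + 1))).trans (Nat.le_add_left _ _)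
    exact Nat.mul_pos (by omega) (Nat.succ_pos _)
  refine run_seq (run_const (by omega) (run_seq (run_const (by omega) (run_seq (run_const (by omega)
    (run_seq (run_op (ite_lt (by omega)) ?_)))))))
  have e0 : (ovInput A B).reg 0 = N := rfl
  refine run_cond (fun h => absurd ?_ h) fun _ => ?_
  · simp [State.setReg_reg, BinOp.eval, e0, hN₀]
  refine run_seq ((initialise_spec (N := N) (d := d) hZ (hc' ▸ hc) hC (A := vectorTable A)
    (B := vectorTable B) rfl rfl rfl rfl
    (fun b i => rfl) rfl rfl ?_ rfl hr hN hrX (hc' ▸ hgX)).mono ?_)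
  · intro x hx
    simp only [State.setReg_reg, ovInput]
    rw [if_neg (by omega), if_neg (by omega), if_neg (by omega), if_neg (by omega)]
    split <;> first | rfl | omega
  rintro t σ ⟨ht, hσ, h15, h9, h8⟩
  rw [← hc'] at hσ h15 h8
  have hb : bits = c.bits := by rw [hc']; rfl
  have hR : p.R = c.R := by rw [hc']; rfl
  have hN' : N = c.N := by rw [hc']; rfl
  have hX' : X = c.X := by rw [hc']; rfl
  rw [hb, hR]
  rw [hR] at hp hq
  refine (guessLoop_spec hc hp hq hσ h15 (hX' ▸ hgX) h9 ?_).mono ?_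
  · rw [h8, ← hN', ← hX']; exact hU
  rintro t' σ' ⟨ht', hor, hfound⟩
  refine ⟨by omega, fun h => hfound (hsucc h), fun h => ?_⟩
  rcases hor with h' | ⟨_, h'⟩
  · exact h'
  · rw [hasOrthogonalPair_iff] at h
    rw [hc'] at h'
    exact absurd h' h

/-! ### A correct guess succeeds -/

lemma pattern_succ' (bit : ℕ → ℕ) : ∀ (c pos : ℕ),
    pattern bit pos (c + 1) = bit pos + 2 * pattern bit (pos + 1) c
  | 0, pos => by simp [pattern]
  | c + 1, pos => by
    rw [pattern, pattern_succ' bit c pos, pattern, pow_succ]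
    have e : pos + (c + 1) = pos + 1 + c := by omega
    rw [e]; ring

lemma collisions_pattern {x y : ℕ → ℕ} (hy : ∀ i, y i ≤ 1) : ∀ (c pos : ℕ),
    collisions x c pos (pattern y pos c) = ∑ t ∈ Finset.range c, x (pos + t) * y (pos + t)
  | 0, pos => rfl
  | c + 1, pos => by
    have h := hy pos
    have h1 : pattern y pos (c + 1) % 2 = y pos := by rw [pattern_succ']; omega
    have h2 : pattern y pos (c + 1) / 2 = pattern y (pos + 1) c := by rw [pattern_succ']; omega
    rw [collisions, h1, h2, collisions_pattern hy, Finset.sum_range_succ', add_comm]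
    simp only [add_zero]
    congr 1
    exact Finset.sum_congr rfl fun t _ => by rw [Nat.add_assoc, Nat.add_comm 1 t]

lemma collisions_zero (x : ℕ → ℕ) : ∀ (c pos : ℕ), collisions x c pos 0 = 0
  | 0, _ => rfl
  | c + 1, pos => by rw [collisions, Nat.zero_div, collisions_zero x c]; simp

lemma collisions_two_pow (x : ℕ → ℕ) : ∀ (c pos t : ℕ), t < c →
    collisions x c pos (2 ^ t) = x (pos + t)
  | c + 1, pos, 0, _ => by rw [collisions]; simp [collisions_zero]
  | c + 1, pos, t + 1, h => by
    have h1 : 2 ^ (t + 1) % 2 = 0 := by rw [pow_succ, Nat.mul_mod_left]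
    have h2 : 2 ^ (t + 1) / 2 = 2 ^ t := by rw [pow_succ, Nat.mul_div_cancel _ (by norm_num)]
    rw [collisions, h1, h2, collisions_two_pow x c (pos + 1) t (by omega), mul_zero, zero_add,
      Nat.add_assoc, Nat.add_comm 1 t]

lemma rowBit_vectorTable {N d : ℕ} (A : Fin N → Fin d → Bool) (i : Fin N) (x : Fin d) :
    rowBit (vectorTable A) d (i * d) x = (A i x).toNat := by
  rw [rowBit, if_pos x.2, mul_one, vectorTable, table_apply]

lemma annInput_eq (n m k : ℕ) (w : ℕ → ℕ) (f : ℕ → ℕ → ℕ) (hw : ∀ i, w i = f (i / m) (i % m)) :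
    annInput k (fun i : Fin n => natCurve m (f i)) 1 = inputState n m k w := by
  have hiff : ∀ i, (i / m < n ∧ i % m < m) ↔ i < n * m := by
    intro i
    rcases Nat.eq_zero_or_pos m with rfl | hm
    · simp
    · rw [Nat.div_lt_iff_lt_mul hm]
      exact ⟨fun h => h.1, fun h => ⟨h, Nat.mod_lt _ hm⟩⟩
  ext x
  · simp only [annInput, inputState, inputReg]
    split <;> simp_all
  · rename_i i
    have hnum : ∀ v : ℕ, (-(v : ℤ)).toNat = 0 := by intro v; omega
    simp only [annInput, inputState]
    split
    · simp only [table, natCurve, hiff, hw]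
      by_cases h : i < n * m <;> simp [h]
    · simp only [table, natCurve, hiff]
      simp [hnum]
    · simp only [table, natCurve, hiff]
      by_cases h : i < n * m <;> simp [h]
    · rename_i h0 h1 h2
      rw [if_neg]
      rintro ⟨h | h, _⟩
      · exact h0 h
      · exact h2 h

lemma withQuery_eq (s : State) (k : ℕ) (w : ℕ → ℕ) :
    withQuery s (natCurve k w) = queryState s k w := by
  have hnum : ∀ v : ℕ, (-(v : ℤ)).toNat = 0 := by intro v; omega
  ext x
  · rfl
  · rename_i i
    simp only [withQuery, queryState, natCurve]
    by_cases h : i < k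
    · simp only [h, dif_pos, if_true]
      split <;> simp_all
    · simp only [h, dif_neg, not_false_iff, if_false]

lemma ratBounded_natCast {M v : ℕ} (hv : v ≤ M) (hM : 1 ≤ M) : RatBounded M (v : ℚ) := by
  constructor <;> simpa

/-- The location that the query curve visits in the block `b` is marked by the curve of
a vector if and only if the vectors have a common one in this block. -/
lemma collisions_location {x y : ℕ → ℕ} (hy : ∀ i, y i ≤ 1) (b l : ℕ) :
    collisions x l ((b * 2 ^ l + pattern y (b * l) l) / 2 ^ l * l)
      ((b * 2 ^ l + pattern y (b * l) l) % 2 ^ l) =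
      ∑ t ∈ Finset.range l, x (b * l + t) * y (b * l + t) := by
  have hlt := pattern_lt hy (b * l) l
  have h1 : (b * 2 ^ l + pattern y (b * l) l) / 2 ^ l = b := by
    rw [mul_comm, Nat.mul_add_div (by positivity), Nat.div_eq_of_lt hlt, add_zero]
  have h2 : (b * 2 ^ l + pattern y (b * l) l) % 2 ^ l = pattern y (b * l) l := by
    rw [mul_comm, Nat.mul_add_mod, Nat.mod_eq_of_lt hlt]
  rw [h1, h2, collisions_pattern hy]

/-- Two vectors of length `d` are orthogonal if they have no common one in any of the blocks. -/
lemma sum_rowBit_eq_zero_iff {A B : ℕ → ℕ} {d a a' l K : ℕ} (hd : d ≤ K * l) :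
    (∀ b < K, ∑ t ∈ Finset.range l, rowBit A d a (b * l + t) * rowBit B d a' (b * l + t) = 0) ↔
      ∑ x ∈ Finset.range d, A (a + x) * B (a' + x) = 0 := by
  simp only [Finset.sum_eq_zero_iff, Finset.mem_range]
  constructor
  · intro h x hx
    have hl : 0 < l := by
      rcases Nat.eq_zero_or_pos l with rfl | h
      · omega
      · exact h
    have := h (x / l) (Nat.div_lt_of_lt_mul (by rw [mul_comm]; omega)) (x % l) (Nat.mod_lt _ hl)
    rw [Nat.div_add_mod', rowBit, rowBit, if_pos hx, mul_one, mul_one] at this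
    exact this
  · intro h b _ t _
    rw [rowBit, rowBit]
    split_ifs with hx
    · rw [mul_one, mul_one]; exact h _ hx
    · simp

/-- The guess `g` has the complexities for which the data structure works, with blocks long
enough to cover all coordinates and short enough to leave room for all patterns. -/
structure Guess.Fitting (g : Guess) (n d : ℕ) : Prop where
  k_ge : 4 ≤ g.k
  L_eq : g.L = 2 ^ g.l
  cover : d ≤ (g.k - 2) / 2 * g.l
  room : 2 * ((g.k - 2) / 2 * g.L) + 3 ≤ g.m
  vertex : g.m + 3 ≤ n * g.m

/-- The locations of the blocks, for the query vector `j`. -/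
def location (B : ℕ → ℕ) (d j l L b : ℕ) : ℕ := b * L + pattern (rowBit B d (j * d)) (b * l) l

lemma location_lt {B : ℕ → ℕ} (hB : ∀ i, B i ≤ 1) (d j l b : ℕ) :
    location B d j l (2 ^ l) b < (b + 1) * 2 ^ l := by
  have := pattern_lt (rowBit_le hB d (j * d)) (b * l) l
  rw [location, Nat.succ_mul]; omega

lemma two_mul_location {B : ℕ → ℕ} (hB : ∀ i, B i ≤ 1) {g : Guess} {n d : ℕ} (hg : g.Fitting n d)
    (j b : ℕ) (hb : b < (g.k - 2) / 2) : 2 * location B d j g.l g.L b + 5 ≤ g.m := by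
  have h1 := location_lt hB d j g.l b
  have h2 : (b + 1) * 2 ^ g.l ≤ (g.k - 2) / 2 * 2 ^ g.l := Nat.mul_le_mul_right _ hb
  have h3 := hg.room
  rw [hg.L_eq] at h3 ⊢
  omega

/-- The curve of the vector `i` of a group. -/
def groupCurve (A : ℕ → ℕ) (d : ℕ) (g : Guess) (i : ℕ) : ℕ → ℕ :=
  inputVertex fun q => collisions (rowBit A d ((g.start + i) * d)) g.l (q / g.L * g.l) (q % g.L)

lemma polyDist_le_one {A B : ℕ → ℕ} (hB : ∀ i, B i ≤ 1) {g : Guess} {n d : ℕ}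
    (hg : g.Fitting n d) {i j : ℕ}
    (h : ∑ x ∈ Finset.range d, A ((g.start + i) * d + x) * B (j * d + x) = 0) :
    polyDist (natCurve g.m (groupCurve A d g i))
      (natCurve g.k (queryVertex (location B d j g.l g.L) g.k g.m)) ≤ 1 := by
  refine polyDist_gadget_le hg.k_ge (fun b _ => ?_) (two_mul_location hB hg j) fun b hb => ?_
  · have h1 := location_lt hB d j g.l b
    rw [← hg.L_eq] at h1
    exact h1.trans_le (Nat.le_add_right _ _)
  · rw [location, hg.L_eq, collisions_location (rowBit_le hB d _)]
    exact (sum_rowBit_eq_zero_iff hg.cover).mpr h b hb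

lemma two_le_polyDist {A B : ℕ → ℕ} (hB : ∀ i, B i ≤ 1) {g : Guess} {n d : ℕ}
    (hg : g.Fitting n d) {i j : ℕ}
    (h : ∑ x ∈ Finset.range d, A ((g.start + i) * d + x) * B (j * d + x) ≠ 0) :
    2 ≤ polyDist (natCurve g.m (groupCurve A d g i))
      (natCurve g.k (queryVertex (location B d j g.l g.L) g.k g.m)) := by
  rw [Ne, ← sum_rowBit_eq_zero_iff hg.cover] at h
  push Not at h
  obtain ⟨b, hb, hne⟩ := h
  refine le_polyDist_gadget hb (two_mul_location hB hg j b hb) ?_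
  rwa [location, hg.L_eq, collisions_location (rowBit_le hB d _)]

/-- A coordinate of the vector can be read off from its curve. -/
lemma groupCurve_injective {N d n : ℕ} {A : Fin N → Fin d → Bool} (hA : Function.Injective A)
    {g : Guess} (hg : g.Fitting n d) (hst : g.start + n ≤ N) :
    Function.Injective fun i : Fin n => natCurve g.m (groupCurve (vectorTable A) d g i) := by
  intro i i' h
  have hrow : (⟨g.start + i, by omega⟩ : Fin N) = ⟨g.start + i', by omega⟩ := by
    refine hA (funext fun x => ?_)
    have hcover := hg.cover
    have hroom := hg.room
    have hx := x.2
    have hl : 0 < g.l := by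
      rcases Nat.eq_zero_or_pos g.l with h | h
      · rw [h] at hcover; omega
      · exact h
    have hdiv : x / g.l < (g.k - 2) / 2 := Nat.div_lt_of_lt_mul (by rw [mul_comm]; omega)
    have hmod : x % g.l < g.l := Nat.mod_lt _ hl
    have hpow : 2 ^ (x % g.l) < 2 ^ g.l := Nat.pow_lt_pow_right (by norm_num) hmod
    set q := (x / g.l) * g.L + 2 ^ (x % g.l) with hq
    have hq1 : q / g.L = x / g.l := by
      rw [hq, hg.L_eq, mul_comm, Nat.mul_add_div (by positivity), Nat.div_eq_of_lt hpow, add_zero]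
    have hq2 : q % g.L = 2 ^ (x % g.l) := by
      rw [hq, hg.L_eq, mul_comm, Nat.mul_add_mod, Nat.mod_eq_of_lt hpow]
    have hqm : 2 * q + 2 < g.m := by
      have h2 : (x / g.l + 1) * g.L ≤ (g.k - 2) / 2 * g.L := Nat.mul_le_mul_right _ hdiv
      rw [Nat.succ_mul] at h2
      rw [hg.L_eq] at h2 hroom hq
      omega
    have hv : groupCurve (vectorTable A) d g i (2 * q + 2) =
        groupCurve (vectorTable A) d g i' (2 * q + 2) := by
      have := congrFun h ⟨2 * q + 2, hqm⟩
      simpa [natCurve] using this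
    have e1 : q + 1 - 1 = q := by omega
    have e2 : (2 * q + 2) / 2 = q + 1 := by omega
    have e3 : (2 * q + 2) % 2 = 0 := by omega
    simp only [groupCurve, inputVertex, e1, e2, e3, hq1, hq2, if_true,
      collisions_two_pow _ _ _ _ hmod, Nat.div_add_mod'] at hv
    have h1 := rowBit_vectorTable A ⟨g.start + i, by omega⟩ x
    have h2 := rowBit_vectorTable A ⟨g.start + i', by omega⟩ x
    simp only at h1 h2
    rw [h1, h2] at hv
    revert hv
    cases A ⟨g.start + i, by omega⟩ x <;> cases A ⟨g.start + i', by omega⟩ x <;> simp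
  have := congrArg Fin.val hrow
  exact Fin.ext (by simpa using this)

lemma groupCurve_le {A : ℕ → ℕ} {d : ℕ} {g : Guess} {i v : ℕ} (hv : v < g.m) :
    groupCurve A d g i v ≤ g.m + 3 := by
  have := inputVertex_le (fun q => collisions (rowBit A d ((g.start + i) * d)) g.l (q / g.L * g.l)
    (q % g.L)) v
  rw [groupCurve]; omega

lemma queryVertex_le {B : ℕ → ℕ} (hB : ∀ i, B i ≤ 1) {g : Guess} {n d : ℕ} (hg : g.Fitting n d)
    (j v : ℕ) (hv : v < g.k) : queryVertex (location B d j g.l g.L) g.k g.m v ≤ g.m + 3 := by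
  have hk := hg.k_ge
  have hroom := hg.room
  rw [queryVertex]
  split_ifs with h1 h2 h3
  · omega
  · omega
  · have := two_mul_location hB hg j ((v - g.k % 2 - 1) / 2) (by omega)
    omega
  · have := two_mul_location hB hg j ((v - g.k % 2 - 1) / 2) (by omega)
    omega

/-- If the guess `g` is right for the data structure, and there is an orthogonal pair in its group,
then it is found. -/
theorem succeeds_of_solvesANN {c : Ctx} {A B : Fin c.N → Fin c.d → Bool} {g : Guess}
    {pre qry : Prog} {w e : ℕ} {ε T₁ T₂ : ℝ}
    (hann : SolvesANN pre qry w e (2 - ε) c.n g.m g.k T₁ T₂) (hε : 0 < ε)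
    (he : 1 ≤ e) (hg : g.Fitting c.n c.d) (hA : c.A = vectorTable A) (hB : c.B = vectorTable B)
    (hinj : Function.Injective A) (hst : g.start + c.n ≤ c.N) (hT₁ : T₁ < c.F₁) (hT₂ : T₂ < c.F₂)
    (hS : 2 ^ wordBits w (c.n * g.m) ≤ c.S) {i j : ℕ} (hi : i < c.n) (hj : j < c.N)
    (ho : c.Orth (g.start + i) j) : c.Succeeds g pre qry := by
  have hB1 : ∀ i, c.B i ≤ 1 := by rw [hB]; exact vectorTable_le B
  have hM1 : 1 ≤ c.n * g.m := by have := hg.vertex; omega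
  have hMe : c.n * g.m ≤ (c.n * g.m) ^ e := Nat.le_self_pow (by omega) _
  have hM : g.m + 3 ≤ (c.n * g.m) ^ e := hg.vertex.trans hMe
  obtain ⟨t₁, s₁, hex₁, ht₁, hquery⟩ := hann
    (fun i => natCurve g.m (groupCurve c.A c.d g i)) 1 (hA ▸ groupCurve_injective hinj hg hst)
    (fun i v => ratBounded_natCast ((groupCurve_le v.2).trans hM) (hM1.trans hMe)) one_pos
    (by simpa using ratBounded_natCast (v := 1) (hM1.trans hMe) (hM1.trans hMe))
  rw [annInput_eq c.n g.m g.k (inputWord c.A c.d g.start g.m g.l g.L) _ fun i => rfl] at hex₁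
  refine ⟨_, t₁, s₁, hS, hex₁, by exact_mod_cast ht₁.trans_lt hT₁, j, hj, ?_⟩
  obtain ⟨t₂, s₂, ans, hex₂, ht₂, hans, hlegal⟩ := hquery
    (natCurve g.k (queryVertex (location c.B c.d j g.l g.L) g.k g.m))
    (fun v => ratBounded_natCast ((queryVertex_le hB1 hg j v v.2).trans hM) (hM1.trans hMe))
  have hle : polyDist (natCurve g.m (groupCurve c.A c.d g i))
      (natCurve g.k (queryVertex (location c.B c.d j g.l g.L) g.k g.m)) ≤ ((1 : ℚ) : ℝ) := by
    rw [Rat.cast_one]; exact polyDist_le_one hB1 hg ho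
  obtain ⟨i', rfl, hi'⟩ := hlegal.1 ⟨⟨i, hi⟩, hle⟩
  rw [withQuery_eq] at hex₂
  refine ⟨_, t₂, s₂, i', hS, hex₂, by exact_mod_cast ht₂.trans_lt hT₂, hans, i'.2, ?_⟩
  by_contra hne
  have h2 := two_le_polyDist hB1 hg hne
  rw [Rat.cast_one, mul_one] at hi'
  linarith

end WordRAM

/-! ### Asymptotics of the parameters -/

open Filter Asymptotics in
/-- For large `r`, the complexity `m` of the input curves is large enough for the gadgets, and still
less than `r`. -/
lemma eventually_parameters {c₀ : ℝ} (hc₀ : 0 < c₀) {z Z : ℕ} (hz : 1 ≤ z) (hZ : 1 ≤ Z) {k : ℕ → ℕ}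
    (hk : Tendsto k atTop atTop)
    (hlog : (fun n : ℕ => (k n : ℝ)) =o[atTop] (fun n : ℕ => Real.log (n : ℝ))) :
    ∀ᶠ r : ℕ in atTop, 6 ≤ k (r ^ z) ∧
      inputComplexity (8 * c₀ * Z / z + 1) (r ^ z) (k (r ^ z)) < r ∧
      ∀ N d l : ℕ, N < (r + 1) ^ Z → d = ⌈c₀ * Real.log N⌉₊ →
        l = (d + (k (r ^ z) - 2) / 2 - 1) / ((k (r ^ z) - 2) / 2) →
        d + 1 ≤ r ∧ 2 * ((k (r ^ z) - 2) / 2 * 2 ^ l) + 3 ≤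
          inputComplexity (8 * c₀ * Z / z + 1) (r ^ z) (k (r ^ z)) := by
  set c := 8 * c₀ * Z / z + 1 with hc
  have hz' : (0 : ℝ) < z := by exact_mod_cast hz
  have hZ' : (0 : ℝ) < Z := by exact_mod_cast hZ
  have hc0 : 0 < c := by positivity
  have hpow : Tendsto (fun r : ℕ => r ^ z) atTop atTop := tendsto_pow_atTop (by omega)
  have hlogr : ∀ δ : ℝ, 0 < δ → ∀ᶠ r : ℕ in atTop, Real.log r ≤ δ * (r : ℝ) ^ (1 / 2 : ℝ) := by
    intro δ hδ
    have := (isLittleO_log_rpow_atTop (r := 1 / 2) (by norm_num)).comp_tendsto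
      tendsto_natCast_atTop_atTop
    filter_upwards [this.def hδ] with r hr
    simp only [Function.comp, Real.norm_eq_abs] at hr
    rw [abs_of_nonneg (by positivity : (0 : ℝ) ≤ (r : ℝ) ^ (1 / 2 : ℝ))] at hr
    exact (le_abs_self _).trans hr
  filter_upwards [(hk.comp hpow).eventually_ge_atTop 6,
    (hk.comp hpow).eventually_ge_atTop ⌈2 * c * z⌉₊,
    hpow.eventually (hlog.def (c := 1 / 2) (by norm_num)), hlogr (1 / (4 * z)) (by positivity),
    hlogr (1 / (8 * c₀ * Z)) (by positivity), eventually_ge_atTop 4] with r h6 hkc hkl hr1 hr2 hr4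
  simp only [Function.comp] at h6 hkc
  set K := k (r ^ z) with hK
  have hr4' : (4 : ℝ) ≤ r := by exact_mod_cast hr4
  have hr0 : (0 : ℝ) < r := by linarith
  have h6' : (6 : ℝ) ≤ K := by exact_mod_cast h6
  have hK0 : (0 : ℝ) < K := by linarith
  have hlogr0 : 0 ≤ Real.log r := Real.log_nonneg (by linarith)
  have hlogn : Real.log ((r ^ z : ℕ) : ℝ) = z * Real.log r := by
    rw [Nat.cast_pow, Real.log_pow]
  have hKlog : (K : ℝ) ≤ z * Real.log r / 2 := by
    have : |(K : ℝ)| ≤ 1 / 2 * |Real.log ((r ^ z : ℕ) : ℝ)| := by simpa using hkl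
    rw [hlogn, abs_of_nonneg hK0.le, abs_of_nonneg (by positivity)] at this
    linarith
  have hsqrt : (r : ℝ) ^ (1 / 2 : ℝ) * (r : ℝ) ^ (1 / 2 : ℝ) = r := by
    rw [← Real.rpow_add hr0]; norm_num
  have hsqrt1 : 1 ≤ (r : ℝ) ^ (1 / 2 : ℝ) := Real.one_le_rpow (by linarith) (by norm_num)
  have hsqrtr : (r : ℝ) ^ (1 / 2 : ℝ) ≤ r := by nlinarith
  have hn1 : (1 : ℝ) ≤ ((r ^ z : ℕ) : ℝ) := by exact_mod_cast Nat.one_le_pow _ _ (by omega)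
  have hn0 : (0 : ℝ) < ((r ^ z : ℕ) : ℝ) := by linarith
  refine ⟨h6, ?_, ?_⟩
  · -- `n ^ (c / k) ≤ √r`, since `c / k ≤ 1 / (2 z)`
    have hck : c / K ≤ 1 / (2 * z) := by
      rw [div_le_div_iff₀ hK0 (by positivity)]
      have := Nat.le_of_ceil_le hkc
      linarith
    have h1 : ((r ^ z : ℕ) : ℝ) ^ (c / K) ≤ (r : ℝ) ^ (1 / 2 : ℝ) := by
      calc ((r ^ z : ℕ) : ℝ) ^ (c / K) ≤ ((r ^ z : ℕ) : ℝ) ^ (1 / (2 * z) : ℝ) :=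
            Real.rpow_le_rpow_of_exponent_le hn1 hck
        _ = (r : ℝ) ^ (1 / 2 : ℝ) := by
            rw [Nat.cast_pow, ← Real.rpow_natCast, ← Real.rpow_mul hr0.le]
            congr 1; field_simp
    have h2 : (K : ℝ) * ((r ^ z : ℕ) : ℝ) ^ (c / K) ≤ r / 8 := by
      have hKr : (K : ℝ) ≤ (r : ℝ) ^ (1 / 2 : ℝ) / 8 := by
        have : z * Real.log r ≤ z * (1 / (4 * z) * (r : ℝ) ^ (1 / 2 : ℝ)) := by gcongr
        have e : z * (1 / (4 * z) * (r : ℝ) ^ (1 / 2 : ℝ)) = (r : ℝ) ^ (1 / 2 : ℝ) / 4 := by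
          field_simp
        linarith
      calc (K : ℝ) * ((r ^ z : ℕ) : ℝ) ^ (c / K)
          ≤ ((r : ℝ) ^ (1 / 2 : ℝ) / 8) * (r : ℝ) ^ (1 / 2 : ℝ) := by gcongr
        _ = r / 8 := by rw [div_mul_eq_mul_div, hsqrt]
    have h3 := Nat.ceil_lt_add_one (a := (K : ℝ) * ((r ^ z : ℕ) : ℝ) ^ (c / K)) (by positivity)
    have : ((inputComplexity c (r ^ z) K : ℕ) : ℝ) < r := by
      unfold inputComplexity; linarith
    exact_mod_cast this
  · intro N d l hN hd hl
    have hlogN : Real.log N ≤ 2 * Z * Real.log r := by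
      rcases Nat.eq_zero_or_pos N with rfl | hN0
      · simp only [Nat.cast_zero, Real.log_zero]; positivity
      · have h1 : (N : ℝ) ≤ ((r : ℝ) * r) ^ Z := by
          have h2 : N ≤ (r * r) ^ Z := hN.le.trans (Nat.pow_le_pow_left (by nlinarith) Z)
          exact_mod_cast h2
        calc Real.log N ≤ Real.log (((r : ℝ) * r) ^ Z) :=
              Real.log_le_log (by exact_mod_cast hN0) h1
          _ = 2 * Z * Real.log r := by
              rw [Real.log_pow, Real.log_mul hr0.ne' hr0.ne']; ring
    have hd1 : (d : ℝ) ≤ c₀ * (2 * Z * Real.log r) + 1 := by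
      have h0 : 0 ≤ Real.log N := Real.log_natCast_nonneg N
      have h1 := Nat.ceil_lt_add_one (a := c₀ * Real.log N) (by positivity)
      rw [← hd] at h1
      have : c₀ * Real.log N ≤ c₀ * (2 * Z * Real.log r) := by gcongr
      linarith
    constructor
    · have h1 : c₀ * (2 * Z * Real.log r) ≤ r / 4 := by
        have h2 : c₀ * (2 * Z * Real.log r) ≤
            c₀ * (2 * Z * (1 / (8 * c₀ * Z) * (r : ℝ) ^ (1 / 2 : ℝ))) := by gcongr
        have e : c₀ * (2 * Z * (1 / (8 * c₀ * Z) * (r : ℝ) ^ (1 / 2 : ℝ))) =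
            (r : ℝ) ^ (1 / 2 : ℝ) / 4 := by field_simp; ring
        linarith
      have : (d : ℝ) + 1 ≤ r := by linarith
      exact_mod_cast this
    · set B := (K - 2) / 2 with hB
      have hB1 : K ≤ 4 * B := by omega
      have hB2 : 2 * B ≤ K := by omega
      have hB0 : 0 < B := by omega
      have hlB : B * l ≤ d + B := by
        have := Nat.mul_div_le (d + B - 1) B
        rw [hl]; omega
      have hlB' : (B : ℝ) * l ≤ d + B := by exact_mod_cast hlB
      have hB1' : (K : ℝ) ≤ 4 * B := by exact_mod_cast hB1
      have hB2' : 2 * (B : ℝ) ≤ K := by exact_mod_cast hB2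
      -- the block length is at most `(c - 1) ln n / k + 2`
      have hl1 : (l : ℝ) ≤ (c - 1) / K * (z * Real.log r) + 2 := by
        have e : (c - 1) / K * (z * Real.log r) = 4 / K * (c₀ * (2 * Z * Real.log r)) := by
          rw [hc]; field_simp; ring
        rw [e]
        have hBpos : (0 : ℝ) < B := by exact_mod_cast hB0
        have h1 : (l : ℝ) ≤ d / B + 1 := by
          rw [div_add_one hBpos.ne', le_div_iff₀ hBpos]; linarith
        have h2 : (d : ℝ) / B ≤ 4 / K * d := by
          rw [div_le_iff₀ hBpos, div_mul_eq_mul_div, div_mul_eq_mul_div, le_div_iff₀ hK0]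
          have := mul_le_mul_of_nonneg_left hB1' (Nat.cast_nonneg d : (0 : ℝ) ≤ d)
          linarith
        have h3 : 4 / (K : ℝ) * d ≤ 4 / K * (c₀ * (2 * Z * Real.log r) + 1) := by gcongr
        have h4 : 4 / (K : ℝ) ≤ 1 := by rw [div_le_one hK0]; linarith
        linarith
      have hexp : ∀ a : ℝ, ((r ^ z : ℕ) : ℝ) ^ a = Real.exp (z * Real.log r * a) := by
        intro a; rw [Real.rpow_def_of_pos hn0, hlogn]
      have hL : ((2 : ℝ) ^ l) ≤ 4 * ((r ^ z : ℕ) : ℝ) ^ ((c - 1) / K) := by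
        have hc1 : 0 ≤ c - 1 := by rw [hc, add_sub_cancel_right]; positivity
        have h1 : (0 : ℝ) ≤ (c - 1) / K * (z * Real.log r) := by positivity
        calc (2 : ℝ) ^ l = (2 : ℝ) ^ (l : ℝ) := (Real.rpow_natCast _ _).symm
          _ ≤ (2 : ℝ) ^ ((c - 1) / K * (z * Real.log r) + 2) :=
              Real.rpow_le_rpow_of_exponent_le (by norm_num) hl1
          _ = 4 * (2 : ℝ) ^ ((c - 1) / K * (z * Real.log r)) := by
              rw [Real.rpow_add (by norm_num), mul_comm]; norm_num
          _ ≤ 4 * (Real.exp 1) ^ ((c - 1) / K * (z * Real.log r)) := by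
              have : (2 : ℝ) ≤ Real.exp 1 := by linarith [Real.add_one_le_exp (1 : ℝ)]
              gcongr
          _ = 4 * ((r ^ z : ℕ) : ℝ) ^ ((c - 1) / K) := by
              rw [Real.exp_one_rpow, hexp, mul_comm (z * Real.log r)]
      have h5 : (5 : ℝ) ≤ ((r ^ z : ℕ) : ℝ) ^ (1 / (K : ℝ)) := by
        rw [hexp]
        have h1 : (2 : ℝ) ≤ z * Real.log r * (1 / K) := by
          rw [mul_one_div, le_div_iff₀ hK0]; linarith
        have h2 : Real.exp 1 * Real.exp 1 = Real.exp 2 := by rw [← Real.exp_add]; norm_num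
        have h3 : (2.7 : ℝ) ≤ Real.exp 1 := by linarith [Real.exp_one_gt_d9]
        have h4 : (2.7 : ℝ) * 2.7 ≤ Real.exp 1 * Real.exp 1 := by gcongr
        have h5 := Real.exp_le_exp.mpr h1
        linarith
      have h1 : (1 : ℝ) ≤ ((r ^ z : ℕ) : ℝ) ^ ((c - 1) / K) := by
        refine Real.one_le_rpow hn1 ?_
        rw [hc, add_sub_cancel_right]; positivity
      have hsplit : ((r ^ z : ℕ) : ℝ) ^ (c / K) =
          ((r ^ z : ℕ) : ℝ) ^ ((c - 1) / K) * ((r ^ z : ℕ) : ℝ) ^ (1 / (K : ℝ)) := by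
        rw [← Real.rpow_add hn0]; congr 1; ring
      have hroom : 2 * ((B : ℝ) * 2 ^ l) + 3 ≤ K * ((r ^ z : ℕ) : ℝ) ^ (c / K) := by
        rw [hsplit]
        set y := ((r ^ z : ℕ) : ℝ) ^ ((c - 1) / K)
        have h2 : 2 * ((B : ℝ) * 2 ^ l) ≤ K * (4 * y) := by
          calc 2 * ((B : ℝ) * 2 ^ l) = (2 * B) * 2 ^ l := by ring
            _ ≤ K * (4 * y) := by gcongr
        have h3 : (K : ℝ) * (y * 5) ≤ K * (y * ((r ^ z : ℕ) : ℝ) ^ (1 / (K : ℝ))) := by gcongr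
        have h4 : 6 * 1 ≤ (K : ℝ) * y := by gcongr
        linarith
      have := hroom.trans (Nat.le_ceil _)
      unfold inputComplexity
      exact_mod_cast this

namespace WordRAM

/-! ### Enumeration of the guesses -/

/-- All guesses with parameters in the allowed range are tried, with a group that contains the
vector `i₀`. -/
lemma exists_guess {c : Ctx} (hn : 1 ≤ c.n) (hnN : c.n ≤ c.N) (hG : c.G = c.N / c.n + 1)
    {k m l L i₀ : ℕ} (hk : k < c.r) (hm : m < c.r) (hl : l ≤ c.d) (hL : L < c.r) (hi₀ : i₀ < c.N) :
    ∃ u < c.guesses, ∃ i < c.n, (c.guess u).k = k ∧ (c.guess u).m = m ∧ (c.guess u).l = l ∧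
      (c.guess u).L = L ∧ (c.guess u).start + i = i₀ := by
  set q := i₀ / c.n with hq
  have hqG : q < c.G := by
    rw [hG]
    exact Nat.lt_succ_of_le (Nat.div_le_div_right hi₀.le)
  have digit : ∀ {b x y : ℕ}, x < b → (x + b * y) % b = x ∧ (x + b * y) / b = y := by
    intro b x y h
    rw [Nat.add_mul_mod_self_left, Nat.mod_eq_of_lt h, Nat.add_mul_div_left _ _ (by omega),
      Nat.div_eq_of_lt h, zero_add]
    exact ⟨rfl, rfl⟩
  have bound : ∀ {b x y Y : ℕ}, x < b → y < Y → x + b * y < b * Y := by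
    intro b x y Y hx hy
    calc x + b * y < b * (y + 1) := by rw [Nat.mul_succ]; omega
      _ ≤ b * Y := Nat.mul_le_mul_left _ hy
  have hl' : l < c.d + 1 := by omega
  refine ⟨q + c.G * (k + c.r * (m + c.r * (l + (c.d + 1) * L))), ?_, i₀ - min (q * c.n) (c.N - c.n),
    ?_, ?_⟩
  · have := bound hqG (bound hk (bound hm (bound hl' hL)))
    rw [Ctx.guesses]
    calc _ < c.G * (c.r * (c.r * ((c.d + 1) * c.r))) := this
      _ = c.r ^ 3 * (c.d + 1) * c.G := by ring
  · have h1 := Nat.div_add_mod i₀ c.n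
    have h2 := Nat.mod_lt i₀ hn
    have h3 : q * c.n = c.n * (i₀ / c.n) := mul_comm _ _
    omega
  · simp only [Ctx.guess, (digit hqG).1, (digit hqG).2, (digit hk).1, (digit hk).2, (digit hm).1,
      (digit hm).2, (digit hl').1, (digit hl').2, Nat.mod_eq_of_lt hL, true_and]
    have h1 := Nat.div_mul_le_self i₀ c.n
    rw [← hq] at h1
    split_ifs <;> omega

/-! ### Word length and running time -/

lemma two_pow_dimension_le {c₀ : ℝ} (hc₀ : 0 < c₀) {N : ℕ} (hN : 1 ≤ N) :
    2 ^ ⌈c₀ * Real.log N⌉₊ ≤ (N + 1) ^ (⌈c₀⌉₊ + 1) := by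
  have hN' : (1 : ℝ) ≤ N := by exact_mod_cast hN
  have hlog : 0 ≤ Real.log N := Real.log_nonneg hN'
  have h1 := Nat.ceil_lt_add_one (a := c₀ * Real.log N) (by positivity)
  have h2 : c₀ * Real.log N ≤ ⌈c₀⌉₊ * Real.log N := by gcongr; exact Nat.le_ceil _
  have h3 : (2 : ℝ) ^ ⌈c₀ * Real.log N⌉₊ ≤ 2 * (N : ℝ) ^ ⌈c₀⌉₊ := by
    calc (2 : ℝ) ^ ⌈c₀ * Real.log N⌉₊ = (2 : ℝ) ^ (⌈c₀ * Real.log N⌉₊ : ℝ) :=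
          (Real.rpow_natCast _ _).symm
      _ ≤ (2 : ℝ) ^ (⌈c₀⌉₊ * Real.log N + 1) :=
          Real.rpow_le_rpow_of_exponent_le (by norm_num) (by linarith)
      _ = 2 * (2 : ℝ) ^ (⌈c₀⌉₊ * Real.log N) := by
          rw [Real.rpow_add (by norm_num), Real.rpow_one, mul_comm]
      _ ≤ 2 * (Real.exp 1) ^ (⌈c₀⌉₊ * Real.log N) := by
          have : (2 : ℝ) ≤ Real.exp 1 := by linarith [Real.add_one_le_exp (1 : ℝ)]
          gcongr
      _ = 2 * (N : ℝ) ^ ⌈c₀⌉₊ := by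
          rw [Real.exp_one_rpow, mul_comm (⌈c₀⌉₊ : ℝ), Real.exp_mul, Real.exp_log (by linarith),
            Real.rpow_natCast]
  have h4 : 2 ^ ⌈c₀ * Real.log N⌉₊ ≤ 2 * N ^ ⌈c₀⌉₊ := by exact_mod_cast h3
  calc _ ≤ 2 * N ^ ⌈c₀⌉₊ := h4
    _ ≤ (N + 1) * (N + 1) ^ ⌈c₀⌉₊ := Nat.mul_le_mul (by omega) (Nat.pow_le_pow_left (by omega) _)
    _ = (N + 1) ^ (⌈c₀⌉₊ + 1) := by rw [pow_succ, mul_comm]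

lemma two_pow_wordBits (w size : ℕ) :
    2 ^ wordBits w size = (2 ^ (Nat.log 2 size + 1)) ^ w := by
  rw [wordBits, mul_comm, pow_mul]

/-- Words of length `2 x + 4` times the logarithm of the input size hold the products of numbers
up to `(N + 1) ^ x`. -/
lemma eight_mul_sq_lt {N d : ℕ} (hd : N = 1 ∨ 1 ≤ d) (x : ℕ) :
    8 * ((N + 1) ^ x * (N + 1) ^ x) < 2 ^ wordBits (2 * x + 4) (N * d) := by
  rw [two_pow_wordBits]
  set ν := 2 ^ (Nat.log 2 (N * d) + 1) with hν
  have h2 : 2 ≤ ν := Nat.le_self_pow (by omega) 2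
  have h1 : N + 1 ≤ ν := by
    rcases hd with rfl | hd
    · exact h2
    · have := Nat.lt_pow_succ_log_self (by norm_num : 1 < 2) (N * d)
      have h3 : N ≤ N * d := Nat.le_mul_of_pos_right _ hd
      exact Nat.succ_le_of_lt (h3.trans_lt this)
  have h3 : (N + 1) ^ x ≤ ν ^ x := Nat.pow_le_pow_left h1 x
  have h4 : 2 ^ 4 ≤ ν ^ 4 := Nat.pow_le_pow_left h2 4
  have h5 : 0 < (N + 1) ^ x * (N + 1) ^ x := by positivity
  calc 8 * ((N + 1) ^ x * (N + 1) ^ x) < 2 ^ 4 * ((N + 1) ^ x * (N + 1) ^ x) := by omega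
    _ ≤ ν ^ 4 * (ν ^ x * ν ^ x) := Nat.mul_le_mul h4 (Nat.mul_le_mul h3 h3)
    _ = ν ^ (2 * x + 4) := by rw [← pow_add, ← pow_add]; congr 1; omega

lemma two_pow_wordBits_le {w size N : ℕ} (h1 : 1 ≤ size) (hN : size ≤ N) :
    2 ^ wordBits w size ≤ (N + 1) ^ (2 * w) := by
  rw [two_pow_wordBits, pow_mul]
  refine Nat.pow_le_pow_left ?_ w
  have h2 := Nat.pow_log_le_self 2 (by omega : size ≠ 0)
  calc 2 ^ (Nat.log 2 size + 1) = 2 ^ Nat.log 2 size * 2 := pow_succ _ _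
    _ ≤ N * 2 := Nat.mul_le_mul_right _ (h2.trans hN)
    _ ≤ (N + 1) ^ 2 := by rw [sq]; nlinarith

/-- The relations between the parameters of the reduction and the size of the input: `D` bounds the
dimension, and `x` the words of the reduction. -/
structure Params.Suit (p : Params) (D x N d r : ℕ) : Prop where
  z_ge : 7 ≤ p.z
  Z_ge : p.z + 2 ≤ p.Z
  f₁_le : p.f₁ ≤ p.Z
  f₂_eq : p.f₂ = p.z - 5
  C_ge : 1 ≤ p.C
  R_ge : 5 ≤ p.R
  s_ge : D + 3 ≤ p.s
  x_ge : p.s + D + p.Z + p.R + 5 ≤ x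
  N_ge : 10 ≤ N
  C_le : p.C ≤ N
  r_pos : 1 ≤ r
  r_le : r ^ p.Z ≤ N
  lt_r : N < (r + 1) ^ p.Z
  d_lt : d + 1 ≤ r
  d_le : 2 ^ d ≤ (N + 1) ^ D

section Bounds

variable {p : Params} {D x N d r : ℕ} {A B : ℕ → ℕ} {bits : ℕ}

lemma Params.Suit.pow_le (h : p.Suit D x N d r) {a : ℕ} (ha : a ≤ p.Z) : r ^ a ≤ N :=
  (Nat.pow_le_pow_right h.r_pos ha).trans h.r_le

lemma Params.Suit.valid (h : p.Suit D x N d r) (hA : ∀ i, A i ≤ 1) (hB : ∀ i, B i ≤ 1)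
    (hbits : 8 * ((N + 1) ^ x * (N + 1) ^ x) < 2 ^ bits) :
    (p.ctx bits ((N + 1) ^ x) N d r A B).Valid := by
  have hz := h.z_ge
  have hZ := h.Z_ge
  have hs := h.s_ge
  have hx := h.x_ge
  have hN := h.N_ge
  have mono : ∀ {a b : ℕ}, a ≤ b → (N + 1) ^ a ≤ (N + 1) ^ b :=
    fun hab => Nat.pow_le_pow_right (by omega) hab
  have e2 : (N + 1) ^ 2 = (N + 1) * (N + 1) := sq _
  have h2x : (N + 1) ^ 2 ≤ (N + 1) ^ x := mono (by omega)
  have h2s : (N + 1) ^ 2 ≤ (N + 1) ^ p.s := mono (by omega)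
  have hNN : 11 * (N + 1) ≤ (N + 1) * (N + 1) := Nat.mul_le_mul_right _ (by omega)
  have hn : r ^ p.z ≤ N := h.pow_le (by omega)
  have hf : ∀ {a : ℕ}, a ≤ p.Z → p.C * r ^ a ≤ (N + 1) ^ p.s := by
    intro a ha
    have : p.C * r ^ a ≤ (N + 1) * (N + 1) :=
      Nat.mul_le_mul (h.C_le.trans (by omega)) ((h.pow_le ha).trans (by omega))
    omega
  refine ⟨hbits, ?_, hA, hB, ?_, hn, ?_, h.r_pos, ?_, ?_, h.R_ge, ?_, hf h.f₁_le, hf ?_⟩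
  · show 5 ≤ (N + 1) ^ x
    omega
  · exact h.d_le.trans (mono (by omega))
  · show N + r ^ p.z ≤ (N + 1) ^ x
    omega
  · show r * r + 2 ^ d + r ^ p.z * r + r ^ p.z + r + 8 ≤ (N + 1) ^ p.s
    have h1 : r * r ≤ N := by rw [← sq]; exact h.pow_le (by omega)
    have h2 : r ^ p.z * r ≤ N := by rw [← pow_succ]; exact h.pow_le (by omega)
    have h3 : r ≤ N := by rw [← pow_one r]; exact h.pow_le (by omega)
    have h4 : (N + 1) ^ D * 1 ≤ (N + 1) ^ D * (N + 1) := Nat.mul_le_mul_left _ (by omega)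
    have h5 : (N + 1) ^ 1 ≤ (N + 1) ^ (D + 1) := mono (by omega)
    have h6 : 11 * (N + 1) ^ (D + 1) ≤ (N + 1) * (N + 1) ^ (D + 1) :=
      Nat.mul_le_mul_right _ (by omega)
    have h7 : (N + 1) * (N + 1) ^ (D + 1) ≤ (N + 1) ^ p.s := by
      rw [← pow_succ']; exact mono (by omega)
    have h8 := h.d_le
    rw [← pow_succ, mul_one] at h4
    rw [pow_one] at h5
    omega
  · exact mono (by omega)
  · refine (Nat.lt_two_pow_self (n := p.R)).le.trans ?_
    calc 2 ^ p.R ≤ (N + 1) ^ p.R := Nat.pow_le_pow_left (by omega) _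
      _ ≤ (N + 1) ^ x := mono (by omega)
  · rw [h.f₂_eq]; omega

/-- The memory that all guesses need is within the word size. -/
lemma Params.Suit.memory_le (h : p.Suit D x N d r) {c : Ctx}
    (hc : c = p.ctx bits ((N + 1) ^ x) N d r A B) :
    c.S + c.S * (N + 1) * c.guesses ≤ (N + 1) ^ x := by
  have hz := h.z_ge
  have hZ := h.Z_ge
  have hx := h.x_ge
  have hN := h.N_ge
  have hg : c.guesses ≤ (N + 1) ^ (D + 2) := by
    have h1 : r ^ 3 ≤ N + 1 := (h.pow_le (by omega)).trans (by omega)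
    have h2 : d + 1 ≤ (N + 1) ^ D := (Nat.lt_two_pow_self (n := d)).trans_le h.d_le
    have h3 : N / r ^ p.z ≤ N := Nat.div_le_self _ _
    rw [hc]
    calc r ^ 3 * (d + 1) * (N / r ^ p.z + 1) ≤ (N + 1) * (N + 1) ^ D * (N + 1) :=
          Nat.mul_le_mul (Nat.mul_le_mul h1 h2) (by omega)
      _ = (N + 1) ^ (D + 2) := by ring
  have hS : c.S = (N + 1) ^ p.s := by rw [hc]; rfl
  have h1 : (N + 1) ^ p.s ≤ (N + 1) ^ (p.s + D + 3) := Nat.pow_le_pow_right (by omega) (by omega)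
  rw [hS]
  calc (N + 1) ^ p.s + (N + 1) ^ p.s * (N + 1) * c.guesses
      ≤ (N + 1) ^ (p.s + D + 3) + (N + 1) ^ p.s * (N + 1) * (N + 1) ^ (D + 2) :=
        Nat.add_le_add h1 (Nat.mul_le_mul_left _ hg)
    _ = (N + 1) ^ (p.s + D + 3) * 2 := by ring
    _ ≤ (N + 1) ^ (p.s + D + 3) * (N + 1) := Nat.mul_le_mul_left _ (by omega)
    _ = (N + 1) ^ (p.s + D + 4) := (pow_succ _ _).symm
    _ ≤ (N + 1) ^ x := Nat.pow_le_pow_right (by omega) (by omega)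

lemma Params.Suit.root_le (h : p.Suit D x N d r) : (r + 1) ^ p.Z ≤ (N + 1) ^ x := by
  have hx := h.x_ge
  have hN := h.N_ge
  have hr := h.r_pos
  calc (r + 1) ^ p.Z ≤ (2 * r) ^ p.Z := Nat.pow_le_pow_left (by omega) _
    _ = 2 ^ p.Z * r ^ p.Z := mul_pow _ _ _
    _ ≤ (N + 1) ^ p.Z * (N + 1) :=
        Nat.mul_le_mul (Nat.pow_le_pow_left (by omega) _) (h.r_le.trans (by omega))
    _ = (N + 1) ^ (p.Z + 1) := (pow_succ _ _).symm
    _ ≤ (N + 1) ^ x := Nat.pow_le_pow_right (by omega) (by omega)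

/-- The constant factor in the time of a guess. -/
def Params.groupFactor (p : Params) (pre qry : Prog) : ℕ :=
  133 + 3 * p.R + clockCost pre * (p.C + 1) + clockCost qry * (p.C + 1)

lemma Params.Suit.groupTime_le (h : p.Suit D x N d r) {X : ℕ} (pre qry : Prog) :
    (p.ctx bits X N d r A B).groupTime pre qry + 2 ≤
      p.groupFactor pre qry * (N * r ^ (p.z - 5)) := by
  have hz := h.z_ge
  have hZ := h.Z_ge
  have hN := h.N_ge
  have hr := h.r_pos
  have hd := h.d_lt
  set W := r ^ (p.z - 5) with hW
  have hW1 : 1 ≤ W := Nat.one_le_pow _ _ hr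
  have hrW : r * r ≤ W := by rw [← sq]; exact Nat.pow_le_pow_right hr (by omega)
  have hrr : r ≤ r * r := Nat.le_mul_self r
  have hNW : N ≤ N * W := Nat.le_mul_of_pos_right _ hW1
  have hq : (p.ctx bits X N d r A B).queryTime qry + 2 ≤
      (65 + p.R + clockCost qry * (p.C + 1)) * W := by
    have h1 : r * (d * 9 + 26) ≤ r * (35 * r) := Nat.mul_le_mul_left _ (by omega)
    have h2 : clockCost qry * (p.C * W + 1) ≤ clockCost qry * (p.C + 1) * W := by
      rw [mul_assoc]
      exact Nat.mul_le_mul_left _ (by rw [Nat.succ_mul]; omega)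
    have h3 : p.R ≤ p.R * W := Nat.le_mul_of_pos_right _ hW1
    have h4 : r * (35 * r) = 35 * (r * r) := by ring
    have h5 : (65 + p.R + clockCost qry * (p.C + 1)) * W =
        65 * W + p.R * W + clockCost qry * (p.C + 1) * W := by ring
    show r * (d * 9 + 26) + p.R + clockCost qry * (p.C * r ^ p.f₂ + 1) + d * 8 + 20 + 2 ≤ _
    rw [h.f₂_eq, ← hW, h5]
    omega
  have h1 : r ^ p.z * r * (d * 11 + 23) ≤ 34 * (N * W) := by
    calc r ^ p.z * r * (d * 11 + 23) ≤ r ^ p.z * r * (34 * r) := Nat.mul_le_mul_left _ (by omega)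
      _ = 34 * r ^ (p.z + 2) := by ring
      _ ≤ 34 * (N * W) := Nat.mul_le_mul_left _ ((h.pow_le (by omega)).trans hNW)
  have h2 : clockCost pre * (p.C * r ^ p.f₁ + 1) ≤ clockCost pre * (p.C + 1) * (N * W) := by
    rw [mul_assoc]
    refine Nat.mul_le_mul_left _ ?_
    have : p.C * r ^ p.f₁ ≤ p.C * (N * W) :=
      Nat.mul_le_mul_left _ ((h.pow_le h.f₁_le).trans hNW)
    rw [Nat.succ_mul]; omega
  have h3 : p.R ≤ p.R * (N * W) := Nat.le_mul_of_pos_right _ (by omega)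
  have h4 : N * ((p.ctx bits X N d r A B).queryTime qry + 2) ≤
      N * ((65 + p.R + clockCost qry * (p.C + 1)) * W) := Nat.mul_le_mul_left _ hq
  have h5 : N * ((65 + p.R + clockCost qry * (p.C + 1)) * W) =
      65 * (N * W) + p.R * (N * W) + clockCost qry * (p.C + 1) * (N * W) := by ring
  have h6 : p.groupFactor pre qry * (N * W) = 133 * (N * W) + 3 * (p.R * (N * W)) +
      clockCost pre * (p.C + 1) * (N * W) + clockCost qry * (p.C + 1) * (N * W) := by
    rw [Params.groupFactor]; ring
  show r ^ p.z * r * (d * 11 + 23) + 2 * p.R + clockCost pre * (p.C * r ^ p.f₁ + 1) +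
    N * ((p.ctx bits X N d r A B).queryTime qry + 2) + 32 + 2 ≤ _
  rw [h6]
  omega

/-- The constant factor in the time of the reduction. -/
def Params.factor (p : Params) (pre qry : Prog) : ℕ :=
  2 * p.groupFactor pre qry + (p.Z + 5 + 2 + p.z + p.s + p.f₁ + p.f₂ + 33)

lemma Params.Suit.time_le (h : p.Suit D x N d r) {X t : ℕ} {pre qry : Prog} {c : Ctx}
    (hc : c = p.ctx bits X N d r A B)
    (ht : t ≤ c.guesses * (c.groupTime pre qry + 2) +
      (N * (p.Z + 5 + 2) + p.z + p.s + p.f₁ + p.f₂ + 33)) :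
    t * r ≤ p.factor pre qry * (N * N) := by
  have hz := h.z_ge
  have hZ := h.Z_ge
  have hN := h.N_ge
  have hr := h.r_pos
  have hgt : c.groupTime pre qry + 2 ≤ p.groupFactor pre qry * (N * r ^ (p.z - 5)) := by
    rw [hc]; exact h.groupTime_le pre qry
  have hg : c.guesses * (r ^ (p.z - 5) * r) ≤ 2 * N := by
    have h1 : c.guesses ≤ r ^ 4 * (N / r ^ p.z + 1) := by
      rw [hc]
      calc r ^ 3 * (d + 1) * (N / r ^ p.z + 1) ≤ r ^ 3 * r * (N / r ^ p.z + 1) :=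
            Nat.mul_le_mul_right _ (Nat.mul_le_mul_left _ h.d_lt)
        _ = r ^ 4 * (N / r ^ p.z + 1) := by ring
    have e : r ^ p.z = r ^ 4 * (r ^ (p.z - 5) * r) := by
      rw [← pow_succ, ← pow_add]; congr 1; omega
    calc c.guesses * (r ^ (p.z - 5) * r)
        ≤ r ^ 4 * (N / r ^ p.z + 1) * (r ^ (p.z - 5) * r) := Nat.mul_le_mul_right _ h1
      _ = (N / r ^ p.z + 1) * (r ^ 4 * (r ^ (p.z - 5) * r)) := by ring
      _ = N / r ^ p.z * r ^ p.z + r ^ p.z := by rw [← e]; ring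
      _ ≤ N + N := Nat.add_le_add (Nat.div_mul_le_self _ _) (h.pow_le (by omega))
      _ = 2 * N := by ring
  have hrN : r ≤ N := by rw [← pow_one r]; exact h.pow_le (by omega)
  set E := p.z + p.s + p.f₁ + p.f₂ + 33 with hE
  have h2 : N * (p.Z + 5 + 2) + E ≤ (p.Z + 5 + 2 + E) * N := by
    have : E ≤ E * N := Nat.le_mul_of_pos_right _ (by omega)
    calc _ ≤ N * (p.Z + 5 + 2) + E * N := Nat.add_le_add_left this _
      _ = _ := by ring
  calc t * r ≤ (c.guesses * (p.groupFactor pre qry * (N * r ^ (p.z - 5))) +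
        (p.Z + 5 + 2 + E) * N) * r := by
        refine Nat.mul_le_mul_right _ (ht.trans ?_)
        have h3 := Nat.mul_le_mul_left c.guesses hgt
        omega
    _ = p.groupFactor pre qry * N * (c.guesses * (r ^ (p.z - 5) * r)) +
        (p.Z + 5 + 2 + E) * N * r := by ring
    _ ≤ p.groupFactor pre qry * N * (2 * N) + (p.Z + 5 + 2 + E) * N * N :=
        Nat.add_le_add (Nat.mul_le_mul_left _ hg) (Nat.mul_le_mul_left _ hrN)
    _ = p.factor pre qry * (N * N) := by rw [Params.factor, hE]; ring

end Bounds

lemma le_rpow_of_mul_le {Z N r t K : ℕ} (hZ : Z ≠ 0) (hN : 1 ≤ N) (hr : 1 ≤ r)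
    (hNr : N < (r + 1) ^ Z) (ht : t * r ≤ K * (N * N)) :
    (t : ℝ) ≤ 2 * K * (N : ℝ) ^ (2 - 1 / (Z : ℝ)) := by
  have hN0 : (0 : ℝ) < N := by exact_mod_cast hN
  have h1 : (N : ℝ) ^ (1 / (Z : ℝ)) ≤ 2 * r := by
    have h2 : (N : ℝ) ≤ (2 * r : ℝ) ^ Z := by
      have : N ≤ (2 * r) ^ Z := hNr.le.trans (Nat.pow_le_pow_left (by omega) Z)
      exact_mod_cast this
    calc (N : ℝ) ^ (1 / (Z : ℝ)) ≤ ((2 * r : ℝ) ^ Z) ^ (1 / (Z : ℝ)) :=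
          Real.rpow_le_rpow hN0.le h2 (by positivity)
      _ = 2 * r := by rw [one_div, Real.pow_rpow_inv_natCast (by positivity) hZ]
  have h3 : (t : ℝ) * r ≤ K * (N * N) := by exact_mod_cast ht
  rw [Real.rpow_sub hN0, Real.rpow_two, ← mul_div_assoc, le_div_iff₀ (by positivity)]
  calc (t : ℝ) * (N : ℝ) ^ (1 / (Z : ℝ)) ≤ t * (2 * r) := by gcongr
    _ = 2 * (t * r) := by ring
    _ ≤ 2 * (K * (N * N)) := by gcongr
    _ = 2 * K * (N : ℝ) ^ 2 := by ring

end WordRAM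

/-! ### The reduction -/

lemma mul_rpow_lt {C a : ℝ} {C' r z f : ℕ} (hC : C < C') (hr : 1 ≤ r) (h : z * a ≤ f) :
    C * ((r ^ z : ℕ) : ℝ) ^ a < ((C' * r ^ f : ℕ) : ℝ) := by
  have hr' : (1 : ℝ) ≤ r := by exact_mod_cast hr
  have h1 : ((r ^ z : ℕ) : ℝ) ^ a ≤ (r : ℝ) ^ f := by
    rw [Nat.cast_pow, ← Real.rpow_natCast, ← Real.rpow_mul (by linarith), ← Real.rpow_natCast]
    exact Real.rpow_le_rpow_of_exponent_le hr' h
  have h2 : 0 < ((r ^ z : ℕ) : ℝ) ^ a := by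
    have : 0 < r ^ z := pow_pos hr z
    positivity
  push_cast at h1 h2 ⊢
  calc C * ((r : ℝ) ^ z) ^ a < C' * ((r : ℝ) ^ z) ^ a := by gcongr
    _ ≤ C' * (r : ℝ) ^ f := by gcongr

lemma exists_root {Z : ℕ} (hZ : Z ≠ 0) (N : ℕ) : ∃ r, r ^ Z ≤ N ∧ N < (r + 1) ^ Z := by
  have h0 : (0 : ℕ) ^ Z ≤ N := by rw [zero_pow hZ]; exact Nat.zero_le _
  refine ⟨Nat.findGreatest (fun r => r ^ Z ≤ N) N, ?_, ?_⟩
  · exact Nat.findGreatest_spec (P := fun r => r ^ Z ≤ N) (Nat.zero_le N) h0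
  · by_contra h
    push Not at h
    have h1 := Nat.le_findGreatest (P := fun r => r ^ Z ≤ N)
      ((Nat.le_self_pow hZ _).trans h) h
    omega

namespace WordRAM

/-- If the data structure works for `n = r ^ z` curves, then one of the guesses is successful. -/
lemma exists_succeeds {p : Params} {D x N d r bits : ℕ} {A B : Fin N → Fin d → Bool}
    (h : p.Suit D x N d r) {pre qry : Prog} {w e K m : ℕ} {ε T₁ T₂ : ℝ} {c : Ctx}
    (hc : c = p.ctx bits ((N + 1) ^ x) N d r (vectorTable A) (vectorTable B))
    (hann : SolvesANN pre qry w e (2 - ε) (r ^ p.z) m K T₁ T₂) (hε : 0 < ε) (he : 1 ≤ e)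
    (hinj : Function.Injective A) (hT₁ : T₁ < (p.C * r ^ p.f₁ : ℕ))
    (hT₂ : T₂ < (p.C * r ^ p.f₂ : ℕ)) (hs : 2 * w ≤ p.s) (hK : 6 ≤ K) (hd : 1 ≤ d) (hKm : K ≤ m)
    (hmr : m < r)
    (hroom : 2 * ((K - 2) / 2 * 2 ^ ((d + (K - 2) / 2 - 1) / ((K - 2) / 2))) + 3 ≤ m)
    (ho : HasOrthogonalPair A B) : ∃ u < c.guesses, c.Succeeds (c.guess u) pre qry := by
  subst hc
  obtain ⟨i₀, hi₀, j, hj, ho⟩ := (hasOrthogonalPair_iff A B).mp ho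
  have hz := h.z_ge
  have hZ := h.Z_ge
  set b := (K - 2) / 2 with hb
  set l := (d + b - 1) / b with hl
  have hb2 : 2 ≤ b := by omega
  have hld : l ≤ d := by
    refine Nat.lt_succ_iff.mp ((Nat.div_lt_iff_lt_mul (by omega)).mpr ?_)
    have : d ≤ d * b := Nat.le_mul_of_pos_right _ (by omega)
    rw [Nat.succ_mul]; omega
  have hcover : d ≤ b * l := by
    have h1 := Nat.div_add_mod (d + b - 1) b
    have h2 := Nat.mod_lt (d + b - 1) (by omega : b > 0)
    rw [← hl] at h1
    omega
  have hLr : 2 ^ l < r := by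
    have : 2 ^ l ≤ b * 2 ^ l := Nat.le_mul_of_pos_left _ (by omega)
    omega
  have hrn : r ≤ r ^ p.z := Nat.le_self_pow (by omega) r
  obtain ⟨u, hu, i, hi, ek, em, el, eL, est⟩ := exists_guess
    (c := p.ctx bits ((N + 1) ^ x) N d r (vectorTable A) (vectorTable B))
    (Nat.one_le_pow _ _ h.r_pos) (h.pow_le (by omega)) rfl (hKm.trans_lt hmr) hmr hld hLr hi₀
  set c := p.ctx bits ((N + 1) ^ x) N d r (vectorTable A) (vectorTable B) with hc
  set g := c.guess u with hg
  have hnm : r ^ p.z * m ≤ N := by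
    calc r ^ p.z * m ≤ r ^ p.z * r := Nat.mul_le_mul_left _ hmr.le
      _ = r ^ (p.z + 1) := (pow_succ _ _).symm
      _ ≤ N := h.pow_le (by omega)
  have hnm1 : 1 ≤ r ^ p.z * m := Nat.mul_pos (by omega) (by omega)
  refine ⟨u, hu, succeeds_of_solvesANN (A := A) (B := B) (i := i) (j := j)
    (by rw [ek, em]; exact hann) hε he ?_ rfl rfl hinj ?_ hT₁ hT₂ ?_ hi hj ?_⟩
  · refine ⟨by rw [ek]; omega, by rw [el, eL], by rw [ek, el]; exact hcover,
      by rw [ek, eL, em]; exact hroom, ?_⟩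
    rw [em]
    have : 6 * m ≤ r ^ p.z * m := Nat.mul_le_mul_right _ (by omega)
    show m + 3 ≤ r ^ p.z * m
    omega
  · have hn : r ^ p.z ≤ N := h.pow_le (by omega)
    show (if N - r ^ p.z < u % c.G * r ^ p.z then N - r ^ p.z else u % c.G * r ^ p.z) + r ^ p.z ≤ N
    split_ifs <;> omega
  · rw [em]
    refine (two_pow_wordBits_le hnm1 hnm).trans ?_
    exact Nat.pow_le_pow_right (by omega) hs
  · rw [est]; exact ho

lemma SolvesOV.mono {p : Prog} {w N d : ℕ} {T T' : ℝ} (h : SolvesOV p w N d T) (hT : T ≤ T') :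
    SolvesOV p w N d T' := by
  intro A B hA hB
  obtain ⟨t, s, hex, ht, hs⟩ := h A B hA hB
  exact ⟨t, s, hex, ht.trans hT, hs⟩

lemma solvesOV_of_lt {p : Params} {N₀ D x N d : ℕ} {pre qry : Prog} (hN : 1 ≤ N)
    (hdim : N = 1 ∨ 1 ≤ d) (hd : 2 ^ d ≤ (N + 1) ^ D) (hx : N₀ + D + 1 ≤ x) (hlt : N < N₀) :
    SolvesOV (reduction p N₀ pre qry) (2 * x + 4) N d
      (N₀ * N₀ * ((N₀ + 1) ^ D * 8 + 9 + 2) + 8 : ℕ) := by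
  intro A B _ _
  have hdD : d ≤ (N + 1) ^ D := (Nat.lt_two_pow_self (n := d)).le.trans hd
  have hDx : (N + 1) ^ D ≤ (N + 1) ^ x := Nat.pow_le_pow_right (by omega) (by omega)
  have hx2 : x < (N + 1) ^ x :=
    (Nat.lt_two_pow_self (n := x)).trans_le (Nat.pow_le_pow_left (by omega) x)
  obtain ⟨t, s, hex, ht, hs⟩ := reduction_spec_of_lt (p := p) (pre := pre) (qry := qry)
    (eight_mul_sq_lt hdim x) (by omega) (by omega : N₀ ≤ (N + 1) ^ x) (hdD.trans hDx) hlt A B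
  refine ⟨t, s, hex, ?_, hs⟩
  refine Nat.cast_le.mpr (ht.trans (Nat.add_le_add_right (Nat.mul_le_mul ?_ ?_) 8))
  · exact Nat.mul_le_mul hlt.le hlt.le
  · have : (N + 1) ^ D ≤ (N₀ + 1) ^ D := Nat.pow_le_pow_left (by omega) D
    omega

lemma solvesOV_of_le {p : Params} {N₀ D x N d r : ℕ} (h : p.Suit D x N d r) {pre qry : Prog}
    {w e K m : ℕ} {ε T₁ T₂ : ℝ} (hp : Fits p.R pre) (hq : Fits p.R qry)
    (hann : SolvesANN pre qry w e (2 - ε) (r ^ p.z) m K T₁ T₂) (hε : 0 < ε) (he : 1 ≤ e)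
    (hT₁ : T₁ < (p.C * r ^ p.f₁ : ℕ)) (hT₂ : T₂ < (p.C * r ^ p.f₂ : ℕ)) (hs : 2 * w ≤ p.s)
    (hK : 6 ≤ K) (hd : 1 ≤ d) (hKm : K ≤ m) (hmr : m < r)
    (hroom : 2 * ((K - 2) / 2 * 2 ^ ((d + (K - 2) / 2 - 1) / ((K - 2) / 2))) + 3 ≤ m)
    (hge : N₀ ≤ N) :
    SolvesOV (reduction p N₀ pre qry) (2 * x + 4) N d
      (2 * p.factor pre qry * (N : ℝ) ^ (2 - 1 / (p.Z : ℝ))) := by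
  intro A B hA _
  have hN := h.N_ge
  have hZ := h.Z_ge
  obtain ⟨t, s, hex, ht, hs⟩ := reduction_spec_of_le hp hq A B (by omega) h.C_ge hge h.r_le h.lt_r
    h.root_le rfl (h.valid (vectorTable_le A) (vectorTable_le B) (eight_mul_sq_lt (.inr hd) x))
    (h.memory_le rfl) (exists_succeeds h rfl hann hε he hA hT₁ hT₂ hs hK hd hKm hmr hroom)
  exact ⟨t, s, hex, le_rpow_of_mul_le (by omega) (by omega) h.r_pos h.lt_r (h.time_le rfl ht), hs⟩

lemma le_inputComplexity {c : ℝ} (hc : 0 ≤ c) {n : ℕ} (hn : 1 ≤ n) (k : ℕ) :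
    k ≤ inputComplexity c n k := by
  have h1 : (1 : ℝ) ≤ (n : ℝ) ^ (c / (k : ℝ)) :=
    Real.one_le_rpow (by exact_mod_cast hn) (by positivity)
  have h2 : (k : ℝ) ≤ inputComplexity c n k :=
    (le_mul_of_one_le_right (Nat.cast_nonneg _) h1).trans (Nat.le_ceil _)
  exact_mod_cast h2

end WordRAM

open WordRAM in
theorem theorem6 (hOVH : OVH) (ε ε' β : ℝ) (hε : 0 < ε) (hε' : 0 < ε') (hβ : 0 < β) :
    ∃ c : ℝ, 0 < c ∧
      ∀ k : ℕ → ℕ, Filter.Tendsto k Filter.atTop Filter.atTop →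
        (fun n : ℕ => (k n : ℝ)) =o[Filter.atTop] (fun n : ℕ => Real.log (n : ℝ)) →
        ∀ e : ℕ, 1 ≤ e →
          ¬ ∃ (pre qry : WordRAM.Prog) (w : ℕ) (C : ℝ),
            ∀ n : ℕ, 0 < n → 2 ≤ k n →
              SolvesANN pre qry w e (2 - ε) n (inputComplexity c n (k n)) (k n)
                (C * (n : ℝ) ^ β) (C * (n : ℝ) ^ (1 - ε')) := by
  -- `n = r ^ z`: the queries of all groups save a factor `r ^ 5`, of which the guesses cost `r ^ 4`
  obtain ⟨z, hz7, hzε⟩ : ∃ z : ℕ, 7 ≤ z ∧ 5 ≤ z * ε' := by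
    refine ⟨max 7 ⌈5 / ε'⌉₊, le_max_left _ _, ?_⟩
    rw [← div_le_iff₀ hε']
    exact (Nat.le_ceil _).trans (by exact_mod_cast le_max_right _ _)
  -- `r ^ Z ≤ N` makes the preprocessing of a group take time `O(N)`
  obtain ⟨Z, hZ⟩ : ∃ Z, Z = z * ⌈β⌉₊ + z + 2 := ⟨_, rfl⟩
  obtain ⟨c₀, hc₀, hno⟩ := hOVH (1 / (Z : ℝ))
    (one_div_pos.mpr (by exact_mod_cast (by omega : 0 < Z)))
  have hz0 : (0 : ℝ) < z := by exact_mod_cast (by omega : 0 < z)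
  refine ⟨8 * c₀ * Z / z + 1, by positivity, fun k hk hlog e he => ?_⟩
  rintro ⟨pre, qry, w, C, hann⟩
  refine hno ?_
  obtain ⟨R₁, hR₁⟩ := exists_fits pre
  obtain ⟨R₂, hR₂⟩ := exists_fits qry
  obtain ⟨C', hCC', hC'⟩ : ∃ C' : ℕ, C < C' ∧ 1 ≤ C' :=
    ⟨⌈C⌉₊ + 1, by push_cast; linarith [Nat.le_ceil C], Nat.succ_pos _⟩
  obtain ⟨D, hD⟩ : ∃ D, D = ⌈c₀⌉₊ + 1 := ⟨_, rfl⟩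
  obtain ⟨r₀, hr₀⟩ := Filter.eventually_atTop.mp
    (eventually_parameters hc₀ (by omega : 1 ≤ z) (by omega : 1 ≤ Z) hk hlog)
  obtain ⟨N₀, hN₀⟩ : ∃ N₀, N₀ = (r₀ + 1) ^ Z + C' + 10 := ⟨_, rfl⟩
  -- words of the simulation are at least as long as those of the data structure, since `n m ≤ N`
  set p : Params := ⟨Z, z, D + 3 + 2 * w, z * ⌈β⌉₊, z - 5, C', R₁ + R₂ + 5⟩ with hp
  obtain ⟨x, hx⟩ : ∃ x, x = D + 3 + 2 * w + D + Z + (R₁ + R₂ + 5) + 5 + N₀ := ⟨_, rfl⟩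
  obtain ⟨K, hK⟩ : ∃ K, K = N₀ * N₀ * ((N₀ + 1) ^ D * 8 + 9 + 2) + 8 := ⟨_, rfl⟩
  refine ⟨reduction p N₀ pre qry, 2 * x + 4, 2 * (p.factor pre qry : ℝ) + K, fun N hN => ?_⟩
  have hN1 : (1 : ℝ) ≤ N := by exact_mod_cast hN
  obtain ⟨d, hd⟩ : ∃ d, d = ⌈c₀ * Real.log N⌉₊ := ⟨_, rfl⟩
  have hdim : N = 1 ∨ 1 ≤ d := by
    rcases Nat.lt_or_ge 1 N with h | h
    · exact .inr (hd ▸ Nat.ceil_pos.mpr (mul_pos hc₀ (Real.log_pos (by exact_mod_cast h))))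
    · exact .inl (by omega)
  have hd2 : 2 ^ d ≤ (N + 1) ^ D := hd ▸ hD ▸ two_pow_dimension_le hc₀ hN
  have hexp : 0 ≤ 2 - 1 / (Z : ℝ) := by
    have hZ1 : (1 : ℝ) ≤ Z := by exact_mod_cast (by omega : 1 ≤ Z)
    have : 1 / (Z : ℝ) ≤ 1 := (div_le_one (by linarith)).mpr hZ1
    linarith
  have hNexp : 1 ≤ (N : ℝ) ^ (2 - 1 / (Z : ℝ)) := Real.one_le_rpow hN1 hexp
  have hK0 : (0 : ℝ) ≤ K := Nat.cast_nonneg _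
  have hfac : (0 : ℝ) ≤ p.factor pre qry := Nat.cast_nonneg _
  rw [← hd]
  rcases Nat.lt_or_ge N N₀ with hlt | hge
  · refine (solvesOV_of_lt hN hdim hd2 (by omega) hlt).mono ?_
    rw [← hK]
    calc (K : ℝ) = K * 1 := (mul_one _).symm
      _ ≤ (2 * (p.factor pre qry : ℝ) + K) * (N : ℝ) ^ (2 - 1 / (Z : ℝ)) :=
        mul_le_mul (by linarith) hNexp zero_le_one (by positivity)
  · obtain ⟨r, hrN, hNr⟩ := exists_root (by omega : Z ≠ 0) N
    have hr : r₀ + 1 ≤ r := by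
      by_contra hcon
      have := Nat.pow_le_pow_left (by omega : r + 1 ≤ r₀ + 1) Z
      omega
    obtain ⟨hK6, hmr, hpar⟩ := hr₀ r (by omega)
    obtain ⟨hdr, hroom⟩ := hpar N d _ hNr hd rfl
    have hn1 : 1 ≤ r ^ z := Nat.one_le_pow _ _ (by omega)
    have hsuit : p.Suit D x N d r := by
      constructor <;> (try simp only [hp]) <;> first | assumption | omega
    have hT₁ : C * ((r ^ z : ℕ) : ℝ) ^ β < ((C' * r ^ (z * ⌈β⌉₊) : ℕ) : ℝ) := by
      refine mul_rpow_lt hCC' (by omega) ?_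
      have := Nat.le_ceil β
      push_cast; gcongr
    have hT₂ : C * ((r ^ z : ℕ) : ℝ) ^ (1 - ε') < ((C' * r ^ (z - 5) : ℕ) : ℝ) := by
      refine mul_rpow_lt hCC' (by omega) ?_
      rw [Nat.cast_sub (by omega)]
      push_cast; linarith
    refine (solvesOV_of_le hsuit (hR₁.mono (by simp only [hp]; omega))
      (hR₂.mono (by simp only [hp]; omega)) (hann (r ^ z) hn1 (by omega)) hε he hT₁ hT₂
      (by simp only [hp]; omega) hK6 (by omega) (le_inputComplexity (by positivity) hn1 _) hmr hroom
      hge).mono ?_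
    exact mul_le_mul_of_nonneg_right (by linarith) (by linarith)
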